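/- Let $r\ge 2$, $n\ge 1$ be integers, $\kappa\neq 0$ an integer, $\kappa'=\gcd(n,\kappa)$, $m=n/\kappa'$, and fix a sign $\epsilon\in\{\pm1\}$. Let $\mathbb F=\mathbb C(q,k)$ and, for $N\ge1$, let $\mathbb K^{(N)}=\mathbb F(g^{(N)}_1,\dots,g^{(N)}_{\lfloor (N-1)/2\rfloor})$ be a rational function field. Define $g^{(N)}_j\in\mathbb K^{(N)}$ for all $j\in\mathbb Z$ by $g_0^{(N)}=-1$, $g^{(N)}_{N/2}=\epsilon^{-1}k^{-1}$ if $N$ is even, $g_j^{(N)}=k^{-2}(g^{(N)}_{N-j})^{-1}$ for $N/2<j<N$, and $N$-periodicity in $j$. Let $\iota_\kappa:\mathbb K^{(m)}\to\mathbb K^{(n)}$ be the $\mathbb F$-homomorphism with $g^{(m)}_j\mapsto g^{(n)}_{\kappa j}$, with image $\mathbb K^{(n,\kappa)}$, and let $\mathrm j_{\kappa'}:\mathbb K^{(m)}\to\mathbb K^{(n)}$ be the $\mathbb C(k)$-homomorphism with $q\mapsto q^{\kappa'^2}$ and $g^{(m)}_j\mapsto g^{(n)}_{\kappa' j}$ (for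 all $j\in\mathbb Z$). On Laurent polynomials in $x_1,\dots,x_r$ put $$\bar\iota_\kappa\Big(\sum_\nu c_\nu x^\nu\Big)=\sum_\nu\iota_\kappa(c_\nu)x^\nu,\qquad \bar{\mathrm j}_{\kappa'}\Big(\sum_\nu c_\nu x^\nu\Big)=\sum_\nu \mathrm j_{\kappa'}(c_\nu)x^{\kappa'\nu}.$$ On $\mathbb K^{(n,\kappa)}[x_1^{\pm1},\dots,x_r^{\pm1}]$ define linear operators, for $1\le i<r$ and $\alpha_i=\epsilon_i-\epsilon_{i+1}$, by $$T_i x^\lambda=(k-k^{-1})\,\frac{1-x^{-t\alpha_i}}{1-x^{m\alpha_i}}\,x^\lambda-k\,g^{(n)}_{-\kappa(\lambda_i-\lambda_{i+1})}\,x^{s_i\lambda},\qquad \omega x^\lambda=q^{-m\lambda_r}x^{(\lambda_r,\lambda_1,\dots,\lambda_{r-1})},$$ where $t$ is the largest multiple of $m$ with $t\le\lambda_i-\lambda_{i+1}$ and $s_i$ interchanges the $i$-th and $(i+1)$-st coordinates. Put $T_i^{-1}=T_i-(k-k^{-1})$, $Y_i=T_{i-1}^{-1}\cdots T_1^{-1}\,\omega\,T_{r-1}\cdots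 T_i$ and $Y^{ma}=Y_1^{a_1}\cdots Y_r^{a_r}$ for $a\in\mathbb Z^r$. Let $\sigma(s)=k^{-1}$ if $s$ is a positive multiple of $m$ and $\sigma(s)=-k\,g^{(n)}_{-\kappa s}$ for all other integers $s$. The metaplectic polynomial $E_\mu^{(n,\kappa)}\in\mathbb K^{(n,\kappa)}[x^{\pm1}]$ ($\mu\in\mathbb Z^r$) is the unique Laurent polynomial in which $x^\mu$ has coefficient $1$ and which satisfies, for all $a\in\mathbb Z^r$, $$Y^{ma}E_\mu^{(n,\kappa)}=q^{-m\sum_i a_i\mu_i}\prod_{1\le i<j\le r}\sigma(\mu_i-\mu_j)^{a_i-a_j}\;E_\mu^{(n,\kappa)} .$$ Write $E^{(N)}_\mu=E^{(N,1)}_\mu$. The monic nonsymmetric Macdonald polynomial $E_\mu(x;q)\in\mathbb F[x^{\pm1}]$ (with $t=k^2$) is the unique Laurent polynomial in which $x^\mu$ has coefficient $1$ and which satisfies $Y_iE_\mu=q^{-\mu_i}k^{e_i(\mu)}E_\mu$ for $1\le i\le r$, where $Y_i=T_{i-1}^{-1}\cdots T_1^{-1}\,\omega\,T_{r-1}\cdots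 T_i$ is built in the same way from $T_ix^\lambda=k\,x^{s_i\lambda}+(k-k^{-1})\frac{x^\lambda-x^{s_i\lambda}}{1-x_i/x_{i+1}}$ and $\omega x^\lambda=q^{-\lambda_r}x^{(\lambda_r,\lambda_1,\dots,\lambda_{r-1})}$, and $e_i(\mu)$ is the number of $j$ with $\mu_j>\mu_i$, or $\mu_j=\mu_i$ and $j>i$, minus the number of $j$ with $\mu_j<\mu_i$, or $\mu_j=\mu_i$ and $j<i$. **Proposition.** The polynomials $E^{(m)}_\mu$, $E^{(n,\kappa)}_\mu$, $E^{(n)}_\mu$ and $E_\mu(x;q)$ are well defined (they exist and are unique) for all $\mu\in\mathbb Z^r$, and for all $\mu\in\mathbb Z^r$ $$\bar\iota_\kappa\big(E_\mu^{(m)}\big)=E_\mu^{(n,\kappa)},\qquad \bar{\mathrm j}_{\kappa'}\big(E_\mu^{(m)}\big)=E_{\kappa'\mu}^{(n)} .$$ Consequently, for all $\mu\in\mathbb Z^r$, $E_{n\mu}^{(n)}(x)$ is the monic nonsymmetric Macdonald polynomial of degree $\mu$ in the variables $x_1^n,\dots,x_r^n$ with $q$ replaced by $q^{n^2}$: if $E_\mu(x;q)=\sum_\nu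 c_\nu(q,k)x^\nu$, then $E_{n\mu}^{(n)}=\sum_\nu c_\nu(q^{n^2},k)x^{n\nu}$. -/

import Mathlib

namespace Metaplectic

/-! ### The coefficient fields -/

/-- The field `ℂ(k)` of rational functions in `k` over `ℂ`. -/
def FieldCk : Type := FractionRing (Polynomial ℂ)

noncomputable instance : Field FieldCk := inferInstanceAs (Field (FractionRing (Polynomial ℂ)))

noncomputable instance : Algebra (Polynomial ℂ) FieldCk :=
  inferInstanceAs (Algebra (Polynomial ℂ) (FractionRing (Polynomial ℂ)))

instance : IsFractionRing (Polynomial ℂ) FieldCk :=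
  inferInstanceAs (IsFractionRing (Polynomial ℂ) (FractionRing (Polynomial ℂ)))

/-- The field `𝔽 = ℂ(q, k)`, realised as the rational functions in `q` over `ℂ(k)`. -/
def BaseField : Type := FractionRing (Polynomial FieldCk)

noncomputable instance : Field BaseField :=
  inferInstanceAs (Field (FractionRing (Polynomial FieldCk)))

noncomputable instance : Algebra (Polynomial FieldCk) BaseField :=
  inferInstanceAs (Algebra (Polynomial FieldCk) (FractionRing (Polynomial FieldCk)))

instance : IsFractionRing (Polynomial FieldCk) BaseField :=
  inferInstanceAs (IsFractionRing (Polynomial FieldCk) (FractionRing (Polynomial FieldCk)))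

noncomputable instance : Algebra FieldCk BaseField :=
  inferInstanceAs (Algebra FieldCk (FractionRing (Polynomial FieldCk)))

instance : IsScalarTower FieldCk (Polynomial FieldCk) BaseField :=
  inferInstanceAs (IsScalarTower FieldCk (Polynomial FieldCk)
    (FractionRing (Polynomial FieldCk)))

/-- The parameter `q` of `𝔽 = ℂ(q, k)`. -/
noncomputable def q : BaseField := algebraMap (Polynomial FieldCk) BaseField Polynomial.X

/-- The parameter `k` of `𝔽 = ℂ(q, k)`. -/
noncomputable def k : BaseField :=
  algebraMap FieldCk BaseField (algebraMap (Polynomial ℂ) FieldCk Polynomial.X)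

/-- The field `K⁽ⁿ⁾ = 𝔽(g₁, g₂, …)` of rational functions over `𝔽` in `⌊(n-1)/2⌋` variables
(this is `⌊n/2⌋` for `n` odd and `n/2 - 1` for `n ≥ 2` even). -/
def K (n : ℕ) : Type := FractionRing (MvPolynomial (Fin ((n - 1) / 2)) BaseField)

noncomputable instance (n : ℕ) : Field (K n) :=
  inferInstanceAs (Field (FractionRing (MvPolynomial (Fin ((n - 1) / 2)) BaseField)))

noncomputable instance (n : ℕ) : Algebra (MvPolynomial (Fin ((n - 1) / 2)) BaseField) (K n) :=
  inferInstanceAs (Algebra (MvPolynomial (Fin ((n - 1) / 2)) BaseField)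
    (FractionRing (MvPolynomial (Fin ((n - 1) / 2)) BaseField)))

instance (n : ℕ) : IsFractionRing (MvPolynomial (Fin ((n - 1) / 2)) BaseField) (K n) :=
  inferInstanceAs (IsFractionRing (MvPolynomial (Fin ((n - 1) / 2)) BaseField)
    (FractionRing (MvPolynomial (Fin ((n - 1) / 2)) BaseField)))

noncomputable instance (n : ℕ) : Algebra BaseField (K n) :=
  inferInstanceAs (Algebra BaseField
    (FractionRing (MvPolynomial (Fin ((n - 1) / 2)) BaseField)))

instance (n : ℕ) :
    IsScalarTower BaseField (MvPolynomial (Fin ((n - 1) / 2)) BaseField) (K n) :=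
  inferInstanceAs (IsScalarTower BaseField (MvPolynomial (Fin ((n - 1) / 2)) BaseField)
    (FractionRing (MvPolynomial (Fin ((n - 1) / 2)) BaseField)))

/-- The parameter `q` as an element of `K⁽ⁿ⁾`. -/
noncomputable def qK (n : ℕ) : K n := algebraMap BaseField (K n) q

/-- The parameter `k` as an element of `K⁽ⁿ⁾`. -/
noncomputable def kK (n : ℕ) : K n := algebraMap BaseField (K n) k

/-- The free variables of `K⁽ⁿ⁾`; the index `i` (starting from `0`) stands for `g_{i+1}`. -/
noncomputable def gVar (n : ℕ) (i : Fin ((n - 1) / 2)) : K n :=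
  algebraMap (MvPolynomial (Fin ((n - 1) / 2)) BaseField) (K n) (MvPolynomial.X i)

/-- The representation parameters `g_s⁽ⁿ⁾ ∈ K⁽ⁿ⁾` for `0 ≤ s < n`: they are `-1` for `s = 0`, the
`s`-th variable for `0 < s < n/2`, `ε⁻¹ k⁻¹` for `s = n/2`, and `k⁻² (g_{n-s})⁻¹` for
`n/2 < s < n`. The last line is not used: it only makes the function total. -/
noncomputable def gRem (ε : ℤˣ) (n : ℕ) (s : ℕ) : K n :=
  if h0 : s = 0 then -1
  else if h1 : 2 * s < n then gVar n ⟨s - 1, by omega⟩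
  else if h2 : 2 * s = n then (((ε⁻¹ : ℤˣ) : ℤ) : K n) * (kK n)⁻¹
  else if h3 : s < n then (kK n)⁻¹ ^ 2 * (gVar n ⟨n - s - 1, by omega⟩)⁻¹
  else 0

/-- The representation parameters `g_j⁽ⁿ⁾ = g_{r_n(j)}⁽ⁿ⁾` for all `j ∈ ℤ`, with `r_n(j)` the
remainder of `j` modulo `n`. -/
noncomputable def g (ε : ℤˣ) (n : ℕ) (j : ℤ) : K n := gRem ε n (j % (n : ℤ)).toNat

theorem gRem_lt (ε : ℤˣ) (n s : ℕ) (h0 : 0 < s) (h1 : 2 * s < n) :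
    gRem ε n s = gVar n ⟨s - 1, by omega⟩ := by
  unfold gRem
  rw [dif_neg (by omega), dif_pos h1]

theorem gRem_half (ε : ℤˣ) (n s : ℕ) (h0 : 0 < s) (h1 : 2 * s = n) :
    gRem ε n s = (((ε⁻¹ : ℤˣ) : ℤ) : K n) * (kK n)⁻¹ := by
  unfold gRem
  rw [dif_neg (by omega), dif_neg (by omega), dif_pos h1]

theorem gRem_gt (ε : ℤˣ) (n s : ℕ) (h1 : n < 2 * s) (h2 : s < n) :
    gRem ε n s = (kK n)⁻¹ ^ 2 * (gVar n ⟨n - s - 1, by omega⟩)⁻¹ := by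
  unfold gRem
  rw [dif_neg (by omega), dif_neg (by omega), dif_neg (by omega), dif_pos h2]

/-- `κ' = gcd(n, κ)`. -/
def kappa' (n : ℕ) (κ : ℤ) : ℕ := Int.gcd (n : ℤ) κ

/-- `m = n / gcd(n, κ)`. -/
def mOf (n : ℕ) (κ : ℤ) : ℕ := n / kappa' n κ

theorem mOf_mul_kappa' (n : ℕ) (κ : ℤ) : mOf n κ * kappa' n κ = n :=
  Nat.div_mul_cancel (by
    have := Int.gcd_dvd_left (n : ℤ) κ
    exact_mod_cast this)

instance (n : ℕ) (κ : ℤ) [NeZero n] : NeZero (mOf n κ) :=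
  ⟨fun h => NeZero.ne n (by rw [← mOf_mul_kappa' n κ, h, zero_mul])⟩

instance (n : ℕ) (κ : ℤ) [NeZero n] : NeZero (kappa' n κ) :=
  ⟨fun h => NeZero.ne n (by rw [← mOf_mul_kappa' n κ, h, mul_zero])⟩

theorem algebraicIndependent_of_gVar {n : ℕ} {ι : Type} (v : ι → K n)
    (σ : ι → Fin ((n - 1) / 2)) (hσ : Function.Injective σ) (c : BaseField) (hc : c ≠ 0)
    (hv : ∀ i, v i = gVar n (σ i) ∨ v i = algebraMap BaseField (K n) c * (gVar n (σ i))⁻¹) :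
    AlgebraicIndependent BaseField v := by
  classical
  have hcK : algebraMap BaseField (K n) c ≠ 0 := by simpa using hc
  have hg0 : ∀ j, gVar n j ≠ 0 := fun j => by
    unfold gVar
    simp
  obtain ⟨w, hw, hwv⟩ : ∃ w : Fin ((n - 1) / 2) → K n,
      (∀ j, w j = gVar n j ∨ w j = algebraMap BaseField (K n) c * (gVar n j)⁻¹) ∧
      w ∘ σ = v := by
    refine ⟨fun j => if h : ∃ i, σ i = j then v h.choose else gVar n j, fun j => ?_, ?_⟩
    · by_cases h : ∃ i, σ i = j
      · simp only [h, dite_true]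
        have h1 := hv h.choose
        rw [h.choose_spec] at h1
        exact h1
      · simp [h]
    · funext i
      have h : ∃ i', σ i' = σ i := ⟨i, rfl⟩
      simp only [Function.comp, h, dite_true]
      exact congrArg v (hσ h.choose_spec)
  rw [← hwv]
  refine AlgebraicIndependent.comp ?_ σ hσ
  have halg : Algebra.IsAlgebraic (Algebra.adjoin BaseField (Set.range w)) (K n) := by
    let S := Algebra.adjoin BaseField (Set.range w)
    have hS : ∀ j, IsAlgebraic S (w j) := fun j =>
      isAlgebraic_algebraMap (⟨w j, Algebra.subset_adjoin ⟨j, rfl⟩⟩ : S)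
    have hF : ∀ a : BaseField, IsAlgebraic S (algebraMap BaseField (K n) a) := fun a =>
      isAlgebraic_algebraMap (algebraMap BaseField S a)
    have hX : ∀ j, IsAlgebraic S (gVar n j) := fun j => by
      rcases hw j with h | h
      · rw [← h]; exact hS j
      · have : gVar n j = algebraMap BaseField (K n) c * (w j)⁻¹ := by
          have := hg0 j
          rw [h]; field_simp
        rw [this]
        exact (hF c).mul (hS j).inv
    have hP : ∀ p : MvPolynomial (Fin ((n - 1) / 2)) BaseField,
        IsAlgebraic S (algebraMap _ (K n) p) := fun p => by
      induction p using MvPolynomial.induction_on with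
      | C a => exact hF a
      | add p p' hp hp' => rw [map_add]; exact hp.add hp'
      | mul_X p j hp => rw [map_mul]; exact hp.mul (hX j)
    refine ⟨fun x => ?_⟩
    obtain ⟨a, b, -, rfl⟩ := IsFractionRing.div_surjective
      (A := MvPolynomial (Fin ((n - 1) / 2)) BaseField) x
    rw [div_eq_mul_inv]
    exact (hP a).mul (hP b).inv
  refine (Algebra.IsAlgebraic.isTranscendenceBasis_of_le_trdeg_of_finite BaseField w ?_).1
  have h1 := (MvPolynomial.algebraicIndependent_X (Fin ((n - 1) / 2)) BaseField).map'
    (f := IsScalarTower.toAlgHom BaseField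
      (MvPolynomial (Fin ((n - 1) / 2)) BaseField) (K n)) (IsFractionRing.injective _ _)
  exact h1.cardinalMk_le_trdeg

theorem k_ne_zero : k ≠ 0 := by
  unfold k
  simp

/-- The elements `g_{c(i+1)}⁽ⁿ⁾` for `1 ≤ i + 1 < m/2` are algebraically independent if
`m = n / gcd(n, c)`. -/
theorem algebraicIndependent_g (ε : ℤˣ) (n : ℕ) [NeZero n] (c : ℤ) (m : ℕ)
    (hm : m * Int.gcd (n : ℤ) c = n) :
    AlgebraicIndependent BaseField
      (fun i : Fin ((m - 1) / 2) => g ε n (c * (((i : ℕ) : ℤ) + 1))) := by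
  have hn : 0 < n := Nat.pos_of_ne_zero (NeZero.ne n)
  have hn' : (0 : ℤ) < n := by exact_mod_cast hn
  set d := Int.gcd (n : ℤ) c with hd
  have hd0 : 0 < d := Nat.pos_of_ne_zero (by rintro h; rw [h] at hm; omega)
  obtain ⟨u, hu⟩ : (d : ℤ) ∣ c := Int.gcd_dvd_right ..
  have hmn : (n : ℤ) = m * d := by exact_mod_cast hm.symm
  have hcop : IsCoprime (m : ℤ) u := by
    rw [Int.isCoprime_iff_gcd_eq_one]
    have h1 : Int.gcd ((n : ℤ)) c = Int.gcd (m : ℤ) u * d := by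
      rw [hmn, hu, mul_comm (d : ℤ) u, Int.gcd_mul_right]
      simp
    rw [← hd] at h1
    have : 1 * d = Int.gcd (m : ℤ) u * d := by rw [one_mul]; exact h1
    exact (Nat.eq_of_mul_eq_mul_right hd0 this).symm
  -- divisibility by `n` after multiplication by `c` is divisibility by `m`
  have key : ∀ z : ℤ, (n : ℤ) ∣ c * z → (m : ℤ) ∣ z := fun z hz => by
    rw [hmn, hu, mul_comm (m : ℤ), mul_assoc] at hz
    exact hcop.dvd_of_dvd_mul_left
      (Int.dvd_of_mul_dvd_mul_left (by exact_mod_cast hd0.ne') hz)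
  let s : Fin ((m - 1) / 2) → ℤ := fun i => (c * (((i : ℕ) : ℤ) + 1)) % n
  have hs0 : ∀ i, 0 ≤ s i := fun i => Int.emod_nonneg _ hn'.ne'
  have hsn : ∀ i, s i < n := fun i => Int.emod_lt_of_pos _ hn'
  have hsd : ∀ i : Fin ((m - 1) / 2), (n : ℤ) ∣ c * (((i : ℕ) : ℤ) + 1) - s i := fun i => Int.dvd_self_sub_emod
  have small : ∀ z : ℤ, (m : ℤ) ∣ z → z < m → -(m : ℤ) < z → z = 0 := fun z hz h1 h2 =>
    Int.eq_zero_of_abs_lt_dvd hz (abs_lt.2 ⟨h2, h1⟩)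
  have hs1 : ∀ i, s i ≠ 0 := fun i h => by
    have h1 := hsd i
    rw [h, sub_zero] at h1
    have h2 := small _ (key _ h1) (by have := i.2; omega) (by have := i.2; omega)
    omega
  have hs2 : ∀ i, 2 * s i ≠ n := fun i h => by
    have h1 : (n : ℤ) ∣ c * (2 * (((i : ℕ) : ℤ) + 1)) := by
      have h2 := (hsd i).mul_left 2
      have h3 := dvd_add h2 (dvd_refl (n : ℤ))
      have h4 : c * (2 * (((i : ℕ) : ℤ) + 1)) = 2 * (c * (((i : ℕ) : ℤ) + 1) - s i) + n := by
        linear_combination h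
      rwa [h4]
    have h2 := small _ (key _ h1) (by have := i.2; omega) (by have := i.2; omega)
    omega
  let σ : Fin ((m - 1) / 2) → Fin ((n - 1) / 2) := fun i =>
    if h : 2 * s i < n then ⟨(s i).toNat - 1, by have := hs1 i; have := hs0 i; omega⟩
    else ⟨n - (s i).toNat - 1, by have := hs2 i; have := hsn i; omega⟩
  refine algebraicIndependent_of_gVar _ σ ?_ (k⁻¹ ^ 2) (pow_ne_zero 2 (inv_ne_zero k_ne_zero)) ?_
  · intro i j hij
    have hor : s i = s j ∨ s i + s j = n := by
      have h1 := congrArg Fin.val hij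
      have := hs1 i; have := hs1 j; have := hs0 i; have := hs0 j
      have := hsn i; have := hsn j
      simp only [σ] at h1
      split_ifs at h1 <;> simp only at h1 <;> omega
    have hi := i.2
    have hj := j.2
    rcases hor with h | h
    · have h1 : (n : ℤ) ∣ c * (((i : ℕ) : ℤ) - (j : ℕ)) := by
        have h2 := dvd_sub (hsd i) (hsd j)
        have h3 : c * (((i : ℕ) : ℤ) - (j : ℕ)) =
            c * (((i : ℕ) : ℤ) + 1) - s i - (c * (((j : ℕ) : ℤ) + 1) - s j) := by
          linear_combination h
        rwa [h3]
      have h2 := small _ (key _ h1) (by omega) (by omega)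
      exact Fin.ext (by omega)
    · have h1 : (n : ℤ) ∣ c * (((i : ℕ) : ℤ) + (j : ℕ) + 2) := by
        have h2 := dvd_add (dvd_add (hsd i) (hsd j)) (dvd_refl (n : ℤ))
        have h3 : c * (((i : ℕ) : ℤ) + (j : ℕ) + 2) =
            c * (((i : ℕ) : ℤ) + 1) - s i + (c * (((j : ℕ) : ℤ) + 1) - s j) + n := by
          linear_combination h
        rwa [h3]
      have h2 := small _ (key _ h1) (by omega) (by omega)
      omega
  · intro i
    have h1 := hs1 i
    have h2 := hs2 i
    have h3 := hs0 i
    have h4 := hsn i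
    by_cases h : 2 * s i < n
    · left
      change gRem ε n (s i).toNat = _
      rw [gRem_lt ε n _ (by omega) (by omega)]
      simp only [σ, h, dite_true]
    · right
      change gRem ε n (s i).toNat = _
      rw [gRem_gt ε n _ (by omega) (by omega)]
      simp only [σ, h, dite_false]
      rw [map_pow, map_inv₀, kK]

/-! Basic properties of the parameters `g_j⁽ⁿ⁾`. -/

theorem g_of_emod_eq (ε : ℤˣ) (n : ℕ) {j j' : ℤ} (h : j % n = j' % n) : g ε n j = g ε n j' := by
  unfold g
  rw [h]

theorem g_of_dvd (ε : ℤˣ) (n : ℕ) {j : ℤ} (h : (n : ℤ) ∣ j) : g ε n j = -1 := by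
  unfold g gRem
  simp [Int.emod_eq_zero_of_dvd h]

theorem g_var (ε : ℤˣ) (n : ℕ) (i : Fin ((n - 1) / 2)) :
    g ε n ((i : ℕ) + 1) = gVar n i := by
  have hi := i.2
  have e : (((i : ℕ) : ℤ) + 1) % n = (i : ℕ) + 1 := Int.emod_eq_of_lt (by omega) (by omega)
  unfold g
  rw [e, gRem_lt ε n _ (by omega) (by omega)]
  congr 1

theorem g_half (ε : ℤˣ) (n : ℕ) {j : ℤ} (h : (n : ℤ) ∣ 2 * j) (h' : ¬ (n : ℤ) ∣ j) :
    g ε n j = (((ε⁻¹ : ℤˣ) : ℤ) : K n) * (kK n)⁻¹ := by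
  have hn : (n : ℤ) ≠ 0 := by
    rintro h0
    rw [h0] at h h'
    simp_all
  have h1 : 2 * (j % n) = n := by
    have a := Int.emod_nonneg j hn
    have b := Int.emod_lt_of_pos j (b := n) (by omega)
    have c : j % n ≠ 0 := fun c => h' (Int.dvd_of_emod_eq_zero c)
    obtain ⟨u, hu⟩ := (Int.dvd_self_sub_emod (x := j) (m := n)).mul_left 2
    obtain ⟨v, hv⟩ := h
    have d : 2 * (j % n) = n * (v - u) := by linear_combination hv - hu
    have n0 : (0 : ℤ) < n := by omega
    have c0 : 0 < j % n := by omega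
    have d1 : 0 < v - u := by
      by_contra hc
      nlinarith
    have d2 : v - u < 2 := by
      by_contra hc
      nlinarith
    have d3 : v - u = 1 := by omega
    rw [d, d3, mul_one]
  unfold g
  rw [gRem_half ε n _ (by omega) (by omega)]

theorem kK_ne_zero (n : ℕ) : kK n ≠ 0 := by
  unfold kK
  simpa using k_ne_zero

theorem gVar_ne_zero (n : ℕ) (i : Fin ((n - 1) / 2)) : gVar n i ≠ 0 := by
  unfold gVar
  simp

theorem g_mul_g_neg (ε : ℤˣ) (n : ℕ) [NeZero n] {j : ℤ} (h : ¬ (n : ℤ) ∣ j) :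
    g ε n j * g ε n (-j) = (kK n)⁻¹ ^ 2 := by
  have hn : 0 < n := Nat.pos_of_ne_zero (NeZero.ne n)
  have a := Int.emod_nonneg j (b := n) (by omega)
  have b := Int.emod_lt_of_pos j (b := n) (by omega)
  have c : j % n ≠ 0 := fun c => h (Int.dvd_of_emod_eq_zero c)
  by_cases h2 : (n : ℤ) ∣ 2 * j
  · rw [g_half ε n h2 h, g_half ε n (by rw [mul_neg]; exact h2.neg_right)
      (by rwa [Int.dvd_neg])]
    rcases Int.units_eq_one_or ε with rfl | rfl <;> simp <;> ring
  · have d : (-j) % n = n - j % n := by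
      rw [Int.emod_eq_iff (by omega)]
      refine ⟨by omega, by omega, ?_⟩
      obtain ⟨u, hu⟩ := Int.dvd_self_sub_emod (x := j) (m := n)
      exact ⟨u + 1, by linear_combination hu⟩
    have e : 2 * (j % n) ≠ n := fun e => h2 (by
      obtain ⟨u, hu⟩ := Int.dvd_self_sub_emod (x := j) (m := n)
      exact ⟨2 * u + 1, by linear_combination 2 * hu + e⟩)
    unfold g
    rw [d]
    by_cases f : 2 * (j % n) < n
    · rw [gRem_lt ε n _ (by omega) (by omega), gRem_gt ε n _ (by omega) (by omega)]
      have : (⟨n - ((n : ℤ) - j % n).toNat - 1, by omega⟩ : Fin ((n - 1) / 2)) =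
          ⟨(j % n).toNat - 1, by omega⟩ := by
        ext
        simp only
        omega
      rw [this]
      have := gVar_ne_zero n ⟨(j % n).toNat - 1, by omega⟩
      field_simp
    · rw [gRem_gt ε n _ (by omega) (by omega), gRem_lt ε n _ (by omega) (by omega)]
      have : (⟨n - (j % n).toNat - 1, by omega⟩ : Fin ((n - 1) / 2)) =
          ⟨((n : ℤ) - j % n).toNat - 1, by omega⟩ := by
        ext
        simp only
        omega
      rw [this]
      have := gVar_ne_zero n ⟨((n : ℤ) - j % n).toNat - 1, by omega⟩
      field_simp

/-- A ring homomorphism `K⁽ᵐ⁾ → K⁽ⁿ⁾` that fixes `k` and maps `g_i` to `g_{c i}` for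
`1 ≤ i < m/2`, where `m = n / gcd(n, c)`, maps `g_j` to `g_{c j}` for all integers `j`. -/
theorem map_g (ε : ℤˣ) (n m : ℕ) [NeZero n] [NeZero m] (c : ℤ)
    (hm : m * Int.gcd (n : ℤ) c = n) (f : K m →+* K n) (hk : f (kK m) = kK n)
    (hf : ∀ i : Fin ((m - 1) / 2), f (gVar m i) = g ε n (c * (((i : ℕ) : ℤ) + 1))) (j : ℤ) :
    f (g ε m j) = g ε n (c * j) := by
  have hm0 : 0 < m := Nat.pos_of_ne_zero (NeZero.ne m)
  have hn : 0 < n := Nat.pos_of_ne_zero (NeZero.ne n)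
  set d := Int.gcd (n : ℤ) c with hd
  have hd0 : 0 < d := Nat.pos_of_ne_zero (by rintro h; rw [h] at hm; omega)
  obtain ⟨u, hu⟩ : (d : ℤ) ∣ c := Int.gcd_dvd_right ..
  have hmn : (n : ℤ) = m * d := by exact_mod_cast hm.symm
  have hcop : IsCoprime (m : ℤ) u := by
    rw [Int.isCoprime_iff_gcd_eq_one]
    have h1 : Int.gcd ((n : ℤ)) c = Int.gcd (m : ℤ) u * d := by
      rw [hmn, hu, mul_comm (d : ℤ) u, Int.gcd_mul_right]
      simp
    rw [← hd] at h1
    have : 1 * d = Int.gcd (m : ℤ) u * d := by rw [one_mul]; exact h1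
    exact (Nat.eq_of_mul_eq_mul_right hd0 this).symm
  have key : ∀ z : ℤ, (n : ℤ) ∣ c * z ↔ (m : ℤ) ∣ z := fun z => by
    rw [hmn, hu, mul_comm (m : ℤ), mul_assoc]
    constructor
    · intro hz
      exact hcop.dvd_of_dvd_mul_left
        (Int.dvd_of_mul_dvd_mul_left (by exact_mod_cast hd0.ne') hz)
    · intro hz
      exact mul_dvd_mul_left _ (hz.mul_left u)
  have per : ∀ x y : ℤ, (m : ℤ) ∣ x - y → g ε n (c * x) = g ε n (c * y) := fun x y h =>
    g_of_emod_eq ε n (Int.modEq_iff_dvd.2 (by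
      rw [← mul_sub]
      exact (key _).2 ((dvd_sub_comm).1 h)))
  have small : ∀ i : ℤ, 0 < i → 2 * i < m → f (g ε m i) = g ε n (c * i) := fun i h1 h2 => by
    have e := g_var ε m ⟨(i - 1).toNat, by omega⟩
    have e' := hf ⟨(i - 1).toNat, by omega⟩
    have ei : (((i - 1).toNat : ℕ) : ℤ) + 1 = i := by omega
    simp only [ei] at e e'
    rw [e, e']
  by_cases h : (m : ℤ) ∣ j
  · rw [g_of_dvd ε m h, g_of_dvd ε n ((key j).2 h)]
    simp
  by_cases h2 : (m : ℤ) ∣ 2 * j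
  · rw [g_half ε m h2 h, g_half ε n (by
      have := (key _).2 h2
      rwa [← mul_assoc, mul_comm c 2, mul_assoc] at this) (fun h' => h ((key j).1 h'))]
    simp [hk]
  have a := Int.emod_nonneg j (b := m) (by omega)
  have b := Int.emod_lt_of_pos j (b := m) (by omega)
  have h0 : j % m ≠ 0 := fun c => h (Int.dvd_of_emod_eq_zero c)
  obtain ⟨w, hw⟩ := Int.dvd_self_sub_emod (x := j) (m := m)
  have e : 2 * (j % m) ≠ m := fun e => h2 ⟨2 * w + 1, by linear_combination 2 * hw + e⟩
  by_cases hlt : 2 * (j % m) < m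
  · have h3 := small (j % m) (by omega) hlt
    rw [g_of_emod_eq ε m (j := j) (j' := j % m) (by simp), h3]
    exact (per _ _ ⟨w, hw⟩).symm
  · have h3 := small (m - j % m) (by omega) (by omega)
    have h4 : f (g ε m (-j)) = g ε n (c * -j) := by
      have h5 : (-j) % m = (m - j % m) % m :=
        Int.modEq_iff_dvd.2 ⟨w + 1, by linear_combination hw⟩
      rw [g_of_emod_eq ε m h5, h3]
      exact per _ _ ⟨w + 1, by linear_combination hw⟩
    have h6 := congrArg f (g_mul_g_neg ε m h)
    rw [map_mul, h4] at h6
    have h7 := g_mul_g_neg ε n (j := c * j) (fun h' => h ((key j).1 h'))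
    rw [← mul_neg] at h7
    have h8 : g ε n (c * -j) ≠ 0 := fun h8 => by
      rw [h8, mul_zero] at h7
      exact pow_ne_zero 2 (inv_ne_zero (kK_ne_zero n)) h7.symm
    refine mul_right_cancel₀ h8 (h6.trans ?_)
    rw [h7]
    simp [hk]

/-- The `𝔽`-homomorphism `ι_κ : K⁽ᵐ⁾ → K⁽ⁿ⁾`, `m = n / gcd(n, κ)`, mapping `g_j⁽ᵐ⁾` to
`g_{κ j}⁽ⁿ⁾`. -/
noncomputable def iota (ε : ℤˣ) (n : ℕ) [NeZero n] (κ : ℤ) : K (mOf n κ) →ₐ[BaseField] K n :=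
  IsFractionRing.liftAlgHom
    (g := MvPolynomial.aeval
      (fun i : Fin ((mOf n κ - 1) / 2) => g ε n (κ * (((i : ℕ) : ℤ) + 1))))
    (algebraicIndependent_iff_injective_aeval.1
      (algebraicIndependent_g ε n κ (mOf n κ) (mOf_mul_kappa' n κ)))

theorem iota_g (ε : ℤˣ) (n : ℕ) [NeZero n] (κ j : ℤ) :
    iota ε n κ (g ε (mOf n κ) j) = g ε n (κ * j) := by
  refine map_g ε n (mOf n κ) κ (mOf_mul_kappa' n κ) (iota ε n κ).toRingHom ?_ ?_ j
  · exact (iota ε n κ).commutes k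
  · intro i
    change iota ε n κ (algebraMap _ _ _) = _
    rw [iota, IsFractionRing.liftAlgHom_apply, IsFractionRing.lift_algebraMap]
    simp

theorem expand_toFractionRing_injective (N : ℕ) [NeZero N] :
    Function.Injective ((IsScalarTower.toAlgHom FieldCk (Polynomial FieldCk) BaseField).comp
      (Polynomial.expand FieldCk N)) :=
  (IsFractionRing.injective (Polynomial FieldCk) BaseField).comp
    (Polynomial.expand_injective (Nat.pos_of_ne_zero (NeZero.ne N)))

/-- The `ℂ(k)`-endomorphism of `𝔽 = ℂ(q, k)` with `q ↦ q^N`, for `N ≥ 1`. -/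
noncomputable def substQ (N : ℕ) [NeZero N] : BaseField →ₐ[FieldCk] BaseField :=
  IsFractionRing.liftAlgHom (expand_toFractionRing_injective N)

theorem substQ_q (N : ℕ) [NeZero N] : substQ N q = q ^ N := by
  rw [substQ, q, IsFractionRing.liftAlgHom_apply, IsFractionRing.lift_algebraMap]
  simp

theorem substQ_k (N : ℕ) [NeZero N] : substQ N k = k :=
  (substQ N).commutes _

theorem mOf_mul_gcd_kappa' (n : ℕ) (κ : ℤ) :
    mOf n κ * Int.gcd (n : ℤ) (kappa' n κ : ℤ) = n := by
  have h : Int.gcd (n : ℤ) (kappa' n κ : ℤ) = kappa' n κ := by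
    rw [Int.gcd_natCast_natCast]
    exact Nat.gcd_eq_right ⟨mOf n κ, by rw [mul_comm, mOf_mul_kappa']⟩
  rw [h, mOf_mul_kappa']

/-- The `ℂ(k)`-homomorphism `j_{κ'} : K⁽ᵐ⁾ → K⁽ⁿ⁾`, `κ' = gcd(n, κ)`, `m = n / κ'`, mapping `q` to
`q^{κ'²}` and `g_j⁽ᵐ⁾` to `g_{κ' j}⁽ⁿ⁾`. -/
noncomputable def jHom (ε : ℤˣ) (n : ℕ) [NeZero n] (κ : ℤ) : K (mOf n κ) →+* K n :=
  IsFractionRing.lift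
    (g := MvPolynomial.eval₂Hom
      ((algebraMap BaseField (K n)).comp (substQ (kappa' n κ ^ 2)).toRingHom)
      (fun i : Fin ((mOf n κ - 1) / 2) => g ε n ((kappa' n κ : ℤ) * (((i : ℕ) : ℤ) + 1))))
    (by
      have h1 := algebraicIndependent_iff_injective_aeval.1
        (algebraicIndependent_g ε n (kappa' n κ) (mOf n κ) (mOf_mul_gcd_kappa' n κ))
      have h2 := MvPolynomial.map_injective (σ := Fin ((mOf n κ - 1) / 2))
        (substQ (kappa' n κ ^ 2)).toRingHom (RingHom.injective _)
      have h3 := h1.comp h2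
      convert h3 using 1
      funext p
      simp [MvPolynomial.aeval_def, MvPolynomial.eval₂_map])

theorem jHom_algebraMap (ε : ℤˣ) (n : ℕ) [NeZero n] (κ : ℤ) (a : BaseField) :
    jHom ε n κ (algebraMap BaseField (K (mOf n κ)) a) =
      algebraMap BaseField (K n) (substQ (kappa' n κ ^ 2) a) := by
  rw [jHom, IsScalarTower.algebraMap_apply BaseField
    (MvPolynomial (Fin ((mOf n κ - 1) / 2)) BaseField) (K (mOf n κ)),
    IsFractionRing.lift_algebraMap]
  simp [MvPolynomial.algebraMap_eq]

theorem jHom_g (ε : ℤˣ) (n : ℕ) [NeZero n] (κ j : ℤ) :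
    jHom ε n κ (g ε (mOf n κ) j) = g ε n (kappa' n κ * j) := by
  refine map_g ε n (mOf n κ) (kappa' n κ) (mOf_mul_gcd_kappa' n κ) (jHom ε n κ) ?_ ?_ j
  · rw [kK, jHom_algebraMap, substQ_k, kK]
  · intro i
    rw [gVar, jHom, IsFractionRing.lift_algebraMap]
    simp

/-- The subfield `K^{(n,κ)}` of `K⁽ⁿ⁾`: the image of `ι_κ`. -/
noncomputable def subfieldK (ε : ℤˣ) (n : ℕ) [NeZero n] (κ : ℤ) :
    IntermediateField BaseField (K n) :=
  (iota ε n κ).fieldRange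

/-! ### Laurent polynomials and operators on them

Indices start from `0`: the usual index `i ∈ {1, …, r}` corresponds to `i - 1 : Fin r`. -/

/-- Laurent polynomials in `x_1, …, x_r` over `R`. -/
abbrev Laurent (r : ℕ) (R : Type) [Semiring R] : Type := AddMonoidAlgebra R (Fin r → ℤ)

section Operators

variable {r : ℕ} {R : Type} [Field R]

/-- The monomial `x^ν`. -/
noncomputable def mono (ν : Fin r → ℤ) : Laurent r R := AddMonoidAlgebra.single ν 1

/-- The linear operator on Laurent polynomials with prescribed values on the monomials. -/
noncomputable def ofMonomials (f : (Fin r → ℤ) → Laurent r R) :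
    Module.End R (Laurent r R) :=
  Finsupp.linearCombination R f ∘ₗ (AddMonoidAlgebra.coeffLinearEquiv R).toLinearMap

theorem ofMonomials_mono (f : (Fin r → ℤ) → Laurent r R) (ν : Fin r → ℤ) :
    ofMonomials f (mono ν) = f ν := by
  simp [ofMonomials, mono]

/-- The position `i` of the simple root `α_i = ε_i - ε_{i+1}`. -/
def left (i : Fin (r - 1)) : Fin r := ⟨i, by omega⟩

/-- The position `i + 1` of the simple root `α_i = ε_i - ε_{i+1}`. -/
def right (i : Fin (r - 1)) : Fin r := ⟨i + 1, by omega⟩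

/-- The simple root `α_i = ε_i - ε_{i+1}`. -/
def simpleRoot (i : Fin (r - 1)) : Fin r → ℤ := Pi.single (left i) 1 - Pi.single (right i) 1

/-- The pairing `(ν, α_i^∨) = ν_i - ν_{i+1}`. -/
def pairing (ν : Fin r → ℤ) (i : Fin (r - 1)) : ℤ := ν (left i) - ν (right i)

/-- The simple reflection `s_i`, interchanging the coordinates `i` and `i + 1`. -/
def reflect (i : Fin (r - 1)) (ν : Fin r → ℤ) : Fin r → ℤ :=
  ν ∘ Equiv.swap (left i) (right i)

/-- The Laurent polynomial `(1 - x^{-aβ}) / (1 - x^β)` (for `β ≠ 0`), written as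
`-(x^{-β} + ⋯ + x^{-aβ})` for `a ≥ 0` and as `1 + x^β + ⋯ + x^{(-a-1)β}` for `a ≤ 0`. -/
noncomputable def geomQuot (a : ℤ) (β : Fin r → ℤ) : Laurent r R :=
  (∑ c ∈ Finset.range (-a).toNat, mono ((c : ℤ) • β)) -
    ∑ c ∈ Finset.range a.toNat, mono (-((c : ℤ) + 1) • β)

theorem mono_mul_mono (ν ν' : Fin r → ℤ) :
    (mono ν : Laurent r R) * mono ν' = mono (ν + ν') := by
  simp [mono, AddMonoidAlgebra.single_mul_single]

theorem one_sub_mono_mul_geomQuot (a : ℤ) (β : Fin r → ℤ) :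
    (1 - mono β) * (geomQuot a β : Laurent r R) = 1 - mono (-a • β) := by
  have h0 : (1 : Laurent r R) = mono 0 := rfl
  have h1 : ∀ N : ℕ, (1 - mono β) * ∑ c ∈ Finset.range N, (mono ((c : ℤ) • β) : Laurent r R) =
      1 - mono ((N : ℤ) • β) := fun N => by
    induction N with
    | zero => simp [h0]
    | succ N ih =>
      rw [Finset.sum_range_succ, mul_add, ih, sub_mul, one_mul, mono_mul_mono,
        show β + (N : ℤ) • β = ((N + 1 : ℕ) : ℤ) • β by push_cast; module]
      abel
  have h2 : ∀ N : ℕ, (1 - mono β) *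
      ∑ c ∈ Finset.range N, (mono (-((c : ℤ) + 1) • β) : Laurent r R) =
      mono (-(N : ℤ) • β) - 1 := fun N => by
    induction N with
    | zero => simp [h0]
    | succ N ih =>
      rw [Finset.sum_range_succ, mul_add, ih, sub_mul, one_mul, mono_mul_mono,
        show β + -((N : ℤ) + 1) • β = -(N : ℤ) • β by module]
      push_cast
      abel
  unfold geomQuot
  rw [mul_sub, h1, h2]
  rcases le_total 0 a with h | h
  · rw [show (-a).toNat = 0 by omega, show ((a.toNat : ℕ) : ℤ) = a by omega]
    simp [h0]
  · rw [show a.toNat = 0 by omega, show (((-a).toNat : ℕ) : ℤ) = -a by omega]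
    simp [h0]

/-- `s_1 s_2 ⋯ s_{r-1} ν = (ν_r, ν_1, …, ν_{r-1})`. -/
def rotate (ν : Fin r → ℤ) : Fin r → ℤ := ν ∘ (finRotate r).symm

/-- The inverse of `rotate`: `(ν_1, …, ν_r) ↦ (ν_2, …, ν_r, ν_1)`. -/
def rotateInv (ν : Fin r → ℤ) : Fin r → ℤ := ν ∘ finRotate r

/-- The last coordinate `ν_r`. -/
def lastCoord [NeZero r] (ν : Fin r → ℤ) : ℤ :=
  ν ⟨r - 1, Nat.sub_lt (Nat.pos_of_ne_zero (NeZero.ne r)) one_pos⟩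

/-- The operator `x^ν ↦ c^{-ν_r} x^{(ν_r, ν_1, …, ν_{r-1})}`. -/
noncomputable def omegaOp [NeZero r] (c : R) : Module.End R (Laurent r R) :=
  ofMonomials fun ν => c ^ (-lastCoord ν) • mono (rotate ν)

/-- The inverse `x^ν ↦ c^{ν_1} x^{(ν_2, …, ν_r, ν_1)}` of `omegaOp c` (for `c ≠ 0`). -/
noncomputable def omegaInvOp [NeZero r] (c : R) : Module.End R (Laurent r R) :=
  ofMonomials fun ν => c ^ (ν 0) • mono (rotateInv ν)

/-- The operator `T_{i-1}⁻¹ ⋯ T_1⁻¹ ω T_{r-1} ⋯ T_i`, where `T'` stands for the inverses of the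
operators `T`. -/
noncomputable def yOp (T T' : Fin (r - 1) → Module.End R (Laurent r R))
    (w : Module.End R (Laurent r R)) (i : Fin r) : Module.End R (Laurent r R) :=
  ((((List.finRange (r - 1)).filter fun l => l.val < i.val).reverse).map T').prod * w *
    ((((List.finRange (r - 1)).filter fun l => i.val ≤ l.val).reverse).map T).prod

/-- The operator `T_i⁻¹ ⋯ T_{r-1}⁻¹ ω⁻¹ T_1 ⋯ T_{i-1}` inverse to the previous one, where `T'`
stands for the inverses of the operators `T` and `w'` for `ω⁻¹`. -/
noncomputable def yInvOp (T T' : Fin (r - 1) → Module.End R (Laurent r R))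
    (w' : Module.End R (Laurent r R)) (i : Fin r) : Module.End R (Laurent r R) :=
  (((List.finRange (r - 1)).filter fun l => i.val ≤ l.val).map T').prod * w' *
    (((List.finRange (r - 1)).filter fun l => l.val < i.val).map T).prod

end Operators

/-! ### The metaplectic basic representation and the metaplectic polynomials -/

section MetaplecticOperators

variable {r : ℕ}

/-- `t_m(s) = s - r_m(s)`, the largest multiple of `m` that is at most `s`. -/
def tm (m : ℕ) (s : ℤ) : ℤ := s - s % (m : ℤ)

/-- The metaplectic divided difference
`∇_i(x^ν) = (1 - x^{-t_m((ν, α_i^∨)) α_i}) / (1 - x^{m α_i}) x^ν`. -/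
noncomputable def nabla {R : Type} [Field R] (m : ℕ) (i : Fin (r - 1)) (ν : Fin r → ℤ) :
    Laurent r R :=
  geomQuot (tm m (pairing ν i) / (m : ℤ)) ((m : ℤ) • simpleRoot i) * mono ν

theorem one_sub_mono_mul_nabla {R : Type} [Field R] (m : ℕ) (i : Fin (r - 1)) (ν : Fin r → ℤ) :
    (1 - mono ((m : ℤ) • simpleRoot i)) * (nabla m i ν : Laurent r R) =
      (1 - mono (-tm m (pairing ν i) • simpleRoot i)) * mono ν := by
  have h : tm m (pairing ν i) / (m : ℤ) * (m : ℤ) = tm m (pairing ν i) :=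
    Int.ediv_mul_cancel Int.dvd_self_sub_emod
  unfold nabla
  rw [← mul_assoc, one_sub_mono_mul_geomQuot, smul_smul, neg_mul, h]

variable (ε : ℤˣ) (n : ℕ) (κ : ℤ)

/-- The value `p_i(ν) = -k g_{-B(ν, α_i)}⁽ⁿ⁾`, where `B(ν, α_i) = κ (ν, α_i^∨)`. -/
noncomputable def pCoeff (i : Fin (r - 1)) (ν : Fin r → ℤ) : K n :=
  -kK n * g ε n (-(κ * pairing ν i))

/-- The action of `T_i` (`1 ≤ i < r`) in the metaplectic basic representation:
`T_i x^ν = (k - k⁻¹) ∇_i(x^ν) + p_i(ν) x^{s_i ν}`, with `m = n / gcd(n, κ)`. -/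
noncomputable def opT (i : Fin (r - 1)) : Module.End (K n) (Laurent r (K n)) :=
  ofMonomials fun ν =>
    (kK n - (kK n)⁻¹) • nabla (mOf n κ) i ν + pCoeff ε n κ i ν • mono (reflect i ν)

/-- The action of `T_i⁻¹`; by the Hecke relation `(T_i - k)(T_i + k⁻¹) = 0`, this is
`T_i - (k - k⁻¹)`. -/
noncomputable def opTInv (i : Fin (r - 1)) : Module.End (K n) (Laurent r (K n)) :=
  opT ε n κ i - (kK n - (kK n)⁻¹) • 1

/-- `σ(s) = k⁻¹` if `s` is a positive multiple of `m`, and `σ(s) = -k g_{-κ s}⁽ⁿ⁾` otherwise. -/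
noncomputable def sigma (s : ℤ) : K n :=
  if 0 < s ∧ (mOf n κ : ℤ) ∣ s then (kK n)⁻¹ else -kK n * g ε n (-(κ * s))

/-- The value `(γ_μ)^λ = q^{-(λ, μ)} ∏_{α > 0} σ((μ, α^∨))^{(λ, α^∨)/m}` at `λ = m a ∈ mℤ^r`. -/
noncomputable def gammaPow (μ a : Fin r → ℤ) : K n :=
  qK n ^ (-((mOf n κ : ℤ) * ∑ i, a i * μ i)) *
    ∏ i : Fin r, ∏ j ∈ Finset.Ioi i, sigma ε n κ (μ i - μ j) ^ (a i - a j)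

variable [NeZero r]

/-- The action of `Y_i = Y^{m ε_i} = T_{i-1}⁻¹ ⋯ T_1⁻¹ ω T_{r-1} ⋯ T_i`, where
`ω x^ν = q^{-m ν_r} x^{(ν_r, ν_1, …, ν_{r-1})}`. -/
noncomputable def opY (i : Fin r) : Module.End (K n) (Laurent r (K n)) :=
  yOp (opT ε n κ) (opTInv ε n κ) (omegaOp (qK n ^ mOf n κ)) i

/-- The action of `Y_i⁻¹`. -/
noncomputable def opYInv (i : Fin r) : Module.End (K n) (Laurent r (K n)) :=
  yInvOp (opT ε n κ) (opTInv ε n κ) (omegaInvOp (qK n ^ mOf n κ)) i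

/-- The action of `Y^λ = Y_1^{a_1} ⋯ Y_r^{a_r}` for `λ = m a ∈ mℤ^r`. -/
noncomputable def opYPow (a : Fin r → ℤ) : Module.End (K n) (Laurent r (K n)) :=
  ((List.finRange r).map fun i =>
    if 0 ≤ a i then opY ε n κ i ^ (a i).toNat else opYInv ε n κ i ^ (-a i).toNat).prod

/-- `E ∈ K^{(n,κ)}[x^{±1}]` is a joint eigenfunction of the operators `Y^λ`, `λ ∈ mℤ^r`, with
eigenvalues `(γ_μ)^λ`, and the coefficient of `x^μ` in `E` is one. -/
def IsMetaplecticPolynomial [NeZero n] (μ : Fin r → ℤ) (E : Laurent r (K n)) : Prop :=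
  (∀ ν, E.coeff ν ∈ subfieldK ε n κ) ∧
  (∀ a : Fin r → ℤ, opYPow ε n κ a E = gammaPow ε n κ μ a • E) ∧
  E.coeff μ = 1

/-- The metaplectic polynomial `E_μ^{(n,κ)}`. (The choice is from a one-element set.) -/
noncomputable def metaplecticE [NeZero n] (μ : Fin r → ℤ) : Laurent r (K n) :=
  Classical.epsilon (IsMetaplecticPolynomial ε n κ μ)

end MetaplecticOperators

/-! ### The maps on Laurent polynomials -/

/-- `∑ c_ν x^ν ↦ ∑ f(c_ν) x^{a ν}`. -/
noncomputable def substLaurent {r : ℕ} {R S : Type} [Semiring R] [Semiring S] (f : R →+* S) (a : ℕ)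
    (E : Laurent r R) : Laurent r S :=
  AddMonoidAlgebra.mapDomain (fun ν : Fin r → ℤ => (a : ℤ) • ν)
    (AddMonoidAlgebra.mapRingHom (Fin r → ℤ) f E)

/-- `∑ c_ν x^ν ↦ ∑ ι_κ(c_ν) x^ν`. -/
noncomputable def iotaBar {r : ℕ} (ε : ℤˣ) (n : ℕ) [NeZero n] (κ : ℤ)
    (E : Laurent r (K (mOf n κ))) : Laurent r (K n) :=
  AddMonoidAlgebra.mapRingHom (Fin r → ℤ) (iota ε n κ).toRingHom E

/-- `∑ c_ν x^ν ↦ ∑ j_{κ'}(c_ν) x^{κ' ν}`. -/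
noncomputable def jBar {r : ℕ} (ε : ℤˣ) (n : ℕ) [NeZero n] (κ : ℤ)
    (E : Laurent r (K (mOf n κ))) : Laurent r (K n) :=
  substLaurent (jHom ε n κ) (kappa' n κ) E

/-! ### Nonsymmetric Macdonald polynomials of type `GL_r` over `ℂ(q, k)` (where `k² = t`) -/

section Macdonald

variable {r : ℕ}

/-- The Demazure–Lusztig operator
`T_i x^ν = k x^{s_i ν} + (k - k⁻¹) (x^ν - x^{s_i ν}) / (1 - x_i / x_{i+1})`. -/
noncomputable def macT (i : Fin (r - 1)) : Module.End BaseField (Laurent r BaseField) :=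
  ofMonomials fun ν =>
    k • mono (reflect i ν) +
      (k - k⁻¹) • (geomQuot (pairing ν i) (simpleRoot i) * mono ν)

/-- The inverse `T_i - (k - k⁻¹)` of `T_i`. -/
noncomputable def macTInv (i : Fin (r - 1)) : Module.End BaseField (Laurent r BaseField) :=
  macT i - (k - k⁻¹) • 1

/-- The Cherednik operator `Y_i = T_{i-1}⁻¹ ⋯ T_1⁻¹ ω T_{r-1} ⋯ T_i`, where
`ω x^ν = q^{-ν_r} x^{(ν_r, ν_1, …, ν_{r-1})}`. -/
noncomputable def macY [NeZero r] (i : Fin r) : Module.End BaseField (Laurent r BaseField) :=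
  yOp macT macTInv (omegaOp q) i

/-- The exponent of `k` in the eigenvalue of `Y_i`: the number of `j` with `μ_j > μ_i`, or
`μ_j = μ_i` and `j > i`, minus the number of `j` with `μ_j < μ_i`, or `μ_j = μ_i` and `j < i`. -/
def macExponent (μ : Fin r → ℤ) (i : Fin r) : ℤ :=
  ((Finset.univ.filter fun j => μ i < μ j ∨ (μ j = μ i ∧ i < j)).card : ℤ) -
    ((Finset.univ.filter fun j => μ j < μ i ∨ (μ j = μ i ∧ j < i)).card : ℤ)

/-- `E` is the monic nonsymmetric Macdonald polynomial of degree `μ`: it is a joint eigenfunction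
of the Cherednik operators, `Y_i E = q^{-μ_i} k^{e_i(μ)} E`, and the coefficient of `x^μ` is one. -/
def IsNonsymmetricMacdonald [NeZero r] (μ : Fin r → ℤ) (E : Laurent r BaseField) : Prop :=
  (∀ i, macY i E = (q ^ (-μ i) * k ^ macExponent μ i) • E) ∧ E.coeff μ = 1

/-- The monic nonsymmetric Macdonald polynomial of degree `μ`. (The choice is from a one-element
set.) -/
noncomputable def macdonaldE [NeZero r] (μ : Fin r → ℤ) : Laurent r BaseField :=
  Classical.epsilon (IsNonsymmetricMacdonald μ)

end Macdonald

end Metaplectic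

open Metaplectic

/-! All the polynomials are normalised joint eigenfunctions of Cherednik operators of one kind. They
are built from the operators `heckeT m k p`, which depend on a step $m$, a scalar $k$ and a function
$p$ on $\mathbb Z$, and from $\omega$, which depends on a scalar $c$. The metaplectic case is
$p(s)=-k\,g_{-\kappa s}$, $c=q^m$; the Macdonald case is $m=1$, $p\equiv k$, $c=q$.

A field homomorphism $f$ combined with $x\mapsto x^d$ intertwines two such families, and matches
their eigenvalues at $\mu$ and $d\mu$, as soon as $m'=dm$, $f(k)=k'$, $f(c)=c'^d$ and
$p'(ds)=f(p(s))$ (`IsParamMap.isHeckeEigen`). For $\iota_\kappa$ one has $d=1$, for $\mathrm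
j_{\kappa'}$ one has $d=\kappa'$. For the Macdonald polynomials $d=n$, because $g_{-ns}=-1$ makes
$p'(ns)=k$. The identities therefore follow once normalised eigenfunctions are unique.

Existence and uniqueness rest on three facts. (1) The $Y_i$ commute (`commute_heckeY`). This is
formal in the affine braid group. The Hecke relations behind it hold because the defect of each
relation permutes the multiplications by $x_l^m$, so it vanishes if it kills the monomials with
exponents in $[0,m)^r$, where $T_i$ is explicit. (2) $Y_i$ is triangular on monomials with diagonal
entries `heckeGamma` (`isLeading_heckeY`). Exponents are compared by square length, then by a weight
that is moved along with each factor of $Y_i$ and returns to its start. (3) The diagonal entries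
separate exponents (`heckeGamma_injective`), since an endomorphism squares $c$ and fixes everything
else. A product of factors $Y_i-\gamma$ then projects $x^\mu$ onto an eigenfunction, and a maximal
exponent of any eigenfunction must be the one with its eigenvalues. -/

namespace Metaplectic

/-! ### Reflections of exponents and the geometric quotient. -/

section Basic

variable {r : ℕ} {R : Type} [Field R]

theorem end_ext {A B : Module.End R (Laurent r R)} (h : ∀ ν, A (mono ν) = B (mono ν)) :
    A = B := by
  refine LinearMap.ext fun f => ?_
  induction f using AddMonoidAlgebra.induction_linear with
  | zero => simp
  | add f g hf hg => simp [hf, hg]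
  | single ν c =>
    have : (AddMonoidAlgebra.single ν c : Laurent r R) = c • mono ν := by simp [mono]
    rw [this, map_smul, map_smul, h]

theorem left_ne_right (i : Fin (r - 1)) : left i ≠ right i := by
  simp [left, right, Fin.ext_iff]

theorem simpleRoot_apply (i : Fin (r - 1)) (l : Fin r) :
    simpleRoot i l = if l = left i then 1 else if l = right i then -1 else 0 := by
  have := left_ne_right i
  simp only [simpleRoot, Pi.sub_apply, Pi.single_apply]
  split_ifs with h1 h2 <;> simp_all

theorem reflect_apply_left (i : Fin (r - 1)) (ν : Fin r → ℤ) :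
    reflect i ν (left i) = ν (right i) := by simp [reflect]

theorem reflect_apply_right (i : Fin (r - 1)) (ν : Fin r → ℤ) :
    reflect i ν (right i) = ν (left i) := by simp [reflect]

theorem reflect_apply_of_ne (i : Fin (r - 1)) (ν : Fin r → ℤ) {l : Fin r} (h : l ≠ left i)
    (h' : l ≠ right i) : reflect i ν l = ν l := by
  simp [reflect, Equiv.swap_apply_of_ne_of_ne h h']

theorem reflect_eq_sub (i : Fin (r - 1)) (ν : Fin r → ℤ) :
    reflect i ν = ν - pairing ν i • simpleRoot i := by
  funext l
  have := left_ne_right i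
  simp only [Pi.sub_apply, Pi.smul_apply, simpleRoot_apply, pairing, smul_eq_mul]
  split_ifs with h1 h2
  · subst h1; rw [reflect_apply_left]; ring
  · subst h2; rw [reflect_apply_right]; ring
  · rw [reflect_apply_of_ne i ν h1 h2]; ring

theorem reflect_reflect (i : Fin (r - 1)) (ν : Fin r → ℤ) : reflect i (reflect i ν) = ν := by
  funext l
  simp [reflect]

theorem pairing_reflect (i : Fin (r - 1)) (ν : Fin r → ℤ) :
    pairing (reflect i ν) i = -pairing ν i := by
  simp [pairing, reflect_apply_left, reflect_apply_right]

theorem reflect_eq_self (i : Fin (r - 1)) (ν : Fin r → ℤ) (h : pairing ν i = 0) :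
    reflect i ν = ν := by
  rw [reflect_eq_sub, h]; simp

theorem mono_zero : (mono 0 : Laurent r R) = 1 := rfl

theorem mono_ne_zero (ν : Fin r → ℤ) : (mono ν : Laurent r R) ≠ 0 := by
  exact AddMonoidAlgebra.single_ne_zero.2 one_ne_zero

theorem mono_injective : Function.Injective (mono : (Fin r → ℤ) → Laurent r R) := fun a b h => by
  have := congrArg AddMonoidAlgebra.coeff h
  simpa [mono, Finsupp.single_eq_single_iff] using this

theorem one_sub_mono_ne_zero {β : Fin r → ℤ} (h : β ≠ 0) : (1 - mono β : Laurent r R) ≠ 0 := by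
  rw [sub_ne_zero, ← mono_zero]
  exact fun e => h (mono_injective e).symm

theorem smul_simpleRoot_ne_zero {m : ℕ} (hm : 0 < m) (i : Fin (r - 1)) :
    (m : ℤ) • (simpleRoot i : Fin r → ℤ) ≠ 0 := fun e => by
  have := congrFun e (left i)
  simp [simpleRoot_apply] at this
  omega

theorem geomQuot_zero (β : Fin r → ℤ) : (geomQuot 0 β : Laurent r R) = 0 := by simp [geomQuot]

theorem geomQuot_neg_one (β : Fin r → ℤ) : (geomQuot (-1) β : Laurent r R) = 1 := by
  simp [geomQuot, mono_zero]

/-- Multiplied by $1-x^\beta$, this is $x^\beta-x^{-a\beta}=(1-x^{-a\beta})-(1-x^\beta)$. The extra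
$1$ is the source of the correction terms in the cross relations. -/
theorem mono_mul_geomQuot_add_one {β : Fin r → ℤ} (hβ : β ≠ 0) (a : ℤ) :
    mono β * (geomQuot (a + 1) β : Laurent r R) = geomQuot a β - 1 := by
  refine mul_left_cancel₀ (one_sub_mono_ne_zero hβ) ?_
  rw [mul_left_comm, one_sub_mono_mul_geomQuot, mul_sub, mul_sub, mul_one, mul_one,
    one_sub_mono_mul_geomQuot, mono_mul_mono, show β + -(a + 1) • β = -a • β by module]
  abel

theorem nabla_eq (m : ℕ) (i : Fin (r - 1)) (ν : Fin r → ℤ) :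
    (nabla m i ν : Laurent r R) =
      geomQuot (pairing ν i / (m : ℤ)) ((m : ℤ) • simpleRoot i) * mono ν := by
  unfold nabla tm
  rcases Nat.eq_zero_or_pos m with rfl | hm
  · simp
  · congr 2
    rw [show pairing ν i - pairing ν i % (m : ℤ) = m * (pairing ν i / m) by
      have := Int.emod_add_mul_ediv (pairing ν i) m
      linarith]
    exact Int.mul_ediv_cancel_left _ (by omega)

end Basic

/-! ### Hecke operators with a general parameter function and their cross relations with $x_l^m$. -/

section Hecke

variable {r : ℕ} {R : Type} [Field R]

/-- The operators `x^ν ↦ (k - k⁻¹) ∇_i(x^ν) + p((ν, α_i^∨)) x^{s_i ν}`, for an arbitrary function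
`p`. -/
noncomputable def heckeT (m : ℕ) (k : R) (p : ℤ → R) (i : Fin (r - 1)) :
    Module.End R (Laurent r R) :=
  ofMonomials fun ν => (k - k⁻¹) • nabla m i ν + p (pairing ν i) • mono (reflect i ν)

/-- The operators `T_i - (k - k⁻¹)`. -/
noncomputable def heckeTInv (m : ℕ) (k : R) (p : ℤ → R) (i : Fin (r - 1)) :
    Module.End R (Laurent r R) :=
  heckeT m k p i - (k - k⁻¹) • 1

/-- The conditions on `p` under which the operators `heckeT` satisfy the Hecke relations. -/
structure IsHeckeParam (m : ℕ) (k : R) (p : ℤ → R) : Prop where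
  pos : 0 < m
  ne_zero : k ≠ 0
  add_period : ∀ s, p (s + m) = p s
  zero : p 0 = k
  mul_neg : ∀ s, ¬ (m : ℤ) ∣ s → p s * p (-s) = 1

variable {m : ℕ} {k : R} {p : ℤ → R}

theorem heckeT_mono (i : Fin (r - 1)) (ν : Fin r → ℤ) :
    heckeT m k p i (mono ν) =
      (k - k⁻¹) • (geomQuot (pairing ν i / (m : ℤ)) ((m : ℤ) • simpleRoot i) * mono ν) +
        p (pairing ν i) • mono (reflect i ν) := by
  rw [heckeT, ofMonomials_mono, nabla_eq]

/-- Multiplication by `x_l^m`. -/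
noncomputable def xOp (R : Type) [Field R] (m : ℕ) (l : Fin r) : Module.End R (Laurent r R) :=
  LinearMap.mulLeft R (mono (Pi.single l (m : ℤ)))

theorem xOp_mono (l : Fin r) (ν : Fin r → ℤ) :
    xOp R m l (mono ν) = mono (ν + Pi.single l (m : ℤ)) := by
  simp [xOp, mono_mul_mono, add_comm]

theorem xOp_injective (l : Fin r) : Function.Injective (xOp R m l) :=
  fun _ _ h => mul_left_cancel₀ (mono_ne_zero _) h

/-- Raising one coordinate by $m$ does not change $p$, by periodicity, and raises the integer
quotient by one. So the only correction comes from `mono_mul_geomQuot_add_one`, and it does not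
involve $p$. -/
theorem heckeT_mul_xOp_left (hp : IsHeckeParam m k p) (i : Fin (r - 1)) :
    heckeT m k p i * xOp R m (left i) =
      xOp R m (right i) * heckeT m k p i - (k - k⁻¹) • xOp R m (right i) := by
  refine end_ext fun ν => ?_
  have hm : (m : ℤ) ≠ 0 := by have := hp.pos; omega
  have hlr := left_ne_right i
  have h1 : pairing (ν + Pi.single (left i) (m : ℤ)) i = pairing ν i + m := by
    simp [pairing, hlr.symm]; ring
  have h2 : reflect i (ν + Pi.single (left i) (m : ℤ)) = Pi.single (right i) (m : ℤ) + reflect i ν := by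
    rw [reflect_eq_sub, reflect_eq_sub, h1, simpleRoot]
    funext l
    simp [Pi.single_apply]
    split_ifs <;> ring
  have h3 : ν + Pi.single (left i) (m : ℤ) =
      Pi.single (right i) (m : ℤ) + ((m : ℤ) • simpleRoot i + ν) := by
    rw [simpleRoot]
    funext l
    simp [Pi.single_apply]
    split_ifs <;> ring
  simp only [Module.End.mul_apply, LinearMap.sub_apply, LinearMap.smul_apply, xOp_mono, heckeT_mono,
    h1, h2, hp.add_period, map_add, map_smul]
  rw [show (pairing ν i + m) / (m : ℤ) = pairing ν i / m + 1 by
    rw [Int.add_ediv_of_dvd_right dvd_rfl, Int.ediv_self hm], h3, ← mono_mul_mono,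
    ← mono_mul_mono ((m : ℤ) • simpleRoot i)]
  have h4 := mono_mul_geomQuot_add_one (R := R) (smul_simpleRoot_ne_zero hp.pos i) (pairing ν i / m)
  rw [show (geomQuot (pairing ν i / (m : ℤ) + 1) ((m : ℤ) • simpleRoot i) : Laurent r R) *
      (mono (Pi.single (right i) (m : ℤ)) * (mono ((m : ℤ) • simpleRoot i) * mono ν)) =
      mono (Pi.single (right i) (m : ℤ)) * ((mono ((m : ℤ) • simpleRoot i) *
        geomQuot (pairing ν i / (m : ℤ) + 1) ((m : ℤ) • simpleRoot i)) * mono ν) by ring, h4,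
    ← mono_mul_mono, ← mono_mul_mono, ← mono_mul_mono, mul_comm (mono ν), mul_comm (mono (reflect i ν))]
  simp only [xOp, LinearMap.mulLeft_apply, sub_mul, one_mul, mul_sub, smul_sub]
  abel

theorem heckeT_mul_xOp_right (hp : IsHeckeParam m k p) (i : Fin (r - 1)) :
    heckeT m k p i * xOp R m (right i) =
      xOp R m (left i) * heckeT m k p i + (k - k⁻¹) • xOp R m (right i) := by
  refine end_ext fun ν => ?_
  have hm : (m : ℤ) ≠ 0 := by have := hp.pos; omega
  have hlr := left_ne_right i
  have h1 : pairing (ν + Pi.single (right i) (m : ℤ)) i = pairing ν i - m := by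
    simp [pairing, hlr]; ring
  have h2 : reflect i (ν + Pi.single (right i) (m : ℤ)) = Pi.single (left i) (m : ℤ) + reflect i ν := by
    rw [reflect_eq_sub, reflect_eq_sub, h1, simpleRoot]
    funext l
    simp [Pi.single_apply]
    split_ifs <;> ring
  have h3 : (Pi.single (left i) (m : ℤ) : Fin r → ℤ) =
      Pi.single (right i) (m : ℤ) + (m : ℤ) • simpleRoot i := by
    rw [simpleRoot]
    funext l
    simp [Pi.single_apply]
    split_ifs <;> ring
  have h5 : p (pairing ν i - m) = p (pairing ν i) := by
    rw [← hp.add_period]; simp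
  have h4 := mono_mul_geomQuot_add_one (R := R) (smul_simpleRoot_ne_zero hp.pos i)
    (pairing ν i / m - 1)
  rw [sub_add_cancel, eq_sub_iff_add_eq] at h4
  simp only [Module.End.mul_apply, LinearMap.add_apply, LinearMap.smul_apply, xOp_mono, heckeT_mono,
    h1, h2, h5, map_add, map_smul]
  rw [show (pairing ν i - m) / (m : ℤ) = pairing ν i / m - 1 by
    rw [Int.sub_ediv_of_dvd _ dvd_rfl, Int.ediv_self hm], ← h4, ← mono_mul_mono,
    ← mono_mul_mono (Pi.single (left i) (m : ℤ))]
  simp only [xOp, LinearMap.mulLeft_apply]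
  rw [add_comm (reflect i ν), ← mono_mul_mono (Pi.single (left i) (m : ℤ)), h3, ← mono_mul_mono]
  simp only [add_mul, one_mul, smul_add]
  rw [show mono ν * (mono (Pi.single (right i) (m : ℤ)) : Laurent r R) =
    mono (Pi.single (right i) (m : ℤ)) * mono ν by ring]
  rw [show mono ((m : ℤ) • simpleRoot i) * (geomQuot (pairing ν i / (m : ℤ)) ((m : ℤ) • simpleRoot i) : Laurent r R) *
    (mono (Pi.single (right i) (m : ℤ)) * mono ν) = mono (Pi.single (right i) (m : ℤ)) * mono ((m : ℤ) • simpleRoot i) *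
     ((geomQuot (pairing ν i / (m : ℤ)) ((m : ℤ) • simpleRoot i) : Laurent r R) * mono ν) by ring]
  abel

theorem heckeT_mul_xOp_of_ne (i : Fin (r - 1)) {l : Fin r} (h : l ≠ left i) (h' : l ≠ right i) :
    heckeT m k p i * xOp R m l = xOp R m l * heckeT m k p i := by
  refine end_ext fun ν => ?_
  have h1 : pairing (ν + Pi.single l (m : ℤ)) i = pairing ν i := by
    simp [pairing, h.symm, h'.symm]
  have h2 : reflect i (ν + Pi.single l (m : ℤ)) = Pi.single l (m : ℤ) + reflect i ν := by
    rw [reflect_eq_sub, reflect_eq_sub, h1]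
    abel
  simp only [Module.End.mul_apply, xOp_mono, heckeT_mono, h1, h2, map_add, map_smul]
  simp only [xOp, LinearMap.mulLeft_apply, ← mono_mul_mono]
  rw [mul_comm (mono ν), mul_comm (mono (reflect i ν)), mul_left_comm]

/-- The integer quotient is $0$ or $-1$ here, so the geometric sum is $0$ or $1$ and $T_i$ preserves
the span of $x^\nu$ and $x^{s_i\nu}$. -/
theorem heckeT_mono_of_abs_lt (i : Fin (r - 1)) (ν : Fin r → ℤ)
    (h : |pairing ν i| < m) :
    heckeT m k p i (mono ν) =
      (if pairing ν i < 0 then k - k⁻¹ else 0) • mono ν +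
        p (pairing ν i) • mono (reflect i ν) := by
  rw [heckeT_mono]
  obtain ⟨h1, h2⟩ := abs_lt.1 h
  split_ifs with h0
  · rw [show pairing ν i / (m : ℤ) = -1 by
      rw [Int.ediv_eq_iff_of_pos (by omega)]; constructor <;> linarith, geomQuot_neg_one, one_mul]
  · rw [Int.ediv_eq_zero_of_lt (by omega) h2, geomQuot_zero]
    simp

/-- Every exponent differs from one in the box by multiples of $m$ in each coordinate. Since
multiplication by $x_{\sigma(l)}^m$ is injective, vanishing of $B$ on a monomial passes to its
translates in both directions. A relation between operators thus becomes a check on the box. -/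
theorem eq_zero_of_box (hm : 0 < m) (B : Module.End R (Laurent r R)) (σ : Fin r → Fin r)
    (hB : ∀ l, B * xOp R m l = xOp R m (σ l) * B)
    (hbox : ∀ ν : Fin r → ℤ, (∀ l, 0 ≤ ν l ∧ ν l < m) → B (mono ν) = 0) : B = 0 := by
  have h1 : ∀ l ν, B (mono (ν + Pi.single l (m : ℤ))) = 0 ↔ B (mono ν) = 0 := fun l ν => by
    have h := LinearMap.congr_fun (hB l) (mono ν)
    simp only [Module.End.mul_apply, xOp_mono] at h
    rw [h]
    exact map_eq_zero_iff _ (xOp_injective _)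
  have h2 : ∀ l (N : ℕ) ν, B (mono (ν + Pi.single l ((N : ℤ) * m))) = 0 ↔ B (mono ν) = 0 :=
    fun l N => by
      induction N with
      | zero => simp
      | succ N ih =>
        intro ν
        have e : ν + Pi.single l (((N + 1 : ℕ) : ℤ) * m) =
            ν + Pi.single l ((N : ℤ) * m) + Pi.single l (m : ℤ) := by
          rw [add_assoc, ← Pi.single_add]
          push_cast
          rw [add_mul, one_mul]
        rw [e, h1, ih]
  have h3 : ∀ l (z : ℤ) ν, B (mono (ν + Pi.single l (z * m))) = 0 ↔ B (mono ν) = 0 :=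
    fun l z ν => by
      obtain ⟨N, rfl | rfl⟩ := z.eq_nat_or_neg
      · exact h2 l N ν
      · have h := h2 l N (ν + Pi.single l (-(N : ℤ) * m))
        rw [add_assoc, ← Pi.single_add] at h
        simpa using h.symm
  -- The coordinates are reduced modulo $m$ one at a time; `s` is the set of those already reduced.
  have h4 : ∀ (s : Finset (Fin r)) ν,
      B (mono (fun l => if l ∈ s then ν l % m else ν l)) = 0 ↔ B (mono ν) = 0 := fun s ν => by
    induction s using Finset.induction_on with
    | empty => simp
    | insert a s ha ih =>
      rw [← ih, ← h3 a (ν a / m)]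
      congr! 3
      funext l
      have := Int.emod_add_mul_ediv (ν a) m
      by_cases hl : l = a
      · subst hl
        simp [ha]
        linarith
      · simp [hl]
  refine end_ext fun ν => ?_
  rw [LinearMap.zero_apply, ← h4 Finset.univ]
  refine hbox _ fun l => ?_
  simp only [Finset.mem_univ, if_true]
  exact ⟨Int.emod_nonneg _ (by omega), Int.emod_lt_of_pos _ (by omega)⟩

end Hecke

/-! ### Defects of the Hecke relations permute the multiplication operators. -/

section Relations

variable {R A : Type*} [CommRing R] [Ring A] [Algebra R A]

/-- Purely formal: $T$ exchanges $X$ and $Y$ up to lower terms, so $T^2$ fixes them, and the lower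
terms cancel against those of $hT$. This makes `eq_zero_of_box` applicable to the defect. -/
theorem quadratic_mul_of_cross {h : R} {T X Y : A} (hX : T * X = Y * T - h • Y)
    (hY : T * Y = X * T + h • Y) :
    (T * T - h • T - 1) * X = X * (T * T - h • T - 1) ∧
      (T * T - h • T - 1) * Y = Y * (T * T - h • T - 1) := by
  constructor <;>
  · simp only [sub_mul, mul_sub, mul_add, mul_assoc, hX, hY, smul_mul_assoc, mul_smul_comm,
      one_mul, mul_one, smul_add, smul_sub]
    simp only [← mul_assoc, hX, hY, sub_mul, add_mul, smul_mul_assoc]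
    abel

theorem commutator_mul_of_cross {h : R} {T S X Y : A} (hX : T * X = Y * T - h • Y)
    (hY : T * Y = X * T + h • Y) (hSX : S * X = X * S) (hSY : S * Y = Y * S) :
    (T * S - S * T) * X = Y * (T * S - S * T) ∧ (T * S - S * T) * Y = X * (T * S - S * T) := by
  have hSX' : ∀ z, S * (X * z) = X * (S * z) := fun z => by rw [← mul_assoc, hSX, mul_assoc]
  have hSY' : ∀ z, S * (Y * z) = Y * (S * z) := fun z => by rw [← mul_assoc, hSY, mul_assoc]
  have hX' : ∀ z, T * (X * z) = Y * (T * z) - h • (Y * z) := fun z => by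
    rw [← mul_assoc, hX, sub_mul, mul_assoc, smul_mul_assoc]
  have hY' : ∀ z, T * (Y * z) = X * (T * z) + h • (Y * z) := fun z => by
    rw [← mul_assoc, hY, add_mul, mul_assoc, smul_mul_assoc]
  constructor <;>
  · simp only [sub_mul, mul_sub, mul_add, mul_assoc, hX, hY, hX', hY', hSX, hSY, hSX', hSY',
      mul_smul_comm]
    abel

/-- Both triple products act on $X,Y,Z$ by the longest permutation, exchanging $X$ and $Z$. The
lower terms cancel only modulo the quadratic relations, which therefore have to be established
beforehand. -/
theorem braid_mul_of_cross {h : R} {T S X Y Z : A} (hX : T * X = Y * T - h • Y)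
    (hY : T * Y = X * T + h • Y) (hZ : T * Z = Z * T) (gX : S * X = X * S)
    (gY : S * Y = Z * S - h • Z) (gZ : S * Z = Y * S + h • Z)
    (qT : T * T = h • T + 1) (qS : S * S = h • S + 1) :
    (T * S * T - S * T * S) * X = Z * (T * S * T - S * T * S) ∧
      (T * S * T - S * T * S) * Y = Y * (T * S * T - S * T * S) ∧
      (T * S * T - S * T * S) * Z = X * (T * S * T - S * T * S) := by
  have hX' : ∀ z, T * (X * z) = Y * (T * z) - h • (Y * z) := fun z => by
    rw [← mul_assoc, hX, sub_mul, mul_assoc, smul_mul_assoc]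
  have hY' : ∀ z, T * (Y * z) = X * (T * z) + h • (Y * z) := fun z => by
    rw [← mul_assoc, hY, add_mul, mul_assoc, smul_mul_assoc]
  have hZ' : ∀ z, T * (Z * z) = Z * (T * z) := fun z => by rw [← mul_assoc, hZ, mul_assoc]
  have gX' : ∀ z, S * (X * z) = X * (S * z) := fun z => by rw [← mul_assoc, gX, mul_assoc]
  have gY' : ∀ z, S * (Y * z) = Z * (S * z) - h • (Z * z) := fun z => by
    rw [← mul_assoc, gY, sub_mul, mul_assoc, smul_mul_assoc]
  have gZ' : ∀ z, S * (Z * z) = Y * (S * z) + h • (Z * z) := fun z => by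
    rw [← mul_assoc, gZ, add_mul, mul_assoc, smul_mul_assoc]
  refine ⟨?_, ?_, ?_⟩ <;>
  · simp only [sub_mul, mul_sub, mul_add, mul_assoc, hX, hY, hZ, gX, gY, gZ, hX', hY', hZ', gX',
      gY', gZ', qT, qS, mul_smul_comm, smul_add, smul_sub, mul_one]
    abel

end Relations

/-! ### Quadratic, commutation and braid relations, checked on the box. -/

section Hecke

variable {r : ℕ} {R : Type} [Field R] {m : ℕ} {k : R} {p : ℤ → R}

theorem abs_pairing_lt_of_box {ν : Fin r → ℤ} (h : ∀ l, 0 ≤ ν l ∧ ν l < m) (i : Fin (r - 1)) :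
    |pairing ν i| < m := by
  have h1 := h (left i)
  have h2 := h (right i)
  rw [abs_lt, pairing]
  constructor <;> linarith

theorem reflect_mem_box {ν : Fin r → ℤ} (h : ∀ l, 0 ≤ ν l ∧ ν l < m) (i : Fin (r - 1)) :
    ∀ l, 0 ≤ reflect i ν l ∧ reflect i ν l < m := fun _ => h _

theorem IsHeckeParam.mul_neg_of_abs_lt (hp : IsHeckeParam m k p) {s : ℤ} (h : |s| < m)
    (h0 : s ≠ 0) : p s * p (-s) = 1 :=
  hp.mul_neg s fun hd => h0 (Int.eq_zero_of_abs_lt_dvd hd h)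

/-- On the box this is a check on the span of $x^\nu$ and $x^{s_i\nu}$. It uses $p(s)p(-s)=1$ for
$0<|s|<m$ and, when $s_i\nu=\nu$, $p(0)=k$ with $k^2=(k-k^{-1})k+1$. -/
theorem heckeT_mul_self (hp : IsHeckeParam m k p) (i : Fin (r - 1)) :
    heckeT m k p i * heckeT m k p i = (k - k⁻¹) • heckeT m k p i + 1 := by
  have key : heckeT m k p i * heckeT m k p i - (k - k⁻¹) • heckeT m k p i - 1 = 0 := by
    have hq := quadratic_mul_of_cross (heckeT_mul_xOp_left hp i) (heckeT_mul_xOp_right hp i)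
    refine eq_zero_of_box hp.pos _ id (fun l => ?_) fun ν hν => ?_
    · rcases eq_or_ne l (left i) with rfl | h1
      · exact hq.1
      rcases eq_or_ne l (right i) with rfl | h2
      · exact hq.2
      have h3 := heckeT_mul_xOp_of_ne (m := m) (k := k) (p := p) i h1 h2
      simp only [sub_mul, mul_sub, id, smul_mul_assoc, mul_smul_comm, mul_assoc, h3, one_mul,
        mul_one]
      rw [← mul_assoc, h3, mul_assoc]
    · have e1 := heckeT_mono_of_abs_lt (k := k) (p := p) i ν (abs_pairing_lt_of_box hν i)
      have e2 := heckeT_mono_of_abs_lt (k := k) (p := p) i _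
        (abs_pairing_lt_of_box (reflect_mem_box hν i) i)
      rw [pairing_reflect, reflect_reflect] at e2
      simp only [LinearMap.sub_apply, Module.End.mul_apply, LinearMap.smul_apply,
        Module.End.one_apply, e1, map_add, map_smul, e2]
      have hk := hp.ne_zero
      rcases lt_trichotomy (pairing ν i) 0 with h | h | h
      · have hm := hp.mul_neg_of_abs_lt (abs_pairing_lt_of_box hν i) h.ne
        simp only [h, if_true, show ¬ -pairing ν i < 0 by omega, if_false, zero_smul, zero_add,
          smul_add, smul_smul, hm]
        module
      · rw [reflect_eq_self i ν h]
        simp only [h, hp.zero, neg_zero, lt_irrefl, if_false, zero_smul, zero_add, smul_smul]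
        match_scalars
        field_simp
        ring
      · have hm := hp.mul_neg_of_abs_lt (abs_pairing_lt_of_box hν i) h.ne'
        simp only [show ¬ pairing ν i < 0 by omega, if_false, show -pairing ν i < 0 by omega,
          if_true, zero_smul, zero_add, smul_add, smul_smul, hm]
        module
  rw [sub_sub, sub_eq_zero] at key
  exact key

theorem heckeT_mul_heckeTInv (hp : IsHeckeParam m k p) (i : Fin (r - 1)) :
    heckeT m k p i * heckeTInv m k p i = 1 := by
  rw [heckeTInv, mul_sub, heckeT_mul_self hp, mul_smul_comm, mul_one]
  abel

theorem heckeTInv_mul_heckeT (hp : IsHeckeParam m k p) (i : Fin (r - 1)) :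
    heckeTInv m k p i * heckeT m k p i = 1 := by
  rw [heckeTInv, sub_mul, heckeT_mul_self hp, smul_mul_assoc, one_mul]
  abel

theorem heckeT_commute (hp : IsHeckeParam m k p) (i j : Fin (r - 1))
    (hij : (i : ℕ) + 2 ≤ j) :
    heckeT m k p i * heckeT m k p j = heckeT m k p j * heckeT m k p i := by
  have d1 : left i ≠ left j := by simp [left, Fin.ext_iff]; omega
  have d2 : left i ≠ right j := by simp [left, right, Fin.ext_iff]; omega
  have d3 : right i ≠ left j := by simp [left, right, Fin.ext_iff]; omega
  have d4 : right i ≠ right j := by simp [right, Fin.ext_iff]; omega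
  have key : heckeT m k p i * heckeT m k p j - heckeT m k p j * heckeT m k p i = 0 := by
    have h1 := commutator_mul_of_cross (heckeT_mul_xOp_left hp i) (heckeT_mul_xOp_right hp i)
      (heckeT_mul_xOp_of_ne (m := m) (k := k) (p := p) j d1 d2)
      (heckeT_mul_xOp_of_ne (m := m) (k := k) (p := p) j d3 d4)
    have h2 := commutator_mul_of_cross (heckeT_mul_xOp_left hp j) (heckeT_mul_xOp_right hp j)
      (heckeT_mul_xOp_of_ne (m := m) (k := k) (p := p) i d1.symm d3.symm)
      (heckeT_mul_xOp_of_ne (m := m) (k := k) (p := p) i d2.symm d4.symm)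
    refine eq_zero_of_box hp.pos _
      -- The permutation $s_is_j$; the four positions are distinct because $j\ge i+2$.
      (fun l => if l = left i then right i else if l = right i then left i
        else if l = left j then right j else if l = right j then left j else l)
      (fun l => ?_) fun ν hν => ?_
    · by_cases c1 : l = left i
      · subst c1; simpa using h1.1
      by_cases c2 : l = right i
      · subst c2; simpa [(left_ne_right i).symm] using h1.2
      by_cases c3 : l = left j
      · subst c3
        have e := h2.1
        simp only [sub_mul, mul_sub, c1, c2, if_false, if_true] at e ⊢
        rw [← neg_sub, e, neg_sub]
      by_cases c4 : l = right j
      · subst c4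
        have e := h2.2
        simp only [sub_mul, mul_sub, c1, c2, c3, if_false, if_true] at e ⊢
        rw [← neg_sub, e, neg_sub]
      have e1 := heckeT_mul_xOp_of_ne (m := m) (k := k) (p := p) i c1 c2
      have e2 := heckeT_mul_xOp_of_ne (m := m) (k := k) (p := p) j c3 c4
      simp only [c1, c2, c3, c4, if_false, sub_mul, mul_sub, mul_assoc, e1, e2]
      rw [← mul_assoc, e1, mul_assoc, ← mul_assoc (heckeT m k p j), e2, mul_assoc]
    · have p1 : pairing (reflect i ν) j = pairing ν j := by
        simp only [pairing]
        rw [reflect_apply_of_ne i ν d1.symm d3.symm, reflect_apply_of_ne i ν d2.symm d4.symm]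
      have p2 : pairing (reflect j ν) i = pairing ν i := by
        simp only [pairing]
        rw [reflect_apply_of_ne j ν d1 d2, reflect_apply_of_ne j ν d3 d4]
      have c : reflect i (reflect j ν) = reflect j (reflect i ν) := by
        rw [reflect_eq_sub i, reflect_eq_sub j (reflect i ν), p1, p2, reflect_eq_sub i,
          reflect_eq_sub j]
        abel
      have e1 := heckeT_mono_of_abs_lt (k := k) (p := p) i ν (abs_pairing_lt_of_box hν i)
      have e2 := heckeT_mono_of_abs_lt (k := k) (p := p) j ν (abs_pairing_lt_of_box hν j)
      have e3 := heckeT_mono_of_abs_lt (k := k) (p := p) i _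
        (abs_pairing_lt_of_box (reflect_mem_box hν j) i)
      have e4 := heckeT_mono_of_abs_lt (k := k) (p := p) j _
        (abs_pairing_lt_of_box (reflect_mem_box hν i) j)
      rw [p2, c] at e3
      rw [p1] at e4
      simp only [LinearMap.sub_apply, Module.End.mul_apply, e1, e2, map_add, map_smul, e3, e4]
      module
  exact sub_eq_zero.1 key

theorem right_eq_left {i j : Fin (r - 1)} (hij : (i : ℕ) + 1 = j) : right i = left j := by
  simp [left, right, hij]

theorem heckeT_braid (hp : IsHeckeParam m k p) (i j : Fin (r - 1)) (hij : (i : ℕ) + 1 = j) :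
    heckeT m k p i * heckeT m k p j * heckeT m k p i =
      heckeT m k p j * heckeT m k p i * heckeT m k p j := by
  have d1 : left i ≠ left j := by simp [left, Fin.ext_iff]; omega
  have d2 : left i ≠ right j := by simp [left, right, Fin.ext_iff]; omega
  have d3 : right i = left j := right_eq_left hij
  have d4 : right i ≠ right j := by simp [right, Fin.ext_iff]; omega
  refine sub_eq_zero.1 ?_
  have hX := heckeT_mul_xOp_left hp i
  have hY := heckeT_mul_xOp_right hp i
  have gY := heckeT_mul_xOp_left hp j
  have gZ := heckeT_mul_xOp_right hp j
  rw [← d3] at gY gZ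
  obtain ⟨b1, b2, b3⟩ := braid_mul_of_cross hX hY
    (heckeT_mul_xOp_of_ne (m := m) (k := k) (p := p) i d2.symm d4.symm)
    (heckeT_mul_xOp_of_ne (m := m) (k := k) (p := p) j d1 d2) gY gZ
    (heckeT_mul_self hp i) (heckeT_mul_self hp j)
  -- $s_is_js_i$ transposes the outer two of the three positions and fixes the middle one.
  refine eq_zero_of_box hp.pos _ (Equiv.swap (left i) (right j)) (fun l => ?_) fun ν hν => ?_
  · rcases eq_or_ne l (left i) with rfl | c1
    · simpa using b1
    rcases eq_or_ne l (right j) with rfl | c2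
    · simpa using b3
    rw [Equiv.swap_apply_of_ne_of_ne c1 c2]
    rcases eq_or_ne l (right i) with rfl | c3
    · exact b2
    have e1 := heckeT_mul_xOp_of_ne (m := m) (k := k) (p := p) i c1 c3
    have e2 := heckeT_mul_xOp_of_ne (m := m) (k := k) (p := p) j (d3 ▸ c3) c2
    have e1' : ∀ z, heckeT m k p i * (xOp R m l * z) = xOp R m l * (heckeT m k p i * z) :=
      fun z => by rw [← mul_assoc, e1, mul_assoc]
    have e2' : ∀ z, heckeT m k p j * (xOp R m l * z) = xOp R m l * (heckeT m k p j * z) :=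
      fun z => by rw [← mul_assoc, e2, mul_assoc]
    simp only [sub_mul, mul_sub, mul_assoc, e1, e2, e1', e2']
  · -- the six elements of the orbit
    have q1 : ∀ ξ : Fin r → ℤ, pairing (reflect i ξ) j = pairing ξ i + pairing ξ j := fun ξ => by
      simp only [pairing]
      rw [← d3, reflect_apply_right, reflect_apply_of_ne i ξ d2.symm d4.symm]
      ring
    have q2 : ∀ ξ : Fin r → ℤ, pairing (reflect j ξ) i = pairing ξ i + pairing ξ j := fun ξ => by
      simp only [pairing]
      rw [d3, reflect_apply_left, reflect_apply_of_ne j ξ d1 d2]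
      ring
    have c : reflect j (reflect i (reflect j ν)) = reflect i (reflect j (reflect i ν)) := by
      rw [reflect_eq_sub j (reflect i (reflect j ν)), q1, q2, pairing_reflect,
        reflect_eq_sub i (reflect j ν), q2, reflect_eq_sub j ν,
        reflect_eq_sub i (reflect j (reflect i ν)), q2, q1, pairing_reflect,
        reflect_eq_sub j (reflect i ν), q1, reflect_eq_sub i ν]
      module
    have ei : ∀ ξ : Fin r → ℤ, (∀ l, 0 ≤ ξ l ∧ ξ l < m) → _ := fun ξ hξ =>
      heckeT_mono_of_abs_lt (k := k) (p := p) i ξ (abs_pairing_lt_of_box hξ i)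
    have ej : ∀ ξ : Fin r → ℤ, (∀ l, 0 ≤ ξ l ∧ ξ l < m) → _ := fun ξ hξ =>
      heckeT_mono_of_abs_lt (k := k) (p := p) j ξ (abs_pairing_lt_of_box hξ j)
    have bi := reflect_mem_box hν i
    have bj := reflect_mem_box hν j
    have f1 := ei ν hν
    have f2 := ej ν hν
    have f3 := ei _ bi
    have f4 := ej _ bi
    have f5 := ei _ bj
    have f6 := ej _ bj
    have f7 := ei _ (reflect_mem_box bi j)
    have f8 := ej _ (reflect_mem_box bj i)
    have r1 : pairing (reflect j (reflect i ν)) i = pairing ν j := by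
      rw [q2, pairing_reflect, q1]; ring
    have r2 : pairing (reflect i (reflect j ν)) j = pairing ν i := by
      rw [q1, pairing_reflect, q2]; ring
    rw [pairing_reflect, reflect_reflect] at f3 f6
    rw [q1] at f4
    rw [q2] at f5
    rw [r1] at f7
    rw [r2, c] at f8
    have ma := hp.mul_neg_of_abs_lt (abs_pairing_lt_of_box hν i)
    have mb := hp.mul_neg_of_abs_lt (abs_pairing_lt_of_box hν j)
    have za := reflect_eq_self i ν
    have zb := reflect_eq_self j ν
    have zab := reflect_eq_self j (reflect i ν)
    have zba := reflect_eq_self i (reflect j ν)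
    rw [q1] at zab
    rw [q2] at zba
    have hk : k * k = (k - k⁻¹) * k + 1 := by
      have := hp.ne_zero
      field_simp
      ring
    have p0 : ∀ s, s = 0 → p s = k := fun s hs => hs ▸ hp.zero
    simp only [LinearMap.sub_apply, Module.End.mul_apply, f1, f2, map_add, map_smul, f3, f4, f5,
      f6, f7, f8]
    clear f1 f2 f3 f4 f5 f6 f7 f8 ei ej bi bj
    generalize pairing ν i = a at *
    generalize pairing ν j = b at *
    generalize k - k⁻¹ = h at *
    -- The signs of $a$, $b$, $a+b$ decide which terms with $k-k^{-1}$ occur and which exponents of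
    -- the orbit coincide. The five identities that are not formal need only $p(s)p(-s)=1$ or its
    -- substitute `hk` at $s=0$.
    rcases lt_trichotomy a 0 with ha | ha | ha <;> rcases lt_trichotomy b 0 with hb | hb | hb <;>
      rcases lt_trichotomy (a + b) 0 with hab | hab | hab <;> try omega
    all_goals
      simp (disch := omega) only [if_pos, if_neg, za, zb, zab, zba, p0, zero_smul, zero_add,
        smul_add, smul_smul, sub_eq_zero]
      try match_scalars <;> try ring1
    · linear_combination h * ma ha.ne - h * mb hb.ne
    · linear_combination h * ma ha.ne - h * hk
    · linear_combination h * ma ha.ne - h * mb hb.ne'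
    · linear_combination h * hk - h * mb hb.ne
    · linear_combination h * ma ha.ne' - h * mb hb.ne

end Hecke

/-! ### Commuting elements in the extended affine braid group. -/

section Group

variable {G : Type*} [Group G]

/-- The product `t_{n-1} ⋯ t_0`. -/
def descProd {M : Type*} [Monoid M] (t : ℕ → M) : ℕ → M
  | 0 => 1
  | n + 1 => t n * descProd t n

/-- The elements `y_0 = w t_{N-1} ⋯ t_0` and `y_{i+1} = t_i⁻¹ y_i t_i⁻¹`. -/
def yElt (t : ℕ → G) (w : G) (N : ℕ) : ℕ → G
  | 0 => w * descProd t N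
  | i + 1 => (t i)⁻¹ * yElt t w N i * (t i)⁻¹

/-- The relations of the extended affine braid group of type `GL_{N+1}`. -/
structure IsAffineBraid (t : ℕ → G) (w : G) (N : ℕ) : Prop where
  braid : ∀ i, i + 1 < N → t i * t (i + 1) * t i = t (i + 1) * t i * t (i + 1)
  comm : ∀ i j, i + 2 ≤ j → j < N → Commute (t i) (t j)
  shift : ∀ i, i + 1 < N → w * t i = t (i + 1) * w
  shift_last : ∀ n, n + 1 = N → w * w * t n = t 0 * (w * w)

variable {t : ℕ → G} {w : G} {N : ℕ}

theorem IsAffineBraid.commute_descProd (H : IsAffineBraid t w N) {i n : ℕ} (hn : n + 1 ≤ i)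
    (hi : i < N) : Commute (t i) (descProd t n) := by
  induction n with
  | zero => exact Commute.one_right _
  | succ n ih => exact ((H.comm n i (by omega) hi).symm).mul_right (ih (by omega))

/-- Conjugation by $t_{n-1}\cdots t_0$ lowers indices by one, opposite to $w$, so $t_{i+1}$ commutes
with $y_0=w\,t_{N-1}\cdots t_0$. One braid move does the work at $n=i+2$; later factors commute with
$t_i$. -/
theorem IsAffineBraid.descProd_mul (H : IsAffineBraid t w N) {i n : ℕ} (hi : i + 1 < n)
    (hn : n ≤ N) : descProd t n * t (i + 1) = t i * descProd t n := by
  induction n, hi using Nat.le_induction with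
  | base =>
    have h := (H.commute_descProd (i := i + 1) (n := i) le_rfl (by omega)).eq
    simp only [descProd]
    calc t (i + 1) * (t i * descProd t i) * t (i + 1)
        = t (i + 1) * t i * (descProd t i * t (i + 1)) := by group
      _ = t (i + 1) * t i * t (i + 1) * descProd t i := by rw [← h]; group
      _ = t i * (t (i + 1) * (t i * descProd t i)) := by rw [← H.braid i (by omega)]; group
  | succ n hi ih =>
    simp only [descProd]
    rw [mul_assoc, ih (by omega), ← mul_assoc, ← (H.comm i n (by omega) (by omega)).eq, mul_assoc]

theorem descProd_succ' (t : ℕ → G) (n : ℕ) :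
    descProd t (n + 1) = descProd (fun i => t (i + 1)) n * t 0 := by
  induction n with
  | zero => simp [descProd]
  | succ n ih => rw [descProd, ih, descProd, mul_assoc]

theorem IsAffineBraid.mul_descProd (H : IsAffineBraid t w N) {n : ℕ} (hn : n < N) :
    w * descProd t n = descProd (fun i => t (i + 1)) n * w := by
  induction n with
  | zero => simp [descProd]
  | succ n ih =>
    rw [descProd, descProd, ← mul_assoc, H.shift n (by omega), mul_assoc, ih (by omega), mul_assoc]

/-- The product $(t_{n-1}\cdots t_0)(t_n\cdots t_1)$ carries $t_0$ to $t_n$, by one braid move per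
induction step. Together with `shift_last` this closes the loop in `commute_yElt_zero_one`. -/
theorem IsAffineBraid.descProd_mul_descProd (H : IsAffineBraid t w N) {n : ℕ} (hn : n < N) :
    descProd t n * descProd (fun i => t (i + 1)) n * t 0 =
      t n * (descProd t n * descProd (fun i => t (i + 1)) n) := by
  induction n with
  | zero => simp [descProd]
  | succ n ih =>
    have ih := ih (by omega)
    have h := (H.commute_descProd (i := n + 1) (n := n) le_rfl hn).eq
    simp only [descProd]
    calc t n * descProd t n * (t (n + 1) * descProd (fun i => t (i + 1)) n) * t 0
        = t n * (descProd t n * t (n + 1)) * descProd (fun i => t (i + 1)) n * t 0 := by group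
      _ = t n * t (n + 1) * (descProd t n * descProd (fun i => t (i + 1)) n * t 0) := by
        rw [← h]; group
      _ = (t n * t (n + 1) * t n) * (descProd t n * descProd (fun i => t (i + 1)) n) := by
        rw [ih]; group
      _ = t (n + 1) * (t n * (t (n + 1) * descProd t n) * descProd (fun i => t (i + 1)) n) := by
        rw [H.braid n hn]; group
      _ = _ := by rw [h]; group

theorem IsAffineBraid.commute_yElt_zero (H : IsAffineBraid t w N) {i : ℕ} (hi : i + 1 < N) :
    Commute (t (i + 1)) (yElt t w N 0) := by
  change t (i + 1) * (w * descProd t N) = w * descProd t N * t (i + 1)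
  rw [mul_assoc w, H.descProd_mul hi le_rfl, ← mul_assoc, ← mul_assoc, H.shift i hi]

theorem IsAffineBraid.commute_yElt_of_lt (H : IsAffineBraid t w N) {i j : ℕ} (hij : j < i)
    (hi : i < N) : Commute (t i) (yElt t w N j) := by
  induction j with
  | zero =>
    obtain ⟨i, rfl⟩ : ∃ i', i = i' + 1 := ⟨i - 1, by omega⟩
    exact H.commute_yElt_zero hi
  | succ j ih =>
    have h := (H.comm j i hij hi).symm.inv_right
    exact (h.mul_right (ih (by omega))).mul_right h

/-- In $y_{i+2}=t_{i+1}^{-1}t_i^{-1}\,y_i\,t_i^{-1}t_{i+1}^{-1}$ the braid relation turns $t_i$ into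
$t_{i+1}$ on passing the left factors. That element commutes with $y_i$ and turns back into $t_i$ on
the right. For larger $j$ only commuting factors are added. -/
theorem IsAffineBraid.commute_yElt_of_gt (H : IsAffineBraid t w N) {i j : ℕ} (hij : i + 2 ≤ j)
    (hj : j ≤ N) : Commute (t i) (yElt t w N j) := by
  induction j, hij using Nat.le_induction with
  | base =>
    have h := (H.commute_yElt_of_lt (i := i + 1) (j := i) (by omega) (by omega)).eq
    have b := H.braid i (by omega)
    have b1 : t i * (t (i + 1))⁻¹ * (t i)⁻¹ = (t (i + 1))⁻¹ * (t i)⁻¹ * t (i + 1) := by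
      rw [← mul_left_inj (t i), ← mul_right_inj (t (i + 1)), ← mul_right_inj (t i)]
      rw [← mul_left_inj (t (i + 1)), ← mul_left_inj (t i)]
      have : t i * (t (i + 1) * (t i * (t (i + 1))⁻¹ * (t i)⁻¹ * t i)) * t (i + 1) * t i =
        (t i * t (i + 1) * t i) * t i := by group
      rw [this, b]
      have : t i * (t (i + 1) * ((t (i + 1))⁻¹ * (t i)⁻¹ * t (i + 1) * t i)) * t (i + 1) * t i =
        t (i + 1) * t i * t (i + 1) * t i := by group
      rw [this]
    have b2 : t (i + 1) * (t i)⁻¹ * (t (i + 1))⁻¹ = (t i)⁻¹ * (t (i + 1))⁻¹ * t i := by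
      rw [← mul_left_inj (t (i + 1)), ← mul_right_inj (t i)]
      rw [← mul_right_inj (t (i + 1))]
      calc t (i + 1) * (t i * (t (i + 1) * (t i)⁻¹ * (t (i + 1))⁻¹ * t (i + 1)))
          = (t (i + 1) * t i * t (i + 1)) * (t i)⁻¹ := by group
        _ = t i * t (i + 1) := by rw [← b]; group
        _ = _ := by group
    change t i * ((t (i + 1))⁻¹ * ((t i)⁻¹ * yElt t w N i * (t i)⁻¹) * (t (i + 1))⁻¹) =
      (t (i + 1))⁻¹ * ((t i)⁻¹ * yElt t w N i * (t i)⁻¹) * (t (i + 1))⁻¹ * t i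
    generalize yElt t w N i = y at *
    calc _ = (t i * (t (i + 1))⁻¹ * (t i)⁻¹) * y * (t i)⁻¹ * (t (i + 1))⁻¹ := by group
      _ = (t (i + 1))⁻¹ * (t i)⁻¹ * (t (i + 1) * y) * (t i)⁻¹ * (t (i + 1))⁻¹ := by
        rw [b1]; group
      _ = (t (i + 1))⁻¹ * (t i)⁻¹ * y * (t (i + 1) * (t i)⁻¹ * (t (i + 1))⁻¹) := by
        rw [h]; group
      _ = _ := by rw [b2]; group
  | succ j hij ih =>
    have h := (H.comm i j hij (by omega)).inv_right
    exact (h.mul_right (ih (by omega))).mul_right h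

/-- With $S=t_n\cdots t_1$ and $N=n+1$ one has $y_0=wSt_0$ and $y_1=t_0^{-1}wS$, so the claim is
that $t_0$ commutes with $(wS)^2$. This square equals $w^2DS$ with $D=t_{n-1}\cdots t_0$; $DS$
carries $t_0$ to $t_n$, and $w^2$ carries $t_n$ back to $t_0$. -/
theorem IsAffineBraid.commute_yElt_zero_one (H : IsAffineBraid t w N) (hN : 1 ≤ N) :
    Commute (yElt t w N 0) (yElt t w N 1) := by
  obtain ⟨n, rfl⟩ : ∃ n, N = n + 1 := ⟨N - 1, by omega⟩
  have h1 := H.mul_descProd (n := n) (by omega)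
  have h2 := H.descProd_mul_descProd (n := n) (by omega)
  have h3 := H.shift_last n rfl
  change (w * descProd t (n + 1)) * ((t 0)⁻¹ * (w * descProd t (n + 1)) * (t 0)⁻¹) =
    ((t 0)⁻¹ * (w * descProd t (n + 1)) * (t 0)⁻¹) * (w * descProd t (n + 1))
  rw [descProd_succ']
  generalize descProd (fun i => t (i + 1)) n = S at *
  generalize descProd t n = D at *
  have e : t 0 * (w * S * (w * S)) = w * S * (w * S) * t 0 := by
    calc t 0 * (w * S * (w * S)) = t 0 * w * (S * w) * S := by group
      _ = (t 0 * (w * w)) * D * S := by rw [← h1]; group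
      _ = w * w * (t n * (D * S)) := by rw [← h3]; group
      _ = w * (w * D) * S * t 0 := by rw [← h2]; group
      _ = _ := by rw [h1]; group
  calc _ = (t 0)⁻¹ * (t 0 * (w * S * (w * S))) := by group
    _ = (t 0)⁻¹ * (w * S * (w * S) * t 0) := by rw [e]
    _ = _ := by group

/-- Both indices are raised by the recursion $y_{i+1}=t_i^{-1}y_it_i^{-1}$, whose factors $t_i$
commute with the other element. Only the pair $y_0,y_1$ is not reached in this way. -/
theorem IsAffineBraid.commute_yElt_of_lt' (H : IsAffineBraid t w N) {i j : ℕ} (hij : i < j)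
    (hj : j ≤ N) : Commute (yElt t w N i) (yElt t w N j) := by
  induction i generalizing j with
  | zero =>
    induction j, hij using Nat.le_induction with
    | base => exact H.commute_yElt_zero_one hj
    | succ j hij ih =>
      have h := (H.commute_yElt_of_lt (i := j) (j := 0) (by omega) (by omega)).symm.inv_right
      exact (h.mul_right (ih (by omega))).mul_right h
  | succ i ih =>
    have h := (H.commute_yElt_of_gt (i := i) (j := j) hij hj).inv_left
    exact (h.mul_left (ih (by omega) hj)).mul_left h

theorem IsAffineBraid.commute_yElt (H : IsAffineBraid t w N) {i j : ℕ} (hi : i ≤ N)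
    (hj : j ≤ N) : Commute (yElt t w N i) (yElt t w N j) := by
  rcases lt_trichotomy i j with h | rfl | h
  · exact H.commute_yElt_of_lt' h hj
  · exact Commute.refl _
  · exact (H.commute_yElt_of_lt' h hi).symm

end Group

/-! ### A criterion for semilinear monomial maps to intertwine Hecke operators. -/

section Intertwine

variable {r : ℕ} {R S : Type} [Field R] [Field S]

theorem semilinear_ext {f : R →+* S} {A B : Laurent r R →ₛₗ[f] Laurent r S}
    (h : ∀ ν, A (mono ν) = B (mono ν)) : A = B := by
  refine LinearMap.ext fun x => ?_
  induction x using AddMonoidAlgebra.induction_linear with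
  | zero => simp
  | add x y hx hy => simp [hx, hy]
  | single ν c =>
    have : (AddMonoidAlgebra.single ν c : Laurent r R) = c • mono ν := by simp [mono]
    rw [this, map_smulₛₗ, map_smulₛₗ, h]

/-- A semilinear map that carries monomials to multiples of monomials compatibly with the root
strings in the directions `α_i` and `α_j` intertwines `T_i` and `T_j`. -/
theorem semilinear_comp_heckeT {f : R →+* S} (W : Laurent r R →ₛₗ[f] Laurent r S)
    {m m' : ℕ} {k : R} {k' : S} {p : ℤ → R} {p' : ℤ → S} (i j : Fin (r - 1))
    (χ : (Fin r → ℤ) → S) (ρ : (Fin r → ℤ) → Fin r → ℤ) (hk : f k = k')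
    (hW : ∀ ν (z : ℤ), W (mono (z • (m : ℤ) • simpleRoot i + ν)) =
      χ ν • mono (z • (m' : ℤ) • simpleRoot j + ρ ν))
    (hW' : ∀ ν, W (mono (reflect i ν)) = χ ν • mono (reflect j (ρ ν)))
    (hq : ∀ ν, pairing (ρ ν) j / (m' : ℤ) = pairing ν i / (m : ℤ))
    (hp : ∀ ν, p' (pairing (ρ ν) j) = f (p (pairing ν i))) (x : Laurent r R) :
    W (heckeT m k p i x) = heckeT m' k' p' j (W x) := by
  have key : W.comp (heckeT m k p i) = (heckeT m' k' p' j).comp W := by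
    refine semilinear_ext fun ν => ?_
    have h0 := hW ν 0
    simp only [zero_smul, zero_add] at h0
    simp only [LinearMap.comp_apply, h0, map_smul, heckeT_mono, map_add, map_smulₛₗ, hW', hq, hp,
      map_sub, map_inv₀, hk, geomQuot, sub_mul, Finset.sum_mul, mono_mul_mono, map_sum, hW,
      smul_add, smul_sub, Finset.smul_sum]
    congr 1
    · congr 1 <;> exact Finset.sum_congr rfl fun c _ => smul_comm _ _ _
    · exact smul_comm _ _ _
  exact LinearMap.congr_fun key x

end Intertwine

/-! ### The cyclic rotation of exponents. -/

section Rotate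

variable {r : ℕ}

theorem rotate_succ (ν : Fin r → ℤ) (l : ℕ) (h : l + 1 < r) :
    rotate ν ⟨l + 1, h⟩ = ν ⟨l, by omega⟩ := by
  unfold rotate
  rw [Function.comp_apply]
  congr 1
  rw [Equiv.symm_apply_eq]
  obtain ⟨n, rfl⟩ : ∃ n, r = n + 1 := ⟨r - 1, by omega⟩
  exact (finRotate_of_lt (by omega)).symm

theorem rotate_zero [NeZero r] (ν : Fin r → ℤ) (h : 0 < r) :
    rotate ν ⟨0, h⟩ = lastCoord ν := by
  unfold rotate lastCoord
  rw [Function.comp_apply]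
  congr 1
  rw [Equiv.symm_apply_eq]
  obtain ⟨n, rfl⟩ : ∃ n, r = n + 1 := ⟨r - 1, by omega⟩
  exact finRotate_last'.symm

theorem rotate_rotateInv (ν : Fin r → ℤ) : rotate (rotateInv ν) = ν := by
  funext l
  exact congrArg ν ((finRotate r).apply_symm_apply l)

theorem rotateInv_rotate (ν : Fin r → ℤ) : rotateInv (rotate ν) = ν := by
  funext l
  exact congrArg ν ((finRotate r).symm_apply_apply l)

theorem rotate_add (ν ξ : Fin r → ℤ) : rotate (ν + ξ) = rotate ν + rotate ξ := rfl

theorem rotate_smul (z : ℤ) (ν : Fin r → ℤ) : rotate (z • ν) = z • rotate ν := rfl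

theorem rotate_reflect (i j : Fin (r - 1)) (hij : (i : ℕ) + 1 = j) (ν : Fin r → ℤ) :
    rotate (reflect i ν) = reflect j (rotate ν) := by
  have hj := j.2
  have : NeZero r := ⟨by omega⟩
  funext l
  obtain ⟨l, hl⟩ := l
  have hl1 : (left j) = ⟨i + 1, by omega⟩ := by simp [left, hij]
  have hr1 : (right j) = ⟨i + 1 + 1, by omega⟩ := by simp [right, hij]
  rcases l with _ | l
  · rw [reflect_apply_of_ne j _ (by rw [hl1]; simp) (by rw [hr1]; simp), rotate_zero, rotate_zero]
    exact reflect_apply_of_ne i _ (by simp [left, Fin.ext_iff]; omega)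
      (by simp [right, Fin.ext_iff]; omega)
  rw [rotate_succ]
  by_cases h1 : l = i
  · subst h1
    rw [← hl1, reflect_apply_left, hr1, rotate_succ]
    exact reflect_apply_left i ν
  by_cases h2 : l = i + 1
  · subst h2
    rw [← hr1, reflect_apply_right, hl1, rotate_succ]
    exact reflect_apply_right i ν
  rw [reflect_apply_of_ne i _ (by simpa [left, Fin.ext_iff] using h1)
    (by simpa [right, Fin.ext_iff] using h2), reflect_apply_of_ne j _
    (by rw [hl1]; simpa [Fin.ext_iff] using h1) (by rw [hr1]; simpa [Fin.ext_iff] using h2),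
    rotate_succ]

theorem pairing_rotate (i j : Fin (r - 1)) (hij : (i : ℕ) + 1 = j) (ν : Fin r → ℤ) :
    pairing (rotate ν) j = pairing ν i := by
  have hj := j.2
  have hl1 : (left j) = ⟨i + 1, by omega⟩ := by simp [left, hij]
  have hr1 : (right j) = ⟨i + 1 + 1, by omega⟩ := by simp [right, hij]
  rw [pairing, hl1, hr1, rotate_succ, rotate_succ]
  rfl

theorem pairing_simpleRoot (i : Fin (r - 1)) : pairing (simpleRoot i) i = 2 := by
  have := left_ne_right i
  simp [pairing, simpleRoot_apply, this.symm]

theorem rotate_simpleRoot (i j : Fin (r - 1)) (hij : (i : ℕ) + 1 = j) :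
    rotate (simpleRoot i) = simpleRoot j := by
  -- Equivariance is applied to the root itself; as $(\alpha_i,\alpha_i^\vee)=2$, it yields twice
  -- the claim, and $2$ cancels in $\mathbb Z$.
  have h := rotate_reflect i j hij (simpleRoot i)
  rw [reflect_eq_sub, reflect_eq_sub, pairing_rotate i j hij, pairing_simpleRoot, sub_eq_add_neg,
    rotate_add, ← neg_smul, rotate_smul] at h
  have h2 : (2 : ℤ) • rotate (simpleRoot i) = (2 : ℤ) • simpleRoot j := by
    rw [neg_smul] at h
    have h3 := add_left_cancel (h.trans (sub_eq_add_neg _ _))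
    exact neg_injective h3
  funext l
  have := congrFun h2 l
  simp at this
  exact this

end Rotate

/-! ### Relations between $\omega$ and the Hecke operators. -/

section Omega

variable {r : ℕ} [NeZero r] {R : Type} [Field R] {m : ℕ} {k c : R} {p : ℤ → R}

theorem omegaOp_mono (ν : Fin r → ℤ) :
    omegaOp c (mono ν : Laurent r R) = c ^ (-lastCoord ν) • mono (rotate ν) := by
  rw [omegaOp, ofMonomials_mono]

theorem rotateInv_zero_eq (ν : Fin r → ℤ) : lastCoord (rotateInv ν) = ν 0 := by
  conv_rhs => rw [← rotate_rotateInv ν]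
  exact (rotate_zero _ (Nat.pos_of_ne_zero (NeZero.ne r))).symm

theorem omegaOp_mul_omegaInvOp (hc : c ≠ 0) :
    (omegaOp c : Module.End R (Laurent r R)) * omegaInvOp c = 1 := by
  refine end_ext fun ν => ?_
  rw [Module.End.mul_apply, omegaInvOp, ofMonomials_mono, map_smul, omegaOp_mono,
    rotateInv_zero_eq, rotate_rotateInv, smul_smul, ← zpow_add₀ hc]
  simp

theorem omegaInvOp_mul_omegaOp (hc : c ≠ 0) :
    (omegaInvOp c : Module.End R (Laurent r R)) * omegaOp c = 1 := by
  refine end_ext fun ν => ?_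
  rw [Module.End.mul_apply, omegaOp_mono, map_smul, omegaInvOp, ofMonomials_mono,
    rotateInv_rotate, smul_smul, ← zpow_add₀ hc]
  rw [show (rotate ν 0) = lastCoord ν from rotate_zero ν (Nat.pos_of_ne_zero (NeZero.ne r))]
  simp

/-- The root $\alpha_i$ does not involve the last coordinate, so the power of $c$ is constant along
its strings, and `semilinear_comp_heckeT` applies with $\alpha_i\mapsto\alpha_{i+1}$. -/
theorem omegaOp_mul_heckeT (i j : Fin (r - 1)) (hij : (i : ℕ) + 1 = j) :
    omegaOp c * heckeT m k p i = heckeT m k p j * omegaOp c := by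
  have hj := j.2
  have hlast : ∀ ν : Fin r → ℤ, lastCoord (reflect i ν) = lastCoord ν := fun ν =>
    reflect_apply_of_ne i ν (by simp [left, Fin.ext_iff]; omega)
      (by simp [right, Fin.ext_iff]; omega)
  have hroot : lastCoord (simpleRoot i : Fin r → ℤ) = 0 := by
    rw [lastCoord, simpleRoot_apply, if_neg (by simp [left, Fin.ext_iff]; omega),
      if_neg (by simp [right, Fin.ext_iff]; omega)]
  refine LinearMap.ext fun x => ?_
  refine semilinear_comp_heckeT (f := RingHom.id R) (omegaOp c) i j
    (fun ν => c ^ (-lastCoord ν)) rotate rfl (fun ν z => ?_) (fun ν => ?_) (fun ν => ?_)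
    (fun ν => ?_) x
  · rw [omegaOp_mono, rotate_add, rotate_smul, rotate_smul, rotate_simpleRoot i j hij]
    congr 3
    change z * (m * lastCoord (simpleRoot i)) + lastCoord ν = _
    rw [hroot]; simp
  · rw [omegaOp_mono, rotate_reflect i j hij, hlast]
  · rw [pairing_rotate i j hij]
  · rw [pairing_rotate i j hij]; rfl

/-- One rotation carries the last simple root to $\epsilon_r-\epsilon_1$, which is not simple; two
carry it to $\alpha_1$. The exponent of $c$ in $\omega^2$ is minus the sum of the last two
coordinates, which is constant along the root strings. -/
theorem omegaOp_sq_mul_heckeT (hc : c ≠ 0) (i j : Fin (r - 1)) (hi : (i : ℕ) + 2 = r)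
    (hj : (j : ℕ) = 0) :
    omegaOp c * omegaOp c * heckeT m k p i = heckeT m k p j * (omegaOp c * omegaOp c) := by
  have hlj : left j = ⟨0, by omega⟩ := by simp [left, hj]
  have hrj : right j = ⟨0 + 1, by omega⟩ := by simp [right, hj]
  have hli : left i = ⟨r - 2, by omega⟩ := by simp [left, Fin.ext_iff]; omega
  have hri : right i = ⟨r - 1, by omega⟩ := by simp [right, Fin.ext_iff]; omega
  have e0 : ∀ ν : Fin r → ℤ, lastCoord ν = ν (right i) := fun ν => by rw [hri]; rfl
  have e1 : ∀ ν : Fin r → ℤ, lastCoord (rotate ν) = ν (left i) := fun ν => by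
    have : (⟨r - 1, by omega⟩ : Fin r) = ⟨r - 2 + 1, by omega⟩ := by simp [Fin.ext_iff]; omega
    rw [lastCoord, this, rotate_succ, hli]
  have f0 : ∀ ν : Fin r → ℤ, rotate (rotate ν) (left j) = ν (left i) := fun ν => by
    rw [hlj, rotate_zero, e1]
  have f1 : ∀ ν : Fin r → ℤ, rotate (rotate ν) (right j) = ν (right i) := fun ν => by
    rw [hrj, rotate_succ, rotate_zero, e0]
  have hpair : ∀ ν : Fin r → ℤ, pairing (rotate (rotate ν)) j = pairing ν i := fun ν => by
    rw [pairing, f0, f1]; rfl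
  have f2 : ∀ ν ξ : Fin r → ℤ, (∀ l, l ≠ left i → l ≠ right i → ν l = ξ l) →
      ∀ l, l ≠ left j → l ≠ right j → rotate (rotate ν) l = rotate (rotate ξ) l := by
    intro ν ξ h l h1 h2
    obtain ⟨l, hl⟩ := l
    rw [hlj, Ne, Fin.ext_iff] at h1
    rw [hrj, Ne, Fin.ext_iff] at h2
    obtain ⟨l, rfl⟩ : ∃ l', l = l' + 1 + 1 := ⟨l - 2, by simp only at h1 h2; omega⟩
    rw [rotate_succ, rotate_succ, rotate_succ, rotate_succ]
    exact h _ (by rw [hli, Ne, Fin.ext_iff]; simp only; omega)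
      (by rw [hri, Ne, Fin.ext_iff]; simp only; omega)
  have hrefl : ∀ ν : Fin r → ℤ, rotate (rotate (reflect i ν)) = reflect j (rotate (rotate ν)) := by
    intro ν
    funext l
    by_cases h1 : l = left j
    · rw [h1, reflect_apply_left, f0, f1, reflect_apply_left]
    by_cases h2 : l = right j
    · rw [h2, reflect_apply_right, f0, f1, reflect_apply_right]
    rw [reflect_apply_of_ne j _ h1 h2]
    exact f2 _ _ (fun l h h' => reflect_apply_of_ne i ν h h') l h1 h2
  have hroot : rotate (rotate (simpleRoot i)) = simpleRoot j := by
    funext l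
    by_cases h1 : l = left j
    · rw [h1, f0]; simp [simpleRoot_apply]
    by_cases h2 : l = right j
    · rw [h2, f1]; simp [simpleRoot_apply, (left_ne_right i).symm, (left_ne_right j).symm]
    rw [f2 _ 0 (fun l h h' => by simp [simpleRoot_apply, h, h']) l h1 h2, simpleRoot_apply,
      if_neg h1, if_neg h2]
    rfl
  have hW : ∀ ν : Fin r → ℤ, (omegaOp c * omegaOp c : Module.End R (Laurent r R)) (mono ν) =
      c ^ (-(ν (left i) + ν (right i))) • mono (rotate (rotate ν)) := fun ν => by
    rw [Module.End.mul_apply, omegaOp_mono, map_smul, omegaOp_mono, smul_smul, e0, e1,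
      ← zpow_add₀ hc]
    congr 2
    ring
  refine LinearMap.ext fun x => ?_
  refine semilinear_comp_heckeT (f := RingHom.id R) (omegaOp c * omegaOp c) i j
    (fun ν => c ^ (-(ν (left i) + ν (right i)))) (fun ν => rotate (rotate ν)) rfl (fun ν z => ?_)
    (fun ν => ?_) (fun ν => ?_) (fun ν => ?_) x
  · rw [hW, rotate_add, rotate_add, rotate_smul, rotate_smul, rotate_smul, rotate_smul, hroot]
    congr 2
    simp [simpleRoot_apply, (left_ne_right i).symm]
    ring
  · rw [hW, hrefl, reflect_apply_left, reflect_apply_right, add_comm (ν (right i))]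
  · rw [hpair]
  · rw [hpair]; rfl

end Omega

/-! ### The list products in $Y_i$ as recursions. -/

section YUnit

variable {M : Type*} [Monoid M] {n : ℕ}

theorem filter_finRange_lt_succ {n i : ℕ} (h : i < n) :
    ((List.finRange n).filter fun l => l.val < i + 1) =
      ((List.finRange n).filter fun l => l.val < i) ++ [⟨i, h⟩] := by
  induction n generalizing i with
  | zero => omega
  | succ n ih =>
    rw [List.finRange_succ, List.filter_cons, List.filter_cons, List.filter_map, List.filter_map]
    rcases i with _ | i
    · simp [Function.comp_def]
    · have := ih (i := i) (by omega)
      simp only [Function.comp_def, Fin.val_succ, Nat.add_lt_add_iff_right, this]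
      simp

theorem filter_finRange_le {n i : ℕ} (h : i < n) :
    ((List.finRange n).filter fun l => i ≤ l.val) =
      ⟨i, h⟩ :: ((List.finRange n).filter fun l => i + 1 ≤ l.val) := by
  induction n generalizing i with
  | zero => omega
  | succ n ih =>
    rw [List.finRange_succ, List.filter_cons, List.filter_cons, List.filter_map, List.filter_map]
    rcases i with _ | i
    · simp [Function.comp_def]
    · have := ih (i := i) (by omega)
      simp only [Function.comp_def, Fin.val_succ, Nat.add_le_add_iff_right, this]
      simp

/-- The product `f_{i-1} ⋯ f_0`. -/
def lowProd (f : Fin n → M) (i : ℕ) : M :=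
  ((((List.finRange n).filter fun l => l.val < i).reverse).map f).prod

/-- The product `f_{n-1} ⋯ f_i`. -/
def highProd (f : Fin n → M) (i : ℕ) : M :=
  ((((List.finRange n).filter fun l => i ≤ l.val).reverse).map f).prod

theorem lowProd_zero (f : Fin n → M) : lowProd f 0 = 1 := by simp [lowProd]

theorem lowProd_succ (f : Fin n → M) {i : ℕ} (h : i < n) :
    lowProd f (i + 1) = f ⟨i, h⟩ * lowProd f i := by
  rw [lowProd, filter_finRange_lt_succ h]
  simp [lowProd]

theorem highProd_self (f : Fin n → M) : highProd f n = 1 := by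
  rw [highProd, List.filter_eq_nil_iff.2]
  · simp
  · simp

theorem highProd_succ (f : Fin n → M) {i : ℕ} (h : i < n) :
    highProd f i = highProd f (i + 1) * f ⟨i, h⟩ := by
  rw [highProd, filter_finRange_le h]
  simp [highProd]

/-- The extension of a finite family by ones. -/
def extendOne (f : Fin n → M) (i : ℕ) : M := if h : i < n then f ⟨i, h⟩ else 1

theorem highProd_mul_descProd (f : Fin n → M) {i : ℕ} (h : i ≤ n) :
    highProd f i * descProd (extendOne f) i = descProd (extendOne f) n := by
  induction h using Nat.decreasingInduction with
  | self => rw [highProd_self, one_mul]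
  | of_succ i hi ih =>
    rw [highProd_succ f hi, mul_assoc, ← ih, descProd, extendOne, dif_pos hi]

/-- The element `u_{i-1}⁻¹ ⋯ u_0⁻¹ w u_{n-1} ⋯ u_i`. -/
def yGroup {G : Type*} [Group G] (u : Fin n → G) (w : G) (i : ℕ) : G :=
  lowProd (fun l => (u l)⁻¹) i * w * highProd u i

/-- Passing from $i$ to $i+1$ removes $u_i$ on the right and adds $u_i^{-1}$ on the left, which is
the recursion of `yElt`. -/
theorem yGroup_eq_yElt {G : Type*} [Group G] (u : Fin n → G) (w : G) {i : ℕ} (h : i ≤ n) :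
    yGroup u w i = yElt (extendOne u) w n i := by
  induction i with
  | zero =>
    have := highProd_mul_descProd u (Nat.zero_le n)
    simp only [descProd, mul_one] at this
    rw [yGroup, lowProd_zero, one_mul, yElt, this]
  | succ i ih =>
    rw [yElt, ← ih (by omega), yGroup, yGroup, lowProd_succ _ h, highProd_succ u h, extendOne,
      dif_pos (show i < n from h)]
    group

theorem inv_yGroup {G : Type*} [Group G] (u : Fin n → G) (w : G) (i : ℕ) :
    (yGroup u w i)⁻¹ =
      (((List.finRange n).filter fun l => i ≤ l.val).map fun l => (u l)⁻¹).prod * w⁻¹ *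
        (((List.finRange n).filter fun l => l.val < i).map u).prod := by
  simp [yGroup, lowProd, highProd, List.prod_inv_reverse, mul_assoc, Function.comp_def]

end YUnit

/-! ### The Cherednik operators are invertible and commute. -/

section CherednikOperators

variable {r : ℕ} {R : Type} [Field R] {m : ℕ} {k c : R} {p : ℤ → R}

/-- `T_i` as a unit. -/
noncomputable def heckeUnit (hp : IsHeckeParam m k p) (i : Fin (r - 1)) :
    (Module.End R (Laurent r R))ˣ :=
  ⟨heckeT m k p i, heckeTInv m k p i, heckeT_mul_heckeTInv hp i, heckeTInv_mul_heckeT hp i⟩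

variable [NeZero r]

/-- `ω` as a unit. -/
noncomputable def omegaUnit (hc : c ≠ 0) : (Module.End R (Laurent r R))ˣ :=
  ⟨omegaOp c, omegaInvOp c, omegaOp_mul_omegaInvOp hc, omegaInvOp_mul_omegaOp hc⟩

theorem isAffineBraid_heckeUnit (hp : IsHeckeParam m k p) (hc : c ≠ 0) :
    IsAffineBraid (extendOne (heckeUnit (r := r) hp)) (omegaUnit hc) (r - 1) where
  braid i hi := by
    rw [extendOne, extendOne, dif_pos hi, dif_pos (by omega)]
    exact Units.ext (heckeT_braid hp _ _ rfl)
  comm i j hij hj := by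
    rw [extendOne, extendOne, dif_pos hj, dif_pos (by omega)]
    exact Units.ext (heckeT_commute hp _ _ hij)
  shift i hi := by
    rw [extendOne, extendOne, dif_pos hi, dif_pos (by omega)]
    exact Units.ext (omegaOp_mul_heckeT _ _ rfl)
  shift_last n hn := by
    rw [extendOne, extendOne, dif_pos (by omega), dif_pos (by omega)]
    exact Units.ext (omegaOp_sq_mul_heckeT hc _ _ (by simp only; omega) rfl)

/-- The operator `T_{i-1}⁻¹ ⋯ T_1⁻¹ ω T_{r-1} ⋯ T_i` built from `heckeT`. -/
noncomputable def heckeY (m : ℕ) (k c : R) (p : ℤ → R) (i : Fin r) :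
    Module.End R (Laurent r R) :=
  yOp (heckeT m k p) (heckeTInv m k p) (omegaOp c) i

theorem heckeY_eq (m : ℕ) (k c : R) (p : ℤ → R) (i : Fin r) :
    heckeY m k c p i =
      lowProd (heckeTInv m k p) i * omegaOp c * highProd (heckeT m k p) i := rfl

/-- `Y_i` as a unit. -/
noncomputable def heckeYUnit (hp : IsHeckeParam m k p) (hc : c ≠ 0) (i : Fin r) :
    (Module.End R (Laurent r R))ˣ :=
  yGroup (heckeUnit hp) (omegaUnit hc) i

theorem coe_heckeYUnit (hp : IsHeckeParam m k p) (hc : c ≠ 0) (i : Fin r) :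
    (heckeYUnit hp hc i : Module.End R (Laurent r R)) = heckeY m k c p i := by
  simp only [heckeYUnit, yGroup, heckeY_eq, lowProd, highProd, ← Units.coeHom_apply, map_mul,
    map_list_prod, List.map_map]
  rfl

theorem coe_inv_heckeYUnit (hp : IsHeckeParam m k p) (hc : c ≠ 0) (i : Fin r) :
    ((heckeYUnit hp hc i)⁻¹ : (Module.End R (Laurent r R))ˣ) =
      yInvOp (heckeT m k p) (heckeTInv m k p) (omegaInvOp c) i := by
  rw [heckeYUnit, inv_yGroup]
  simp only [yInvOp, ← Units.coeHom_apply, map_mul, map_list_prod, List.map_map]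
  rfl

theorem commute_heckeY (hp : IsHeckeParam m k p) (hc : c ≠ 0) (i j : Fin r) :
    Commute (heckeY m k c p i) (heckeY m k c p j) := by
  have h : Commute (heckeYUnit hp hc i) (heckeYUnit hp hc j) := by
    rw [heckeYUnit, heckeYUnit, yGroup_eq_yElt _ _ (by have := i.2; omega),
      yGroup_eq_yElt _ _ (by have := j.2; omega)]
    exact (isAffineBraid_heckeUnit hp hc).commute_yElt (by have := i.2; omega)
      (by have := j.2; omega)
  rw [← coe_heckeYUnit hp hc, ← coe_heckeYUnit hp hc]
  exact congrArg Units.val h.eq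

theorem yInvOp_apply_of_heckeY_apply (hp : IsHeckeParam m k p) (hc : c ≠ 0) (i : Fin r) {d : R}
    (hd : d ≠ 0) {E : Laurent r R} (h : heckeY m k c p i E = d • E) :
    yInvOp (heckeT m k p) (heckeTInv m k p) (omegaInvOp c) i E = d⁻¹ • E := by
  have h2 := LinearMap.congr_fun (heckeYUnit hp hc i).inv_mul E
  rw [Module.End.mul_apply, coe_heckeYUnit, coe_inv_heckeYUnit, h, map_smul,
    Module.End.one_apply] at h2
  rw [eq_inv_smul_iff₀ hd, h2]

end CherednikOperators

/-! ### Operators with a leading term, the order changing between source and target. -/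

section Triangular

variable {r : ℕ} {R : Type} [Field R]

/-- The span of the monomials `x^ν` with `v ν < a`. -/
noncomputable def lowerSpan (R : Type) [Field R] {V : Type*} [Preorder V]
    (v : (Fin r → ℤ) → V) (a : V) :
    Submodule R (Laurent r R) :=
  Submodule.span R (mono '' {ν | v ν < a})

theorem mono_mem_lowerSpan {V : Type*} [Preorder V] {v : (Fin r → ℤ) → V} {a : V} {ν : Fin r → ℤ}
    (h : v ν < a) : (mono ν : Laurent r R) ∈ lowerSpan R v a :=
  Submodule.subset_span ⟨ν, h, rfl⟩

theorem lowerSpan_mono {V : Type*} [Preorder V] {v : (Fin r → ℤ) → V} {a b : V} (h : a ≤ b) :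
    lowerSpan R v a ≤ lowerSpan R v b :=
  Submodule.span_mono (Set.image_mono fun _ hν => lt_of_lt_of_le hν h)

theorem mono_coeff (ν ξ : Fin r → ℤ) :
    (mono ν : Laurent r R).coeff ξ = if ν = ξ then 1 else 0 := by
  rw [mono, AddMonoidAlgebra.coeff_single, Finsupp.single_apply]

theorem coeff_eq_zero_of_mem_lowerSpan {V : Type*} [Preorder V] {v : (Fin r → ℤ) → V} {a : V}
    {f : Laurent r R} (hf : f ∈ lowerSpan R v a) {ν : Fin r → ℤ} (h : ¬ v ν < a) :
    f.coeff ν = 0 := by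
  induction hf using Submodule.span_induction with
  | mem x hx =>
    obtain ⟨ξ, hξ, rfl⟩ := hx
    rw [mono_coeff, if_neg]
    rintro rfl
    exact h hξ
  | zero => rfl
  | add x y _ _ hx hy => rw [AddMonoidAlgebra.coeff_add, Finsupp.add_apply, hx, hy, add_zero]
  | smul c x _ hx => rw [AddMonoidAlgebra.coeff_smul, Finsupp.smul_apply, hx, smul_zero]

theorem sum_coeff_smul_mono (f : Laurent r R) : f = f.coeff.sum fun ν c => c • mono ν := by
  conv_lhs => rw [← AddMonoidAlgebra.sum_coeff_single f]
  refine Finsupp.sum_congr fun ν _ => ?_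
  simp [mono]

/-- `A x^ν` is `d x^{ν'}` plus a combination of monomials `x^ξ` with `v' ξ < v ν = v' ν'`. -/
structure IsLeading {V : Type*} [Preorder V] (v v' : (Fin r → ℤ) → V)
    (A : Module.End R (Laurent r R)) (ν ν' : Fin r → ℤ) (d : R) : Prop where
  value_eq : v' ν' = v ν
  sub_mem : A (mono ν) - d • mono ν' ∈ lowerSpan R v' (v ν)

/-- `A` has a leading part on every monomial; in particular it does not increase values. -/
def IsFiltered {V : Type*} [Preorder V] (v v' : (Fin r → ℤ) → V)
    (A : Module.End R (Laurent r R)) : Prop :=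
  ∀ ν, ∃ ν' d, IsLeading v v' A ν ν' d

variable {V : Type*} [Preorder V] {v v' v'' : (Fin r → ℤ) → V}

theorem IsFiltered.apply_mem {A : Module.End R (Laurent r R)} (hA : IsFiltered v v' A) {a : V}
    {f : Laurent r R} (hf : f ∈ lowerSpan R v a) : A f ∈ lowerSpan R v' a := by
  induction hf using Submodule.span_induction with
  | mem x hx =>
    obtain ⟨ν, hν, rfl⟩ := hx
    obtain ⟨ν', d, h1, h2⟩ := hA ν
    rw [← sub_add_cancel (A (mono ν)) (d • mono ν')]
    refine add_mem (lowerSpan_mono (le_of_lt hν) h2) (Submodule.smul_mem _ _ ?_)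
    exact mono_mem_lowerSpan (by rw [h1]; exact hν)
  | zero => rw [map_zero]; exact zero_mem _
  | add x y _ _ hx hy => rw [map_add]; exact add_mem hx hy
  | smul c x _ hx => rw [map_smul]; exact Submodule.smul_mem _ _ hx

/-- The factors of $Y_i$ are triangular only between different orders. So source and target carry
separate value functions, and leading coefficients multiply along a chain of them. -/
theorem IsLeading.mul {A B : Module.End R (Laurent r R)} {ν ν' ν'' : Fin r → ℤ} {d d' : R}
    (hB : IsLeading v' v'' B ν' ν'' d') (hA : IsLeading v v' A ν ν' d)
    (hB' : IsFiltered v' v'' B) : IsLeading v v'' (B * A) ν ν'' (d' * d) where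
  value_eq := hB.value_eq.trans hA.value_eq
  sub_mem := by
    have h1 := hB'.apply_mem hA.sub_mem
    have h2 := Submodule.smul_mem _ d hB.sub_mem
    rw [hA.value_eq] at h2
    have h3 := add_mem h1 h2
    rw [map_sub, map_smul, smul_sub, smul_smul, sub_add_sub_cancel, mul_comm d] at h3
    exact h3

theorem IsFiltered.mul {A B : Module.End R (Laurent r R)} (hB : IsFiltered v' v'' B)
    (hA : IsFiltered v v' A) : IsFiltered v v'' (B * A) := fun ν => by
  obtain ⟨ν', d, h⟩ := hA ν
  obtain ⟨ν'', d', h'⟩ := hB ν'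
  exact ⟨ν'', _, h'.mul h hB⟩

theorem IsLeading.one (ν : Fin r → ℤ) : IsLeading v v (1 : Module.End R (Laurent r R)) ν ν 1 where
  value_eq := rfl
  sub_mem := by simp

theorem IsFiltered.one : IsFiltered v v (1 : Module.End R (Laurent r R)) := fun ν =>
  ⟨ν, 1, IsLeading.one ν⟩

end Triangular

/-! ### Leading terms of $T_i^{\pm1}$ and $\omega$. -/

section Values

variable {r : ℕ} {R : Type} [Field R] {m : ℕ} {k c : R} {p : ℤ → R}

theorem IsHeckeParam.eq_of_dvd (hp : IsHeckeParam m k p) {s : ℤ} (h : (m : ℤ) ∣ s) : p s = k := by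
  obtain ⟨z, rfl⟩ := h
  have hN : ∀ (N : ℕ) (s : ℤ), p (s + m * N) = p s := fun N => by
    induction N with
    | zero => simp
    | succ N ih =>
      intro s
      rw [← ih s, ← hp.add_period (s + m * N)]
      push_cast
      ring_nf
  obtain ⟨N, rfl | rfl⟩ := z.eq_nat_or_neg
  · rw [← hp.zero, ← hN N 0, zero_add]
  · rw [← hp.zero, ← hN N (m * -(N : ℤ))]
    ring_nf

/-- `σ(s) = k⁻¹` if `s` is a positive multiple of `m`, and `p(s)` otherwise. -/
noncomputable def heckeSigma (m : ℕ) (k : R) (p : ℤ → R) (s : ℤ) : R :=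
  if 0 < s ∧ (m : ℤ) ∣ s then k⁻¹ else p s

/-- For multiples of $m$ the values at $s$ and $-s$ are $k$ and $k^{-1}$ in some order; otherwise
$p(s)p(-s)=1$. It fails at $s=0$ in general, where $\sigma(0)=k$. -/
theorem heckeSigma_neg_inv (hp : IsHeckeParam m k p) {s : ℤ} (hs : s ≠ 0) :
    (heckeSigma m k p (-s))⁻¹ = heckeSigma m k p s := by
  by_cases hd : (m : ℤ) ∣ s
  · rcases lt_or_gt_of_ne hs with h | h
    · simp [heckeSigma, hd, h, h.not_gt, hp.eq_of_dvd hd]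
    · simp [heckeSigma, hd, h, h.not_gt, hp.eq_of_dvd (hd.neg_right)]
  · simp only [heckeSigma, hd, and_false, if_false, Int.dvd_neg]
    exact inv_eq_of_mul_eq_one_left (hp.mul_neg s hd)

theorem heckeSigma_ne_zero (hp : IsHeckeParam m k p) (s : ℤ) : heckeSigma m k p s ≠ 0 := by
  unfold heckeSigma
  by_cases hd : (m : ℤ) ∣ s
  · rw [hp.eq_of_dvd hd]
    split_ifs
    · exact inv_ne_zero hp.ne_zero
    · exact hp.ne_zero
  · rw [if_neg (fun h => hd h.2)]
    exact left_ne_zero_of_mul_eq_one (hp.mul_neg s hd)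

/-- Exponents are ordered by their square length and then by a weight function `b`. -/
def value (b ν : Fin r → ℤ) : ℤ ×ₗ ℤ := toLex (∑ l, ν l ^ 2, -∑ l, b l * ν l)

theorem sum_simpleRoot_mul (i : Fin (r - 1)) (ν : Fin r → ℤ) :
    ∑ l, simpleRoot i l * ν l = pairing ν i := by
  simp [simpleRoot, pairing, sub_mul, Finset.sum_sub_distrib, Pi.single_apply, ite_mul]

theorem sum_sq_add_smul_simpleRoot (i : Fin (r - 1)) (ν : Fin r → ℤ) (z : ℤ) :
    ∑ l, (z • simpleRoot i + ν) l ^ 2 = ∑ l, ν l ^ 2 + 2 * z * (pairing ν i + z) := by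
  have h1 := sum_simpleRoot_mul i ν
  have h2 := sum_simpleRoot_mul i (simpleRoot i)
  rw [pairing_simpleRoot] at h2
  have : ∀ l, (z • simpleRoot i + ν) l ^ 2 =
      ν l ^ 2 + (2 * z * (simpleRoot i l * ν l) + z ^ 2 * (simpleRoot i l * simpleRoot i l)) :=
    fun l => by simp; ring
  simp only [this, Finset.sum_add_distrib, ← Finset.mul_sum, h1, h2]
  ring

/-- The square length changes by $2z((\nu,\alpha_i^\vee)+z)$, so exponents strictly between $\nu$
and $s_i\nu$ are shorter, whatever the weights. -/
theorem value_add_smul_lt (b b' : Fin r → ℤ) (i : Fin (r - 1)) (ν : Fin r → ℤ) (z : ℤ)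
    (h : z * (pairing ν i + z) < 0) : value b' (z • simpleRoot i + ν) < value b ν := by
  rw [value, value, Prod.Lex.toLex_lt_toLex]
  left
  simp only
  rw [sum_sq_add_smul_simpleRoot]
  linarith

theorem value_reflect (b : Fin r → ℤ) (i : Fin (r - 1)) (ν : Fin r → ℤ) :
    value (reflect i b) (reflect i ν) = value b ν := by
  unfold value reflect
  congr 2
  · exact Equiv.sum_comp (Equiv.swap (left i) (right i)) fun l => ν l ^ 2
  · exact congrArg Neg.neg
      (Equiv.sum_comp (Equiv.swap (left i) (right i)) fun l => b l * ν l)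

theorem value_rotate (b ν : Fin r → ℤ) : value (rotate b) (rotate ν) = value b ν := by
  unfold value rotate
  congr 2
  · exact Equiv.sum_comp (finRotate r).symm fun l => ν l ^ 2
  · exact congrArg Neg.neg (Equiv.sum_comp (finRotate r).symm fun l => b l * ν l)

theorem value_reflect_lt (b : Fin r → ℤ) (i : Fin (r - 1)) (ν : Fin r → ℤ)
    (h : pairing b i * pairing ν i < 0) : value (reflect i b) ν < value b ν := by
  rw [value, value, Prod.Lex.toLex_lt_toLex]
  right
  refine ⟨rfl, ?_⟩
  simp only [reflect_eq_sub, Pi.sub_apply, Pi.smul_apply, smul_eq_mul, sub_mul,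
    Finset.sum_sub_distrib, mul_assoc, ← Finset.mul_sum, sum_simpleRoot_mul]
  linarith

/-- The geometric sum runs along the root string from $\nu$ towards $s_i\nu$ in steps of $m$, and
its inner terms are shorter. It contains $x^\nu$ exactly for negative pairing. It reaches
$x^{s_i\nu}$ exactly when the pairing is a positive multiple of $m$, and then changes the
coefficient $k$ to $k-(k-k^{-1})=k^{-1}$; this is the origin of $\sigma$. -/
theorem heckeT_mono_sub_mem (hp : IsHeckeParam m k p) (b b' : Fin r → ℤ) (i : Fin (r - 1))
    (ν : Fin r → ℤ) :
    heckeT m k p i (mono ν) - (if pairing ν i < 0 then k - k⁻¹ else 0) • mono ν -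
        heckeSigma m k p (pairing ν i) • mono (reflect i ν) ∈
      lowerSpan R (value b') (value b ν) := by
  have hm : (0 : ℤ) < m := by exact_mod_cast hp.pos
  have hdiv := Int.emod_add_mul_ediv (pairing ν i) m
  have hmod := Int.emod_nonneg (pairing ν i) hm.ne'
  have hmod' := Int.emod_lt_of_pos (pairing ν i) hm
  have hmem : ∀ z : ℤ, z * (pairing ν i + z) < 0 →
      (mono (z • simpleRoot i + ν) : Laurent r R) ∈ lowerSpan R (value b') (value b ν) :=
    fun z hz => mono_mem_lowerSpan (value_add_smul_lt b b' i ν z hz)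
  have hrefl : reflect i ν = (-pairing ν i) • simpleRoot i + ν := by
    rw [reflect_eq_sub]; module
  rw [heckeT_mono]
  generalize pairing ν i / (m : ℤ) = e at *
  generalize hr : pairing ν i % (m : ℤ) = a at *
  rcases lt_trichotomy (pairing ν i) 0 with h | h | h
  · have he : e < 0 := by
      by_contra hc
      nlinarith
    -- The sum has $N+1$ terms, and its term of index $0$ is $x^\nu$, which is split off.
    obtain ⟨N, hN⟩ : ∃ N : ℕ, e = -(N + 1 : ℕ) := ⟨(-e - 1).toNat, by omega⟩
    rw [if_pos h, heckeSigma, if_neg (fun hc => by omega), hN, geomQuot]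
    simp only [Int.neg_neg, Int.toNat_natCast, show (-((N + 1 : ℕ) : ℤ)).toNat = 0 by omega,
      Finset.range_zero, Finset.sum_empty, sub_zero, Finset.sum_range_succ', add_mul,
      Finset.sum_mul, mono_mul_mono, smul_add, Nat.cast_zero, zero_smul, zero_add]
    rw [add_sub_right_comm, add_sub_cancel_right, add_sub_cancel_right]
    refine Submodule.smul_mem _ _ (Submodule.sum_mem _ fun j hj => ?_)
    rw [Finset.mem_range] at hj
    rw [smul_smul]
    refine hmem _ ?_
    have h1 : (0 : ℤ) < ((j + 1 : ℕ) : ℤ) * m := by positivity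
    have h2 : ((j + 1 : ℕ) : ℤ) ≤ N := by exact_mod_cast hj
    refine mul_neg_of_pos_of_neg h1 ?_
    push_cast at *
    nlinarith
  · have he : e = 0 := by
      rcases lt_trichotomy e 0 with hc | hc | hc
      · nlinarith
      · exact hc
      · nlinarith
    rw [if_neg (by omega), heckeSigma, if_neg (fun hc => by omega), he, geomQuot_zero]
    simp
  · have he : 0 ≤ e := by
      by_contra hc
      nlinarith
    obtain ⟨N, hN⟩ : ∃ N : ℕ, e = N := ⟨e.toNat, by omega⟩
    rw [if_neg (by omega), zero_smul, sub_zero, hN, geomQuot]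
    simp only [Int.toNat_natCast, show (-(N : ℤ)).toNat = 0 by omega,
      Finset.range_zero, Finset.sum_empty, zero_sub, neg_mul, smul_neg,
      Finset.sum_mul, mono_mul_mono, smul_smul]
    have hlow : ∀ j : ℕ, ((j : ℤ) + 1) * m < pairing ν i →
        (mono (-(((j : ℤ) + 1) * m) • simpleRoot i + ν) : Laurent r R) ∈
          lowerSpan R (value b') (value b ν) := fun j hj => by
      refine hmem _ ?_
      have h1 : (0 : ℤ) < ((j : ℤ) + 1) * m := by positivity
      exact mul_neg_of_neg_of_pos (by linarith) (by linarith)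
    by_cases hd : (m : ℤ) ∣ pairing ν i
    · have ha : a = 0 := by rw [← hr]; exact Int.emod_eq_zero_of_dvd hd
      obtain ⟨N, rfl⟩ : ∃ N', N = N' + 1 := ⟨N - 1, by
        have : N ≠ 0 := by rintro rfl; simp at hN; subst hN; subst ha; omega
        omega⟩
      have hN' : -(((N : ℤ) + 1) * m) = -pairing ν i := by
        rw [← hdiv, ha, hN]; push_cast; ring
      rw [heckeSigma, if_pos ⟨h, hd⟩, hp.eq_of_dvd hd, Finset.sum_range_succ, hN', ← hrefl]
      rw [show ∀ x y : Laurent r R, -((k - k⁻¹) • (x + y)) + k • y - k⁻¹ • y =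
        -((k - k⁻¹) • x) from fun x y => by module]
      refine neg_mem (Submodule.smul_mem _ _ (Submodule.sum_mem _ fun j hj => hlow j ?_))
      rw [Finset.mem_range] at hj
      have : ((j : ℤ) + 1) ≤ N := by exact_mod_cast hj
      nlinarith
    · have ha : a ≠ 0 := fun ha => hd (Int.dvd_of_emod_eq_zero (hr.trans ha))
      rw [heckeSigma, if_neg (fun hc => hd hc.2), add_sub_cancel_right]
      refine neg_mem (Submodule.smul_mem _ _ (Submodule.sum_mem _ fun j hj => hlow j ?_))
      rw [Finset.mem_range] at hj
      have : ((j : ℤ) + 1) ≤ N := by exact_mod_cast hj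
      have : 0 < a := by omega
      nlinarith

/-- The unwanted term $x^\nu$ occurs only for negative pairing. When $b$ pairs positively with
$\alpha_i$, replacing $b$ by $s_ib$ strictly lowers the value of such a $\nu$. -/
theorem isLeading_heckeT (hp : IsHeckeParam m k p) (b : Fin r → ℤ) (i : Fin (r - 1))
    (hb : 0 < pairing b i) (ν : Fin r → ℤ) :
    IsLeading (value b) (value (reflect i b)) (heckeT m k p i) ν (reflect i ν)
      (heckeSigma m k p (pairing ν i)) where
  value_eq := value_reflect b i ν
  sub_mem := by
    have h := heckeT_mono_sub_mem hp b (reflect i b) i ν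
    split_ifs at h with h0
    · have h1 : (mono ν : Laurent r R) ∈ lowerSpan R (value (reflect i b)) (value b ν) :=
        mono_mem_lowerSpan (value_reflect_lt b i ν (mul_neg_of_pos_of_neg hb h0))
      have h2 := add_mem h (Submodule.smul_mem _ (k - k⁻¹) h1)
      rwa [sub_right_comm, sub_add_cancel] at h2
    · rwa [zero_smul, sub_zero] at h

/-- Subtracting $k-k^{-1}$ moves the unwanted term $x^\nu$ to positive pairing, so the sign
condition on $b$ is reversed. At pairing $0$ the coefficient is $k-(k-k^{-1})=\sigma(0)^{-1}$. -/
theorem isLeading_heckeTInv (hp : IsHeckeParam m k p) (b : Fin r → ℤ) (i : Fin (r - 1))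
    (hb : pairing b i < 0) (ν : Fin r → ℤ) :
    IsLeading (value b) (value (reflect i b)) (heckeTInv m k p i) ν (reflect i ν)
      (heckeSigma m k p (-pairing ν i))⁻¹ where
  value_eq := value_reflect b i ν
  sub_mem := by
    have h := heckeT_mono_sub_mem hp b (reflect i b) i ν
    rw [heckeTInv, LinearMap.sub_apply, LinearMap.smul_apply, Module.End.one_apply]
    rcases lt_trichotomy (pairing ν i) 0 with h0 | h0 | h0
    · rw [if_pos h0] at h
      rwa [heckeSigma_neg_inv hp h0.ne]
    · rw [h0, if_neg (lt_irrefl _)] at h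
      rw [reflect_eq_self i ν h0, heckeSigma, if_neg (by simp), hp.zero] at h
      rw [reflect_eq_self i ν h0, h0, heckeSigma, if_neg (by simp), neg_zero, hp.zero]
      convert h using 1
      module
    · rw [if_neg h0.not_gt, zero_smul, sub_zero] at h
      rw [heckeSigma_neg_inv hp h0.ne']
      have h1 : (mono ν : Laurent r R) ∈ lowerSpan R (value (reflect i b)) (value b ν) :=
        mono_mem_lowerSpan (value_reflect_lt b i ν (mul_neg_of_neg_of_pos hb h0))
      have h2 := sub_mem h (Submodule.smul_mem _ (k - k⁻¹) h1)
      rwa [sub_right_comm] at h2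

theorem isLeading_omegaOp [NeZero r] (b ν : Fin r → ℤ) :
    IsLeading (value b) (value (rotate b)) (omegaOp c : Module.End R (Laurent r R)) ν (rotate ν)
      (c ^ (-lastCoord ν)) where
  value_eq := value_rotate b ν
  sub_mem := by rw [omegaOp_mono, sub_self]; exact zero_mem _

end Values

/-! ### Moving one entry of a tuple. -/

section MoveEntry

variable {r : ℕ}

/-- The extension of a tuple by zeros. -/
def extendZero (μ : Fin r → ℤ) (l : ℕ) : ℤ := if h : l < r then μ ⟨l, h⟩ else 0

/-- The tuple obtained from `μ` by moving the entry in position `i` to position `j`. -/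
def moveEntry (i j : ℕ) (μ : Fin r → ℤ) : Fin r → ℤ := fun l =>
  if l.val = j then extendZero μ i
  else if (if l.val < j then l.val else l.val - 1) < i then
    extendZero μ (if l.val < j then l.val else l.val - 1)
  else extendZero μ ((if l.val < j then l.val else l.val - 1) + 1)

theorem extendZero_val (μ : Fin r → ℤ) (l : Fin r) : extendZero μ l = μ l := by
  simp [extendZero]

theorem moveEntry_self (i : ℕ) (μ : Fin r → ℤ) : moveEntry i i μ = μ := by
  funext l
  rw [← extendZero_val μ l, moveEntry]
  split_ifs <;> congr 1 <;> omega

theorem moveEntry_left (i : ℕ) (j : Fin (r - 1)) (μ : Fin r → ℤ) :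
    moveEntry i j μ (left j) = extendZero μ i := by
  simp [moveEntry, left]

theorem moveEntry_right (i : ℕ) (j : Fin (r - 1)) (μ : Fin r → ℤ) :
    moveEntry i j μ (right j) = if (j : ℕ) < i then extendZero μ j else extendZero μ (j + 1) := by
  simp [moveEntry, right]

theorem reflect_moveEntry (i : ℕ) (j : Fin (r - 1)) (μ : Fin r → ℤ) :
    reflect j (moveEntry i j μ) = moveEntry i (j + 1) μ := by
  funext l
  by_cases h1 : l = left j
  · rw [h1, reflect_apply_left, moveEntry_right]
    simp [moveEntry, left]
  by_cases h2 : l = right j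
  · rw [h2, reflect_apply_right, moveEntry_left]
    simp [moveEntry, right]
  rw [reflect_apply_of_ne j _ h1 h2]
  simp only [left, right, Fin.ext_iff] at h1 h2
  have e : (if l.val < j then l.val else l.val - 1) =
    if l.val < j + 1 then l.val else l.val - 1 := by split_ifs <;> omega
  rw [moveEntry, moveEntry, if_neg h1, if_neg h2, e]

theorem lastCoord_moveEntry [NeZero r] (i : ℕ) (μ : Fin r → ℤ) :
    lastCoord (moveEntry i (r - 1) μ) = extendZero μ i := by
  simp [lastCoord, moveEntry]

theorem rotate_moveEntry [NeZero r] (i : ℕ) (μ : Fin r → ℤ) :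
    rotate (moveEntry i (r - 1) μ) = moveEntry i 0 μ := by
  funext l
  obtain ⟨l, hl⟩ := l
  rcases l with _ | l
  · rw [rotate_zero, lastCoord_moveEntry]
    simp [moveEntry]
  · rw [rotate_succ]
    simp only [moveEntry]
    rw [if_neg (show ¬ l = r - 1 by omega), if_pos (show l < r - 1 by omega),
      if_neg (show ¬ l + 1 = 0 by omega), if_neg (show ¬ l + 1 < 0 by omega), Nat.add_sub_cancel]

end MoveEntry

/-! ### Triangularity of the Cherednik operators. -/

section Leading

variable {r : ℕ} {R : Type} [Field R] {m : ℕ} {k c : R} {p : ℤ → R}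

/-- The weights `(0, -1, …, -(r-1))`. -/
def rho (r : ℕ) : Fin r → ℤ := fun l => -(l : ℕ)

theorem extendZero_rho {l : ℕ} (h : l < r) : extendZero (rho r) l = -(l : ℤ) := by
  simp [extendZero, h, rho]

theorem isLeading_highProd (hp : IsHeckeParam m k p) (i : Fin r) {j : ℕ} (hij : i.val ≤ j)
    (hj : j ≤ r - 1) :
    IsFiltered (value (moveEntry i j (rho r))) (value (moveEntry i (r - 1) (rho r)))
      (highProd (heckeT m k p) j) ∧
    ∀ μ, IsLeading (value (moveEntry i j (rho r))) (value (moveEntry i (r - 1) (rho r)))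
      (highProd (heckeT m k p) j) (moveEntry i j μ) (moveEntry i (r - 1) μ)
      (∏ l ∈ Finset.Ico (j + 1) r, heckeSigma m k p (μ i - extendZero μ l)) := by
  induction hj using Nat.decreasingInduction with
  | self =>
    have e : r - 1 + 1 = r := by have := i.2; omega
    rw [highProd_self, e, Finset.Ico_self]
    exact ⟨IsFiltered.one, fun μ => IsLeading.one _⟩
  | of_succ j hj ih =>
    obtain ⟨ih1, ih2⟩ := ih (by omega)
    -- The weight $-i$ moves right past $-(j+1)$ with $j\ge i$, hence past smaller weights: the sign
    -- required for $T_j$. In `isLeading_lowProd` it passes the larger weights $-j$ with $j<i$, as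
    -- required for $T_j^{-1}$.
    have hb : 0 < pairing (moveEntry i j (rho r)) ⟨j, hj⟩ := by
      have h1 := moveEntry_left i ⟨j, hj⟩ (rho r)
      have h2 := moveEntry_right i ⟨j, hj⟩ (rho r)
      simp only [not_lt.2 hij, if_false] at h1 h2
      rw [pairing, h1, h2, extendZero_rho i.2, extendZero_rho (by omega)]
      push_cast
      omega
    have hT := isLeading_heckeT hp _ ⟨j, hj⟩ hb
    rw [reflect_moveEntry i ⟨j, hj⟩] at hT
    have hF : IsFiltered (value (moveEntry i j (rho r))) (value (moveEntry i (j + 1) (rho r)))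
        (heckeT m k p ⟨j, hj⟩) := fun ν => ⟨_, _, hT ν⟩
    rw [highProd_succ _ hj]
    refine ⟨ih1.mul hF, fun μ => ?_⟩
    have h3 := hT (moveEntry i j μ)
    have h1 := moveEntry_left i ⟨j, hj⟩ μ
    have h2 := moveEntry_right i ⟨j, hj⟩ μ
    simp only [not_lt.2 hij, if_false] at h1 h2
    rw [reflect_moveEntry i ⟨j, hj⟩, pairing, h1, h2, extendZero_val] at h3
    have h4 := (ih2 μ).mul h3 ih1
    rwa [mul_comm, ← Finset.prod_eq_prod_Ico_succ_bot (show j + 1 < r by omega)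
      fun l => heckeSigma m k p (μ i - extendZero μ l)] at h4

theorem isLeading_lowProd (hp : IsHeckeParam m k p) (i : Fin r) {j : ℕ} (hij : j ≤ i.val) :
    IsFiltered (value (moveEntry i 0 (rho r))) (value (moveEntry i j (rho r)))
      (lowProd (heckeTInv m k p) j) ∧
    ∀ μ, IsLeading (value (moveEntry i 0 (rho r))) (value (moveEntry i j (rho r)))
      (lowProd (heckeTInv m k p) j) (moveEntry i 0 μ) (moveEntry i j μ)
      (∏ l ∈ Finset.range j, (heckeSigma m k p (extendZero μ l - μ i))⁻¹) := by
  induction j with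
  | zero =>
    rw [lowProd_zero, Finset.range_zero]
    exact ⟨IsFiltered.one, fun μ => IsLeading.one _⟩
  | succ j ih =>
    obtain ⟨ih1, ih2⟩ := ih (by omega)
    have hj : j < r - 1 := by have := i.2; omega
    have hji : j < i.val := hij
    have hb : pairing (moveEntry i j (rho r)) ⟨j, hj⟩ < 0 := by
      have h1 := moveEntry_left i ⟨j, hj⟩ (rho r)
      have h2 := moveEntry_right i ⟨j, hj⟩ (rho r)
      simp only [hji, if_true] at h1 h2
      rw [pairing, h1, h2, extendZero_rho i.2, extendZero_rho (by omega)]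
      omega
    have hT := isLeading_heckeTInv hp _ ⟨j, hj⟩ hb
    rw [reflect_moveEntry i ⟨j, hj⟩] at hT
    have hF : IsFiltered (value (moveEntry i j (rho r))) (value (moveEntry i (j + 1) (rho r)))
        (heckeTInv m k p ⟨j, hj⟩) := fun ν => ⟨_, _, hT ν⟩
    rw [lowProd_succ _ hj]
    refine ⟨hF.mul ih1, fun μ => ?_⟩
    have h3 := hT (moveEntry i j μ)
    have h1 := moveEntry_left i ⟨j, hj⟩ μ
    have h2 := moveEntry_right i ⟨j, hj⟩ μ
    simp only [hji, if_true] at h1 h2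
    rw [reflect_moveEntry i ⟨j, hj⟩, pairing, h1, h2, extendZero_val, neg_sub] at h3
    have h4 := h3.mul (ih2 μ) hF
    rwa [mul_comm, ← Finset.prod_range_succ] at h4

/-- The eigenvalue of `Y_i` on the polynomial of degree `μ`. -/
noncomputable def heckeGamma (m : ℕ) (k c : R) (p : ℤ → R) (μ : Fin r → ℤ) (i : Fin r) : R :=
  c ^ (-μ i) * ((∏ j ∈ Finset.Ioi i, heckeSigma m k p (μ i - μ j)) *
    ∏ j ∈ Finset.Iio i, (heckeSigma m k p (μ j - μ i))⁻¹)

/-- The factors $T$ move the $i$-th entry to the end, $\omega$ brings it to the front, and the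
inverses move it back to its place. Exponent and weights thus return to themselves, and the leading
coefficients collected on the way form the eigenvalue. -/
theorem isLeading_heckeY [NeZero r] (hp : IsHeckeParam m k p) (i : Fin r) (μ : Fin r → ℤ) :
    IsLeading (value (rho r)) (value (rho r)) (heckeY m k c p i) μ μ (heckeGamma m k c p μ i) := by
  obtain ⟨h1, h2⟩ := isLeading_highProd hp i le_rfl (show i.val ≤ r - 1 by have := i.2; omega)
  obtain ⟨h3, h4⟩ := isLeading_lowProd hp i le_rfl
  have h5 := isLeading_omegaOp (R := R) (c := c) (moveEntry i (r - 1) (rho r))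
  rw [rotate_moveEntry] at h5
  have h6 : IsFiltered _ _ _ := fun ν => ⟨_, _, h5 ν⟩
  have h7 := h5 (moveEntry i (r - 1) μ)
  rw [rotate_moveEntry, lastCoord_moveEntry, extendZero_val] at h7
  have h8 := ((h4 μ).mul h7 h3).mul (h2 μ) (h3.mul h6)
  rw [moveEntry_self, moveEntry_self] at h8
  have e1 : ∏ j ∈ Finset.Ioi i, heckeSigma m k p (μ i - μ j) =
      ∏ l ∈ Finset.Ico (i.val + 1) r, heckeSigma m k p (μ i - extendZero μ l) := by
    have : Finset.Ico (i.val + 1) r = (Finset.Ioi i).map Fin.valEmbedding := by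
      rw [Fin.map_valEmbedding_Ioi]
      ext l
      simp
    rw [this, Finset.prod_map]
    simp [extendZero_val]
  have e2 : ∏ j ∈ Finset.Iio i, (heckeSigma m k p (μ j - μ i))⁻¹ =
      ∏ l ∈ Finset.range i.val, (heckeSigma m k p (extendZero μ l - μ i))⁻¹ := by
    have : Finset.range i.val = (Finset.Iio i).map Fin.valEmbedding := by
      rw [Fin.map_valEmbedding_Iio]
      ext l
      simp
    rw [this, Finset.prod_map]
    simp [extendZero_val]
  have e3 : heckeGamma m k c p μ i =
      (∏ l ∈ Finset.range i.val, (heckeSigma m k p (extendZero μ l - μ i))⁻¹) * c ^ (-μ i) *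
        ∏ l ∈ Finset.Ico (i.val + 1) r, heckeSigma m k p (μ i - extendZero μ l) := by
    rw [heckeGamma, e1, e2]
    ring
  rw [heckeY_eq, e3]
  exact h8

theorem heckeGamma_ne_zero (hp : IsHeckeParam m k p) (hc : c ≠ 0) (μ : Fin r → ℤ) (i : Fin r) :
    heckeGamma m k c p μ i ≠ 0 :=
  mul_ne_zero (zpow_ne_zero _ hc) (mul_ne_zero
    (Finset.prod_ne_zero_iff.2 fun _ _ => heckeSigma_ne_zero hp _)
    (Finset.prod_ne_zero_iff.2 fun _ _ => inv_ne_zero (heckeSigma_ne_zero hp _)))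

end Leading

/-! ### Existence and uniqueness of joint eigenfunctions. -/

section Eigenfunctions

variable {r : ℕ} {R : Type} [Field R] {m : ℕ} {k c : R} {p : ℤ → R}

/-- `c` is not a root of unity, and some endomorphism squares `c` and fixes the other parameters. -/
structure IsGenericParam (k c : R) (p : ℤ → R) : Prop where
  ne_zero : c ≠ 0
  zpow_eq_one : ∀ a : ℤ, c ^ a = 1 → a = 0
  exists_hom : ∃ φ : R →+* R, φ c = c ^ 2 ∧ φ k = k ∧ ∀ s, φ (p s) = p s

theorem map_heckeSigma {φ : R →+* R} (hk : φ k = k) (hφ : ∀ s, φ (p s) = p s) (s : ℤ) :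
    φ (heckeSigma m k p s) = heckeSigma m k p s := by
  unfold heckeSigma
  split_ifs
  · rw [map_inv₀, hk]
  · exact hφ s

/-- Each eigenvalue is $c^{-\mu_i}u$ with $u\neq0$ fixed by $\varphi$. Applying $\varphi$ to
$c^{-\mu_i}u=c^{-\nu_i}u'$ doubles the exponents; dividing by the original equation leaves
$c^{-\mu_i}=c^{-\nu_i}$, and $c$ is not a root of unity. -/
theorem heckeGamma_injective (hp : IsHeckeParam m k p) (hc : IsGenericParam k c p) {μ ν : Fin r → ℤ}
    (h : ∀ i, heckeGamma m k c p μ i = heckeGamma m k c p ν i) : μ = ν := by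
  obtain ⟨φ, h1, h2, h3⟩ := hc.exists_hom
  funext i
  have hu : ∀ ξ : Fin r → ℤ, ∃ u, u ≠ 0 ∧ φ u = u ∧ heckeGamma m k c p ξ i = c ^ (-ξ i) * u :=
    fun ξ => ⟨_, mul_ne_zero (Finset.prod_ne_zero_iff.2 fun _ _ => heckeSigma_ne_zero hp _)
      (Finset.prod_ne_zero_iff.2 fun _ _ => inv_ne_zero (heckeSigma_ne_zero hp _)),
      by simp only [map_mul, map_prod, map_inv₀, map_heckeSigma h2 h3], rfl⟩
  obtain ⟨u, hu0, hu1, hu2⟩ := hu μ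
  obtain ⟨u', hu0', hu1', hu2'⟩ := hu ν
  have e1 := h i
  rw [hu2, hu2'] at e1
  have e2 := congrArg φ e1
  rw [map_mul, map_mul, map_zpow₀, map_zpow₀, hu1, hu1', h1, pow_two, mul_zpow, mul_zpow, mul_assoc,
    e1, mul_assoc] at e2
  have e3 := mul_right_cancel₀ (mul_ne_zero (zpow_ne_zero _ hc.ne_zero) hu0') e2
  have e4 : c ^ (-μ i - -ν i) = 1 := by
    rw [zpow_sub₀ hc.ne_zero, e3, div_self (zpow_ne_zero _ hc.ne_zero)]
  have := hc.zpow_eq_one _ e4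
  omega

theorem finite_value_lt (b : Fin r → ℤ) (a : ℤ ×ₗ ℤ) : {ν | value b ν < a}.Finite := by
  obtain ⟨N, hN⟩ : ∃ N : ℤ, (ofLex a).1 ≤ N := ⟨_, le_rfl⟩
  refine (Set.Finite.pi' (ι := Fin r) (κ := fun _ => ℤ) (t := fun _ => Set.Icc (-N) N)
    fun _ => Set.finite_Icc _ _).subset fun ν hν l => ?_
  have h1 : ∑ l, ν l ^ 2 ≤ (ofLex a).1 := by
    have := Prod.Lex.lt_iff.1 (show value b ν < a from hν)
    rcases this with h | h
    · exact h.le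
    · exact h.1.le
  have h2 : ν l ^ 2 ≤ ∑ l, ν l ^ 2 :=
    Finset.single_le_sum (f := fun l => ν l ^ 2) (fun _ _ => sq_nonneg _) (Finset.mem_univ l)
  have h3 : ν l ≤ ν l ^ 2 := Int.le_self_sq _
  have h4 : -ν l ≤ (-ν l) ^ 2 := Int.le_self_sq _
  rw [neg_sq] at h4
  rw [Set.mem_Icc]
  constructor <;> linarith

variable [NeZero r]

/-- `E` is a joint eigenfunction of the `Y_i` with the eigenvalues attached to `μ`, normalised at
`x^μ`. -/
def IsHeckeEigen (m : ℕ) (k c : R) (p : ℤ → R) (μ : Fin r → ℤ) (E : Laurent r R) : Prop :=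
  (∀ i, heckeY m k c p i E = heckeGamma m k c p μ i • E) ∧ E.coeff μ = 1

/-- A polynomial $P$ in the $Y_i$ is built that kills every monomial below $x^\mu$ and keeps the
coefficient of $x^\mu$. As $Y_ix^\mu-\gamma x^\mu$ lies below $x^\mu$ and $P$ commutes with $Y_i$,
the vector $Px^\mu$ is an eigenfunction. -/
theorem exists_isHeckeEigen (hp : IsHeckeParam m k p) (hc : IsGenericParam k c p)
    (μ : Fin r → ℤ) : ∃ E, IsHeckeEigen m k c p μ E := by
  classical
  set v := value (rho r) with hv
  set Y := heckeY (r := r) m k c p with hY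
  have hlead : ∀ i ν, IsLeading v v (Y i) ν ν (heckeGamma m k c p ν i) := fun i ν =>
    isLeading_heckeY hp i ν
  have hfilt : ∀ i, IsFiltered v v (Y i) := fun i ν => ⟨_, _, hlead i ν⟩
  have hsep : ∀ ν, v ν < v μ → ∃ i, heckeGamma m k c p ν i ≠ heckeGamma m k c p μ i := fun ν h => by
    by_contra! hne
    rw [heckeGamma_injective hp hc hne] at h
    exact lt_irrefl _ h
  have key : ∀ S : Finset (Fin r → ℤ), (∀ ν ∈ S, v ν < v μ) →
      (∀ ν ∈ S, ∀ ξ, v ξ < v ν → ξ ∈ S) →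
      ∃ P : Module.End R (Laurent r R), (∀ i, Commute P (Y i)) ∧ (∀ ν ∈ S, P (mono ν) = 0) ∧
        P (mono μ) - mono μ ∈ lowerSpan R v (v μ) := by
    intro S
    induction S using Finset.induction_on_max_value v with
    | empty => exact fun _ _ => ⟨1, fun _ => Commute.one_left _, by simp, by simp⟩
    | insert ν S hν hmax ih =>
      intro h1 h2
      obtain ⟨P, hP1, hP2, hP3⟩ := ih (fun ξ hξ => h1 ξ (Finset.mem_insert_of_mem hξ))
        fun ξ hξ η hη => (Finset.mem_insert.1 (h2 ξ (Finset.mem_insert_of_mem hξ) η hη)).resolve_left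
          fun he => ((hmax ξ hξ).trans_lt' (he ▸ hη)).false
      obtain ⟨i, hi⟩ := hsep ν (h1 ν (Finset.mem_insert_self _ _))
      have hi' := sub_ne_zero.2 hi.symm
      set a := heckeGamma m k c p ν i
      set d := heckeGamma m k c p μ i
      have hcomm : Commute P (Y i - a • 1) :=
        (hP1 i).sub_right ((Commute.one_right P).smul_right a)
      -- The factor $Y_i-a$ sends the new monomial $x^\nu$ to lower terms, which $P$ kills, and it
      -- multiplies the leading term of $x^\mu$ by $d-a\neq0$.
      refine ⟨(d - a)⁻¹ • (P * (Y i - a • 1)), fun j => ?_, fun ξ hξ => ?_, ?_⟩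
      · refine ((hP1 j).mul_left (Commute.sub_left ?_ ?_)).smul_left _
        · exact commute_heckeY hp hc.ne_zero i j
        · exact (Commute.one_left _).smul_left a
      · rw [LinearMap.smul_apply]
        rcases Finset.mem_insert.1 hξ with rfl | hξ'
        · have h3 : (Y i - a • 1) (mono ξ) ∈ lowerSpan R v (v ξ) := (hlead i ξ).sub_mem
          have h4 : lowerSpan R v (v ξ) ≤ LinearMap.ker P := by
            refine Submodule.span_le.2 ?_
            rintro _ ⟨η, hη, rfl⟩
            refine hP2 η ((Finset.mem_insert.1 (h2 ξ hξ η hη)).resolve_left ?_)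
            rintro rfl
            exact (show v η < v η from hη).false
          rw [Module.End.mul_apply, LinearMap.mem_ker.1 (h4 h3), smul_zero]
        · rw [hcomm.eq, Module.End.mul_apply, hP2 ξ hξ', map_zero, smul_zero]
      · have h3 := (hlead i μ).sub_mem
        have h4 : (Y i) (P (mono μ) - mono μ) ∈ lowerSpan R v (v μ) := (hfilt i).apply_mem hP3
        rw [hcomm.eq, LinearMap.smul_apply, Module.End.mul_apply, LinearMap.sub_apply,
          LinearMap.smul_apply, Module.End.one_apply]
        have h5 : (d - a)⁻¹ • (Y i (P (mono μ)) - a • P (mono μ)) - mono μ =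
            (d - a)⁻¹ • (Y i (P (mono μ) - mono μ) - a • (P (mono μ) - mono μ) +
              (Y i (mono μ) - d • mono μ)) := by
          rw [eq_inv_smul_iff₀ hi', smul_sub, smul_inv_smul₀ hi', map_sub]
          module
        rw [h5]
        exact Submodule.smul_mem _ _ (add_mem (sub_mem h4 (Submodule.smul_mem _ _ hP3)) h3)
  obtain ⟨P, hP1, hP2, hP3⟩ := key (finite_value_lt (rho r) (v μ)).toFinset (by simp [hv])
    (by simp only [Set.Finite.mem_toFinset, Set.mem_ofPred_eq]
        exact fun ν hν ξ hξ => hξ.trans hν)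
  refine ⟨P (mono μ), fun i => ?_, ?_⟩
  · have h4 : lowerSpan R v (v μ) ≤ LinearMap.ker P := by
      refine Submodule.span_le.2 ?_
      rintro _ ⟨η, hη, rfl⟩
      exact hP2 η (by simpa using hη)
    have h5 := LinearMap.mem_ker.1 (h4 (hlead i μ).sub_mem)
    rw [map_sub, map_smul, sub_eq_zero] at h5
    rw [← h5, ← Module.End.mul_apply, ← Module.End.mul_apply, (hP1 i).eq]
  · have h6 := coeff_eq_zero_of_mem_lowerSpan hP3 (lt_irrefl _)
    rw [AddMonoidAlgebra.coeff_sub, Finsupp.sub_apply, mono_coeff, if_pos rfl, sub_eq_zero] at h6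
    exact h6

/-- At an exponent $\nu$ of maximal value in the support only the diagonal term contributes to
$Y_iD$. So $D$ has the eigenvalues of $\nu$, which forces $\nu=\mu$. Ties in the value do no harm,
because off-diagonal terms are strictly lower. -/
theorem eq_zero_of_heckeY_apply (hp : IsHeckeParam m k p) (hc : IsGenericParam k c p)
    {μ : Fin r → ℤ} {D : Laurent r R} (hD : ∀ i, heckeY m k c p i D = heckeGamma m k c p μ i • D)
    (hμ : D.coeff μ = 0) : D = 0 := by
  classical
  by_contra hne
  have hs : D.coeff.support.Nonempty := by
    rw [Finsupp.support_nonempty_iff]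
    simpa using hne
  obtain ⟨ν, hν, hmax⟩ := Finset.exists_max_image D.coeff.support (value (rho r)) hs
  have hν' := Finsupp.mem_support_iff.1 hν
  suffices h : ν = μ from hν' (h ▸ hμ)
  refine heckeGamma_injective hp hc fun i => ?_
  have h1 : (heckeY m k c p i D).coeff ν = heckeGamma m k c p ν i * D.coeff ν := by
    conv_lhs => rw [sum_coeff_smul_mono D]
    rw [Finsupp.sum, map_sum, AddMonoidAlgebra.coeff_sum, Finsupp.finsetSum_apply,
      Finset.sum_eq_single_of_mem ν hν]
    · have h := coeff_eq_zero_of_mem_lowerSpan (isLeading_heckeY (c := c) hp i ν).sub_mem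
        (lt_irrefl (value (rho r) ν))
      rw [AddMonoidAlgebra.coeff_sub, Finsupp.sub_apply, AddMonoidAlgebra.coeff_smul,
        Finsupp.smul_apply, mono_coeff, if_pos rfl, sub_eq_zero] at h
      rw [map_smul, AddMonoidAlgebra.coeff_smul, Finsupp.smul_apply, h, smul_eq_mul, smul_eq_mul,
        mul_one, mul_comm]
    · intro ξ hξ hξν
      have h := coeff_eq_zero_of_mem_lowerSpan (isLeading_heckeY (c := c) hp i ξ).sub_mem
        (hmax ξ hξ).not_gt
      rw [AddMonoidAlgebra.coeff_sub, Finsupp.sub_apply, AddMonoidAlgebra.coeff_smul,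
        Finsupp.smul_apply, mono_coeff, if_neg hξν, smul_zero, sub_zero] at h
      rw [map_smul, AddMonoidAlgebra.coeff_smul, Finsupp.smul_apply, h, smul_zero]
  rw [hD, AddMonoidAlgebra.coeff_smul, Finsupp.smul_apply, smul_eq_mul] at h1
  exact (mul_right_cancel₀ hν' h1).symm

theorem IsHeckeEigen.unique (hp : IsHeckeParam m k p) (hc : IsGenericParam k c p)
    {μ : Fin r → ℤ} {E E' : Laurent r R} (h : IsHeckeEigen m k c p μ E)
    (h' : IsHeckeEigen m k c p μ E') : E = E' := by
  refine sub_eq_zero.1 (eq_zero_of_heckeY_apply hp hc (μ := μ) (fun i => ?_) ?_)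
  · rw [map_sub, h.1, h'.1, smul_sub]
  · rw [AddMonoidAlgebra.coeff_sub, Finsupp.sub_apply, h.2, h'.2, sub_self]

end Eigenfunctions

/-! ### Substitutions carry eigenfunctions to eigenfunctions. -/

section Transport

variable {r : ℕ} {R S : Type} [Field R] [Field S] {m m' : ℕ} {k c : R} {k' c' : S} {p : ℤ → R}
  {p' : ℤ → S}

/-- `substLaurent` as a semilinear map. -/
noncomputable def substSemilinear (f : R →+* S) (d : ℕ) : Laurent r R →ₛₗ[f] Laurent r S where
  toFun := substLaurent f d
  map_add' x y := by simp [substLaurent, AddMonoidAlgebra.mapDomain_add]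
  map_smul' a x := by
    induction x using AddMonoidAlgebra.induction_linear with
    | zero => simp [substLaurent]
    | add x y hx hy =>
      simp only [substLaurent, smul_add, map_add, AddMonoidAlgebra.mapDomain_add] at hx hy ⊢
      rw [hx, hy]
    | single ν b =>
      simp [substLaurent, AddMonoidAlgebra.smul_single]

theorem substSemilinear_apply (f : R →+* S) (d : ℕ) (x : Laurent r R) :
    substSemilinear f d x = substLaurent f d x := rfl

theorem substSemilinear_mono (f : R →+* S) (d : ℕ) (ν : Fin r → ℤ) :
    substSemilinear f d (mono ν) = mono ((d : ℤ) • ν) := by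
  simp [substSemilinear_apply, substLaurent, mono]

/-- The substitution `f`, `x ↦ x^d` carries the parameters `(m, k, c, p)` to
`(m', k', c', p')`. -/
structure IsParamMap (f : R →+* S) (d m m' : ℕ) (k c : R) (k' c' : S) (p : ℤ → R) (p' : ℤ → S) :
    Prop where
  pos : 0 < d
  eq_mul : m' = d * m
  map_k : f k = k'
  map_c : f c = c' ^ d
  map_p : ∀ s, p' (d * s) = f (p s)

variable {f : R →+* S} {d : ℕ}

theorem pairing_smul (z : ℤ) (ν : Fin r → ℤ) (i : Fin (r - 1)) :
    pairing (z • ν) i = z * pairing ν i := by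
  simp [pairing, mul_sub]

/-- Scaling exponents by $d$ turns strings of step $m\alpha_i$ into strings of step $dm\alpha_i$ and
keeps the integer quotient, as $\lfloor ds/dm\rfloor=\lfloor s/m\rfloor$. -/
theorem IsParamMap.subst_heckeT (H : IsParamMap f d m m' k c k' c' p p') (i : Fin (r - 1))
    (x : Laurent r R) :
    substSemilinear f d (heckeT m k p i x) = heckeT m' k' p' i (substSemilinear f d x) := by
  refine semilinear_comp_heckeT _ i i (fun _ => 1) (fun ν => (d : ℤ) • ν) H.map_k (fun ν z => ?_)
    (fun ν => ?_) (fun ν => ?_) (fun ν => ?_) x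
  · rw [substSemilinear_mono, one_smul, H.eq_mul]
    congr 1
    push_cast
    module
  · rw [substSemilinear_mono, one_smul, reflect_eq_sub, reflect_eq_sub, pairing_smul]
    congr 1
    module
  · rw [pairing_smul, H.eq_mul]
    push_cast
    exact Int.mul_ediv_mul_of_pos _ _ (by exact_mod_cast H.pos)
  · rw [pairing_smul, H.map_p]

theorem IsParamMap.subst_heckeTInv (H : IsParamMap f d m m' k c k' c' p p') (i : Fin (r - 1))
    (x : Laurent r R) :
    substSemilinear f d (heckeTInv m k p i x) = heckeTInv m' k' p' i (substSemilinear f d x) := by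
  simp only [heckeTInv, LinearMap.sub_apply, LinearMap.smul_apply, Module.End.one_apply, map_sub,
    map_smulₛₗ, H.subst_heckeT, map_inv₀, H.map_k]

theorem list_prod_intertwine {ι : Type*} (W : Laurent r R → Laurent r S)
    (A : ι → Module.End R (Laurent r R)) (B : ι → Module.End S (Laurent r S))
    (h : ∀ i x, W (A i x) = B i (W x)) (L : List ι) (x : Laurent r R) :
    W ((L.map A).prod x) = (L.map B).prod (W x) := by
  induction L with
  | nil => rfl
  | cons i L ih =>
    rw [List.map_cons, List.map_cons, List.prod_cons, List.prod_cons, Module.End.mul_apply,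
      Module.End.mul_apply, h, ih]

theorem IsParamMap.map_heckeSigma (H : IsParamMap f d m m' k c k' c' p p') (s : ℤ) :
    f (heckeSigma m k p s) = heckeSigma m' k' p' (d * s) := by
  have hd : (0 : ℤ) < d := by exact_mod_cast H.pos
  have h1 : (0 < (d : ℤ) * s) ↔ 0 < s := mul_pos_iff_of_pos_left hd
  have h2 : ((m' : ℤ) ∣ d * s) ↔ (m : ℤ) ∣ s := by
    rw [H.eq_mul]
    push_cast
    exact mul_dvd_mul_iff_left hd.ne'
  unfold heckeSigma
  simp only [h1, h2]
  split_ifs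
  · rw [map_inv₀, H.map_k]
  · rw [H.map_p]

theorem IsParamMap.map_heckeGamma (H : IsParamMap f d m m' k c k' c' p p') (μ : Fin r → ℤ)
    (i : Fin r) :
    f (heckeGamma m k c p μ i) = heckeGamma m' k' c' p' ((d : ℤ) • μ) i := by
  simp only [heckeGamma, map_mul, map_prod, map_inv₀, map_zpow₀, H.map_heckeSigma, H.map_c,
    Pi.smul_apply, smul_eq_mul, mul_sub]
  rw [← zpow_natCast, ← zpow_mul, mul_neg]

theorem coeff_substSemilinear (hd : 0 < d) (x : Laurent r R) (ν : Fin r → ℤ) :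
    (substSemilinear f d x).coeff ((d : ℤ) • ν) = f (x.coeff ν) := by
  have hd' : (d : ℤ) ≠ 0 := by omega
  induction x using AddMonoidAlgebra.induction_linear with
  | zero => simp
  | add x y hx hy =>
    rw [map_add, AddMonoidAlgebra.coeff_add, Finsupp.add_apply, hx, hy, AddMonoidAlgebra.coeff_add,
      Finsupp.add_apply, map_add]
  | single ξ b =>
    have e : (AddMonoidAlgebra.single ξ b : Laurent r R) = b • mono ξ := by simp [mono]
    have e' : (d : ℤ) • ξ = (d : ℤ) • ν ↔ ξ = ν := smul_right_inj hd'
    rw [e, map_smulₛₗ (substSemilinear f d), substSemilinear_mono, AddMonoidAlgebra.coeff_smul, Finsupp.smul_apply,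
      AddMonoidAlgebra.coeff_smul, Finsupp.smul_apply, mono_coeff, mono_coeff]
    rw [if_congr e' rfl rfl]
    split_ifs <;> simp

variable [NeZero r]

theorem IsParamMap.subst_omegaOp (H : IsParamMap f d m m' k c k' c' p p') (x : Laurent r R) :
    substSemilinear f d (omegaOp c x) = omegaOp c' (substSemilinear f d x) := by
  have key : (substSemilinear f d).comp (omegaOp c : Module.End R (Laurent r R)) =
      (omegaOp c' : Module.End S (Laurent r S)).comp (substSemilinear f d) := by
    refine semilinear_ext fun ν => ?_
    simp only [LinearMap.comp_apply, substSemilinear_mono, omegaOp_mono, map_smulₛₗ, map_zpow₀,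
      H.map_c]
    rw [← zpow_natCast, ← zpow_mul]
    congr 2
    change (d : ℤ) * -lastCoord ν = -(d * lastCoord ν)
    ring
  exact LinearMap.congr_fun key x

theorem IsParamMap.subst_heckeY (H : IsParamMap f d m m' k c k' c' p p') (i : Fin r)
    (x : Laurent r R) :
    substSemilinear f d (heckeY m k c p i x) = heckeY m' k' c' p' i (substSemilinear f d x) := by
  rw [heckeY, heckeY, yOp, yOp, Module.End.mul_apply, Module.End.mul_apply, Module.End.mul_apply,
    Module.End.mul_apply, list_prod_intertwine _ _ _ H.subst_heckeTInv, H.subst_omegaOp,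
    list_prod_intertwine _ _ _ H.subst_heckeT]

theorem IsParamMap.isHeckeEigen (H : IsParamMap f d m m' k c k' c' p p') {μ : Fin r → ℤ}
    {E : Laurent r R} (hE : IsHeckeEigen m k c p μ E) :
    IsHeckeEigen m' k' c' p' ((d : ℤ) • μ) (substLaurent f d E) := by
  rw [← substSemilinear_apply]
  refine ⟨fun i => ?_, ?_⟩
  · rw [← H.subst_heckeY, hE.1, map_smulₛₗ, H.map_heckeGamma]
  · rw [coeff_substSemilinear H.pos, hE.2, map_one]

end Transport

/-! ### The metaplectic and Macdonald parameters satisfy the hypotheses. -/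

section Parameters

theorem q_ne_zero : q ≠ 0 := by
  unfold q
  simp

theorem zpow_eq_one_of_pow {R : Type*} [Field R] {x : R} (h : ∀ N : ℕ, x ^ N = 1 → N = 0) (a : ℤ)
    (ha : x ^ a = 1) : a = 0 := by
  obtain ⟨N, rfl | rfl⟩ := a.eq_nat_or_neg
  · rw [zpow_natCast] at ha
    simp [h N ha]
  · rw [zpow_neg, inv_eq_one, zpow_natCast] at ha
    simp [h N ha]

theorem q_pow_eq_one (N : ℕ) (h : q ^ N = 1) : N = 0 := by
  have h1 : (Polynomial.X : Polynomial FieldCk) ^ N = 1 :=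
    IsFractionRing.injective (Polynomial FieldCk) BaseField (by rw [map_pow, map_one]; exact h)
  have h2 := congrArg Polynomial.natDegree h1
  simpa using h2

theorem qK_pow_eq_one (n N : ℕ) (h : qK n ^ N = 1) : N = 0 := by
  refine q_pow_eq_one N ((algebraMap BaseField (K n)).injective ?_)
  rw [map_pow, map_one]
  exact h

theorem substQ_map_injective (n : ℕ) :
    Function.Injective (MvPolynomial.map (σ := Fin ((n - 1) / 2)) (substQ 2).toRingHom) :=
  MvPolynomial.map_injective _ (RingHom.injective _)

/-- The endomorphism of `K⁽ⁿ⁾` that maps `q` to `q²` and fixes `k` and the `g_j`. -/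
noncomputable def squareQ (n : ℕ) : K n →+* K n := IsFractionRing.map (substQ_map_injective n)

theorem squareQ_algebraMap (n : ℕ) (a : BaseField) :
    squareQ n (algebraMap BaseField (K n) a) = algebraMap BaseField (K n) (substQ 2 a) := by
  rw [IsScalarTower.algebraMap_apply BaseField (MvPolynomial (Fin ((n - 1) / 2)) BaseField) (K n),
    squareQ, IsFractionRing.map, IsLocalization.map_eq, MvPolynomial.algebraMap_eq,
    MvPolynomial.map_C]
  rfl

theorem squareQ_gVar (n : ℕ) (i : Fin ((n - 1) / 2)) : squareQ n (gVar n i) = gVar n i := by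
  rw [gVar, squareQ, IsFractionRing.map, IsLocalization.map_eq, MvPolynomial.map_X]

theorem squareQ_kK (n : ℕ) : squareQ n (kK n) = kK n := by
  rw [kK, squareQ_algebraMap, substQ_k]

theorem squareQ_g (ε : ℤˣ) (n : ℕ) (j : ℤ) : squareQ n (g ε n j) = g ε n j := by
  unfold g gRem
  split_ifs
  · simp
  · exact squareQ_gVar n _
  · simp [squareQ_kK]
  · simp [squareQ_kK, squareQ_gVar]
  · simp

variable (ε : ℤˣ) (n : ℕ) (κ : ℤ)

/-- The function `s ↦ -k g_{-κ s}⁽ⁿ⁾`. -/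
noncomputable def metaP (s : ℤ) : K n := -kK n * g ε n (-(κ * s))

theorem dvd_mul_iff_dvd_of_mul_gcd {n m : ℕ} [NeZero n] {c : ℤ}
    (hm : m * Int.gcd (n : ℤ) c = n) (s : ℤ) : (n : ℤ) ∣ c * s ↔ (m : ℤ) ∣ s := by
  set d := Int.gcd (n : ℤ) c with hd
  have hd0 : d ≠ 0 := fun h => NeZero.ne n (by rw [← hm, h, mul_zero])
  obtain ⟨u, hu⟩ : (d : ℤ) ∣ c := Int.gcd_dvd_right ..
  have hmn : (n : ℤ) = m * d := by exact_mod_cast hm.symm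
  have hcop : IsCoprime (m : ℤ) u := by
    rw [Int.isCoprime_iff_gcd_eq_one]
    have h1 : Int.gcd (n : ℤ) c = Int.gcd (m : ℤ) u * d := by
      rw [hmn, hu, mul_comm (d : ℤ) u, Int.gcd_mul_right]
      simp
    rw [← hd] at h1
    have h2 : 1 * d = Int.gcd (m : ℤ) u * d := by rw [one_mul]; exact h1
    exact (Nat.eq_of_mul_eq_mul_right (Nat.pos_of_ne_zero hd0) h2).symm
  rw [hmn, hu, mul_comm (m : ℤ), mul_assoc, mul_dvd_mul_iff_left (by exact_mod_cast hd0)]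
  exact ⟨hcop.dvd_of_dvd_mul_left, fun h => h.mul_left u⟩

theorem dvd_mul_iff_mOf_dvd [NeZero n] (s : ℤ) : (n : ℤ) ∣ κ * s ↔ (mOf n κ : ℤ) ∣ s :=
  dvd_mul_iff_dvd_of_mul_gcd (mOf_mul_kappa' n κ) s

/-- The period $m$ comes from $n\mid\kappa s\iff m\mid s$, the value at $0$ from $g_0=-1$, and
$p(s)p(-s)=1$ from $g_jg_{-j}=k^{-2}$ for $n\nmid j$. -/
theorem isHeckeParam_metaP [NeZero n] : IsHeckeParam (mOf n κ) (kK n) (metaP ε n κ) where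
  pos := Nat.pos_of_ne_zero (NeZero.ne _)
  ne_zero := kK_ne_zero n
  add_period s := by
    unfold metaP
    congr 1
    refine g_of_emod_eq ε n (Int.modEq_iff_dvd.2 ?_)
    rw [show -(κ * s) - -(κ * (s + mOf n κ)) = κ * mOf n κ by ring, dvd_mul_iff_mOf_dvd]
  zero := by simp [metaP, g_of_dvd]
  mul_neg s hs := by
    have h := g_mul_g_neg ε n (j := -(κ * s)) (by rwa [Int.dvd_neg, dvd_mul_iff_mOf_dvd])
    have hk := kK_ne_zero n
    unfold metaP
    rw [mul_neg, mul_mul_mul_comm, h]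
    field_simp

theorem isGenericParam_metaP [NeZero n] :
    IsGenericParam (kK n) (qK n ^ mOf n κ) (metaP ε n κ) where
  ne_zero := pow_ne_zero _ (by simpa [qK] using q_ne_zero)
  zpow_eq_one := zpow_eq_one_of_pow fun N hN => by
    rw [← pow_mul] at hN
    exact (Nat.mul_eq_zero.1 (qK_pow_eq_one n _ hN)).resolve_left (NeZero.ne _)
  exists_hom := ⟨squareQ n, by
    rw [map_pow, qK, squareQ_algebraMap, substQ_q, map_pow, ← pow_mul, ← pow_mul, mul_comm],
    squareQ_kK n, fun s => by rw [metaP, map_mul, map_neg, squareQ_kK, squareQ_g]⟩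

theorem isHeckeParam_k : IsHeckeParam 1 k fun _ => k where
  pos := one_pos
  ne_zero := k_ne_zero
  add_period _ := rfl
  zero := rfl
  mul_neg _ h := (h (by simp)).elim

theorem isGenericParam_k : IsGenericParam k q fun _ => k where
  ne_zero := q_ne_zero
  zpow_eq_one := zpow_eq_one_of_pow q_pow_eq_one
  exists_hom := ⟨(substQ 2).toRingHom, substQ_q 2, substQ_k 2, fun _ => substQ_k 2⟩

end Parameters

/-! ### Matching the general operators with the metaplectic and Macdonald ones. -/

section Comparison

variable {r : ℕ} (ε : ℤˣ) (n : ℕ) (κ : ℤ)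

theorem gammaPow_eq [NeZero n] (μ a : Fin r → ℤ) :
    gammaPow ε n κ μ a =
      ∏ i, heckeGamma (mOf n κ) (kK n) (qK n ^ mOf n κ) (metaP ε n κ) μ i ^ a i := by
  have hp := isHeckeParam_metaP ε n κ
  have hs : ∀ s, sigma ε n κ s = heckeSigma (mOf n κ) (kK n) (metaP ε n κ) s := fun _ => rfl
  have hq : qK n ≠ 0 := by simpa [qK] using q_ne_zero
  have h1 : ∏ i, ((qK n ^ mOf n κ) ^ (-μ i)) ^ a i =
      qK n ^ (-((mOf n κ : ℤ) * ∑ i, a i * μ i)) := by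
    rw [Finset.mul_sum, ← Finset.sum_neg_distrib]
    have : ∀ i, ((qK n ^ mOf n κ) ^ (-μ i)) ^ a i = qK n ^ (-((mOf n κ : ℤ) * (a i * μ i))) :=
      fun i => by
        rw [← zpow_natCast, ← zpow_mul, ← zpow_mul]
        congr 1
        ring
    simp only [this]
    induction (Finset.univ : Finset (Fin r)) using Finset.induction_on with
    | empty => simp
    | insert i s hi ih => rw [Finset.prod_insert hi, Finset.sum_insert hi, zpow_add₀ hq, ih]
  -- The inverse factors of $Y_i$ come from $j<i$. Interchanging the products puts them on the same
  -- pairs as the others, and the exponents combine to $a_i-a_j$.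
  have h2 : ∏ i : Fin r, ∏ j ∈ Finset.Iio i,
      ((heckeSigma (mOf n κ) (kK n) (metaP ε n κ) (μ j - μ i))⁻¹) ^ a i =
      ∏ j : Fin r, ∏ i ∈ Finset.Ioi j,
        ((heckeSigma (mOf n κ) (kK n) (metaP ε n κ) (μ j - μ i))⁻¹) ^ a i :=
    Finset.prod_comm' (by simp)
  simp only [gammaPow, heckeGamma, mul_zpow, Finset.prod_mul_distrib, h1, ← Finset.prod_zpow, h2,
    hs]
  rw [← Finset.prod_mul_distrib]
  congr 1
  refine Finset.prod_congr rfl fun i _ => ?_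
  rw [← Finset.prod_mul_distrib]
  refine Finset.prod_congr rfl fun j _ => ?_
  rw [zpow_sub₀ (heckeSigma_ne_zero hp _), inv_zpow, div_eq_mul_inv]

theorem pow_apply_of_eigen {R : Type} [Field R] {A : Module.End R (Laurent r R)} {d : R}
    {E : Laurent r R} (h : A E = d • E) (N : ℕ) : (A ^ N) E = d ^ N • E := by
  induction N with
  | zero => simp
  | succ N ih => rw [pow_succ, Module.End.mul_apply, h, map_smul, ih, smul_smul, pow_succ, mul_comm]

theorem substLaurent_one {R S : Type} [Field R] [Field S] (f : R →+* S) (E : Laurent r R) :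
    substLaurent f 1 E = AddMonoidAlgebra.mapRingHom (Fin r → ℤ) f E := by
  have h : (fun ν : Fin r → ℤ => ((1 : ℕ) : ℤ) • ν) = id := by funext ν; simp
  rw [substLaurent, h]
  generalize AddMonoidAlgebra.mapRingHom (Fin r → ℤ) f E = x
  induction x using AddMonoidAlgebra.induction_linear with
  | zero => simp
  | add x y hx hy => rw [AddMonoidAlgebra.mapDomain_add, hx, hy]
  | single ν b => rw [AddMonoidAlgebra.mapDomain_single, id]

theorem macT_eq (i : Fin (r - 1)) : macT i = heckeT 1 k (fun _ => k) i := by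
  refine end_ext fun ν => ?_
  rw [macT, ofMonomials_mono, heckeT_mono, add_comm]
  simp

theorem macTInv_eq (i : Fin (r - 1)) : macTInv i = heckeTInv 1 k (fun _ => k) i := by
  rw [macTInv, heckeTInv, macT_eq]

theorem macGamma_eq (μ : Fin r → ℤ) (i : Fin r) :
    q ^ (-μ i) * k ^ macExponent μ i = heckeGamma 1 k q (fun _ => k) μ i := by
  have hk := k_ne_zero
  -- For $m=1$ every integer is a multiple of $m$, so $\sigma$ sees only the sign. The value
  -- $\sigma(0)=k$ gives the tie-breaking rule in $e_i(\mu)$.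
  have hs : ∀ s, heckeSigma 1 k (fun _ => k) s = k ^ (if 0 < s then -1 else 1 : ℤ) := fun s => by
    simp only [heckeSigma, Nat.cast_one, one_dvd, and_true]
    split_ifs <;> simp
  have hprod : ∀ (s : Finset (Fin r)) (f : Fin r → ℤ), ∏ j ∈ s, k ^ f j = k ^ ∑ j ∈ s, f j :=
    fun s f => by
      induction s using Finset.induction_on with
      | empty => simp
      | insert j s hj ih => rw [Finset.prod_insert hj, Finset.sum_insert hj, zpow_add₀ hk, ih]
  rw [heckeGamma]
  simp only [hs, ← zpow_neg, hprod, ← zpow_add₀ hk]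
  congr 2
  rw [macExponent, Finset.card_filter, Finset.card_filter]
  push_cast
  rw [← Finset.sum_sub_distrib]
  have e1 : Finset.Ioi i = Finset.univ.filter fun j => i < j := by ext; simp
  have e2 : Finset.Iio i = Finset.univ.filter fun j => j < i := by ext; simp
  rw [e1, e2, Finset.sum_filter, Finset.sum_filter, ← Finset.sum_add_distrib]
  refine Finset.sum_congr rfl fun j _ => ?_
  rcases lt_trichotomy i j with h | rfl | h
  · simp only [h, h.not_gt, sub_pos, if_true, if_false, and_true, and_false, or_false, add_zero]
    split_ifs <;> omega
  · simp
  · simp only [h, h.not_gt, sub_pos, if_true, if_false, and_true, and_false, or_false, zero_add]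
    split_ifs <;> omega

variable [NeZero r]

theorem opY_eq (i : Fin r) :
    opY ε n κ i = heckeY (mOf n κ) (kK n) (qK n ^ mOf n κ) (metaP ε n κ) i := rfl

theorem opYInv_eq (i : Fin r) :
    opYInv ε n κ i = yInvOp (heckeT (mOf n κ) (kK n) (metaP ε n κ))
      (heckeTInv (mOf n κ) (kK n) (metaP ε n κ)) (omegaInvOp (qK n ^ mOf n κ)) i := rfl

theorem opYPow_single (i : Fin r) : opYPow ε n κ (Pi.single i 1) = opY ε n κ i := by
  have h : ∀ l : Fin r, (if 0 ≤ (Pi.single i 1 : Fin r → ℤ) l then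
      opY ε n κ l ^ ((Pi.single i 1 : Fin r → ℤ) l).toNat
      else opYInv ε n κ l ^ (-(Pi.single i 1 : Fin r → ℤ) l).toNat) =
      if l = i then opY ε n κ l else 1 := fun l => by
    by_cases hl : l = i
    · subst hl; simp
    · simp [hl]
  rw [opYPow]
  simp only [h]
  have h2 : ∀ L : List (Fin r), L.Nodup →
      (L.map fun l => if l = i then opY ε n κ l else 1).prod =
        if i ∈ L then opY ε n κ i else 1 := fun L hL => by
    induction L with
    | nil => simp
    | cons l L ih =>
      rw [List.nodup_cons] at hL
      rw [List.map_cons, List.prod_cons, ih hL.2]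
      by_cases hl : l = i
      · subst hl; simp [hL.1]
      · simp [hl, Ne.symm hl]
  rw [h2 _ (List.nodup_finRange r), if_pos (List.mem_finRange i)]

/-- Unit vectors $a=\epsilon_i$ give one direction; for the other, the inverse operators act by
inverse eigenvalues, which are nonzero. -/
theorem opYPow_apply_iff [NeZero n] (μ : Fin r → ℤ) (E : Laurent r (K n)) :
    (∀ a : Fin r → ℤ, opYPow ε n κ a E = gammaPow ε n κ μ a • E) ↔
      ∀ i, heckeY (mOf n κ) (kK n) (qK n ^ mOf n κ) (metaP ε n κ) i E =
        heckeGamma (mOf n κ) (kK n) (qK n ^ mOf n κ) (metaP ε n κ) μ i • E := by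
  have hp := isHeckeParam_metaP ε n κ
  have hc := (isGenericParam_metaP ε n κ).ne_zero
  constructor
  · intro h i
    have h1 := h (Pi.single i 1)
    rw [opYPow_single, opY_eq, gammaPow_eq, Finset.prod_eq_single i] at h1
    · simpa using h1
    · intro j _ hj
      simp [hj]
    · simp
  · intro h a
    rw [gammaPow_eq, Fin.prod_univ_def, opYPow]
    have hl : ∀ l : Fin r, (if 0 ≤ a l then opY ε n κ l ^ (a l).toNat
        else opYInv ε n κ l ^ (-a l).toNat) E =
        heckeGamma (mOf n κ) (kK n) (qK n ^ mOf n κ) (metaP ε n κ) μ l ^ a l • E := fun l => by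
      split_ifs with h0
      · rw [opY_eq, pow_apply_of_eigen (h l), ← zpow_natCast, Int.toNat_of_nonneg h0]
      · rw [opYInv_eq, pow_apply_of_eigen (yInvOp_apply_of_heckeY_apply hp hc l
          (heckeGamma_ne_zero hp hc μ l) (h l)), ← zpow_natCast, Int.toNat_of_nonneg (by omega),
          inv_zpow, ← zpow_neg, neg_neg]
    induction List.finRange r with
    | nil => simp
    | cons l L ih =>
      rw [List.map_cons, List.map_cons, List.prod_cons, List.prod_cons, Module.End.mul_apply, ih,
        map_smul, hl, smul_smul, mul_comm]

theorem isMetaplecticPolynomial_iff [NeZero n] (μ : Fin r → ℤ) (E : Laurent r (K n)) :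
    IsMetaplecticPolynomial ε n κ μ E ↔ (∀ ν, E.coeff ν ∈ subfieldK ε n κ) ∧
      IsHeckeEigen (mOf n κ) (kK n) (qK n ^ mOf n κ) (metaP ε n κ) μ E := by
  rw [IsMetaplecticPolynomial, opYPow_apply_iff, IsHeckeEigen]

theorem IsMetaplecticPolynomial.unique [NeZero n] {μ : Fin r → ℤ} {E E' : Laurent r (K n)}
    (h : IsMetaplecticPolynomial ε n κ μ E) (h' : IsMetaplecticPolynomial ε n κ μ E') : E = E' :=
  IsHeckeEigen.unique (isHeckeParam_metaP ε n κ) (isGenericParam_metaP ε n κ)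
    ((isMetaplecticPolynomial_iff ε n κ μ E).1 h).2
    ((isMetaplecticPolynomial_iff ε n κ μ E').1 h').2

theorem metaplecticE_eq [NeZero n] {μ : Fin r → ℤ} {E : Laurent r (K n)}
    (h : IsMetaplecticPolynomial ε n κ μ E) : metaplecticE ε n κ μ = E :=
  IsMetaplecticPolynomial.unique ε n κ (Classical.epsilon_spec ⟨E, h⟩) h

theorem mOf_one : mOf n 1 = n := by simp [mOf, kappa']

/-- For $\kappa=1$ the image of $\iota_\kappa$ contains all the free variables, so the condition on
coefficients is void. -/
theorem subfieldK_one [NeZero n] (x : K n) : x ∈ subfieldK ε n 1 := by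
  have hX : ∀ i, gVar n i ∈ subfieldK ε n 1 := fun i =>
    ⟨g ε (mOf n 1) ((i : ℕ) + 1), by
      rw [← g_var ε n i]
      have := iota_g ε n 1 ((i : ℕ) + 1)
      rw [one_mul] at this
      exact this⟩
  have hP : ∀ P : MvPolynomial (Fin ((n - 1) / 2)) BaseField,
      algebraMap _ (K n) P ∈ subfieldK ε n 1 := fun P => by
    induction P using MvPolynomial.induction_on with
    | C a => exact (subfieldK ε n 1).algebraMap_mem a
    | add P P' h h' => rw [map_add]; exact add_mem h h'
    | mul_X P i h => rw [map_mul]; exact mul_mem h (hX i)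
  obtain ⟨a, b, -, rfl⟩ := IsFractionRing.div_surjective
    (A := MvPolynomial (Fin ((n - 1) / 2)) BaseField) x
  exact div_mem (hP a) (hP b)

theorem exists_isMetaplecticPolynomial_one [NeZero n] (μ : Fin r → ℤ) :
    ∃ E, IsMetaplecticPolynomial ε n 1 μ E := by
  obtain ⟨E, hE⟩ := exists_isHeckeEigen (isHeckeParam_metaP ε n 1) (isGenericParam_metaP ε n 1) μ
  exact ⟨E, (isMetaplecticPolynomial_iff ε n 1 μ E).2 ⟨fun ν => subfieldK_one ε n _, hE⟩⟩

theorem isParamMap_iota [NeZero n] :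
    IsParamMap (iota ε n κ).toRingHom 1 (mOf (mOf n κ) 1) (mOf n κ) (kK (mOf n κ))
      (qK (mOf n κ) ^ mOf (mOf n κ) 1) (kK n) (qK n ^ mOf n κ) (metaP ε (mOf n κ) 1)
      (metaP ε n κ) where
  pos := one_pos
  eq_mul := by rw [mOf_one, one_mul]
  map_k := (iota ε n κ).commutes k
  map_c := by
    rw [map_pow, pow_one, mOf_one]
    exact congrArg (· ^ mOf n κ) ((iota ε n κ).commutes q)
  map_p s := by
    have h1 : (iota ε n κ) (kK (mOf n κ)) = kK n := (iota ε n κ).commutes k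
    change _ = iota ε n κ _
    rw [metaP, metaP, map_mul, map_neg, h1, iota_g]
    congr 2
    push_cast
    ring

theorem isParamMap_jHom [NeZero n] :
    IsParamMap (jHom ε n κ) (kappa' n κ) (mOf (mOf n κ) 1) (mOf n 1) (kK (mOf n κ))
      (qK (mOf n κ) ^ mOf (mOf n κ) 1) (kK n) (qK n ^ mOf n 1) (metaP ε (mOf n κ) 1)
      (metaP ε n 1) where
  pos := Nat.pos_of_ne_zero (NeZero.ne _)
  eq_mul := by rw [mOf_one, mOf_one, mul_comm, mOf_mul_kappa']
  map_k := by rw [kK, jHom_algebraMap, substQ_k, kK]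
  map_c := by
    rw [map_pow, mOf_one, mOf_one, qK, jHom_algebraMap, substQ_q, map_pow, ← qK, ← pow_mul,
      ← pow_mul]
    -- As $m\kappa'=n$, the image of $q^m$ is $q^{\kappa'^2m}=(q^n)^{\kappa'}$; this is why $q$ is
    -- raised to the power $\kappa'^2$.
    rw [show kappa' n κ ^ 2 * mOf n κ = mOf n κ * kappa' n κ * kappa' n κ by ring,
      mOf_mul_kappa']
  map_p s := by
    have h1 : jHom ε n κ (kK (mOf n κ)) = kK n := by rw [kK, jHom_algebraMap, substQ_k, kK]
    rw [metaP, metaP, map_mul, map_neg, h1, jHom_g]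
    congr 2
    ring

theorem isParamMap_macdonald [NeZero n] :
    IsParamMap ((algebraMap BaseField (K n)).comp (substQ (n ^ 2)).toRingHom) n 1 (mOf n 1) k q
      (kK n) (qK n ^ mOf n 1) (fun _ => k) (metaP ε n 1) where
  pos := Nat.pos_of_ne_zero (NeZero.ne _)
  eq_mul := by rw [mOf_one, mul_one]
  map_k := congrArg (algebraMap BaseField (K n)) (substQ_k (n ^ 2))
  map_c := by
    refine (congrArg (algebraMap BaseField (K n)) (substQ_q (n ^ 2))).trans ?_
    rw [map_pow, mOf_one, ← pow_mul, pow_two, qK]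
  map_p s := by
    refine Eq.trans ?_ (congrArg (algebraMap BaseField (K n)) (substQ_k (n ^ 2))).symm
    -- At multiples of $n$ all parameters $g$ equal $-1$, so only the Macdonald parameter $k$
    -- remains.
    rw [metaP, g_of_dvd ε n (by rw [one_mul, Int.dvd_neg]; exact dvd_mul_right _ _), kK]
    ring

theorem isMetaplecticPolynomial_iotaBar [NeZero n] {μ : Fin r → ℤ} {E : Laurent r (K (mOf n κ))}
    (h : IsMetaplecticPolynomial ε (mOf n κ) 1 μ E) :
    IsMetaplecticPolynomial ε n κ μ (iotaBar ε n κ E) := by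
  rw [isMetaplecticPolynomial_iff] at h ⊢
  refine ⟨fun ν => ⟨E.coeff ν, ?_⟩, ?_⟩
  · simp [iotaBar]
  · have h1 := (isParamMap_iota ε n κ).isHeckeEigen h.2
    rwa [substLaurent_one, Nat.cast_one, one_smul] at h1

theorem isMetaplecticPolynomial_jBar [NeZero n] {μ : Fin r → ℤ} {E : Laurent r (K (mOf n κ))}
    (h : IsMetaplecticPolynomial ε (mOf n κ) 1 μ E) :
    IsMetaplecticPolynomial ε n 1 ((kappa' n κ : ℤ) • μ) (jBar ε n κ E) := by
  rw [isMetaplecticPolynomial_iff] at h ⊢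
  exact ⟨fun ν => subfieldK_one ε n _, (isParamMap_jHom ε n κ).isHeckeEigen h.2⟩

theorem macY_eq (i : Fin r) : macY i = heckeY 1 k q (fun _ => k) i := by
  rw [macY, heckeY, funext macT_eq, funext macTInv_eq]

theorem isNonsymmetricMacdonald_iff (μ : Fin r → ℤ) (E : Laurent r BaseField) :
    IsNonsymmetricMacdonald μ E ↔ IsHeckeEigen 1 k q (fun _ => k) μ E := by
  simp only [IsNonsymmetricMacdonald, IsHeckeEigen, macY_eq, macGamma_eq]

theorem existsUnique_isNonsymmetricMacdonald (μ : Fin r → ℤ) :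
    ∃! E, IsNonsymmetricMacdonald μ E := by
  simp only [isNonsymmetricMacdonald_iff]
  obtain ⟨E, hE⟩ := exists_isHeckeEigen isHeckeParam_k isGenericParam_k μ
  exact ⟨E, hE, fun E' hE' => hE'.unique isHeckeParam_k isGenericParam_k hE⟩

end Comparison

end Metaplectic

theorem mainTheorem10 (r n : ℕ) [NeZero r] [NeZero n] (hr : 2 ≤ r) (κ : ℤ) (hκ : κ ≠ 0)
    (ε : ℤˣ) :
    -- the polynomials are well defined
    (∀ μ : Fin r → ℤ,
      (∃! E, IsMetaplecticPolynomial ε (mOf n κ) 1 μ E) ∧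
      (∃! E, IsMetaplecticPolynomial ε n κ μ E) ∧
      (∃! E, IsMetaplecticPolynomial ε n 1 μ E) ∧
      (∃! E, IsNonsymmetricMacdonald μ E)) ∧
    (∀ μ : Fin r → ℤ,
      iotaBar ε n κ (metaplecticE ε (mOf n κ) 1 μ) = metaplecticE ε n κ μ) ∧
    (∀ μ : Fin r → ℤ,
      jBar ε n κ (metaplecticE ε (mOf n κ) 1 μ) =
        metaplecticE ε n 1 ((kappa' n κ : ℤ) • μ)) ∧
    -- the variables `x_i` are replaced by `x_i ^ n`, and `q` by `q ^ (n ^ 2)`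
    (∀ μ : Fin r → ℤ,
      metaplecticE ε n 1 ((n : ℤ) • μ) =
        substLaurent ((algebraMap BaseField (K n)).comp (substQ (n ^ 2)).toRingHom) n
          (macdonaldE μ)) := by
  have hex := fun (N : ℕ) [NeZero N] (μ : Fin r → ℤ) => exists_isMetaplecticPolynomial_one ε N μ
  -- Existence for $(n,\kappa)$ is transported from $\mathbb K^{(m)}$, which places the coefficients
  -- in $\mathbb K^{(n,\kappa)}$. Uniqueness holds over all of $\mathbb K^{(n)}$.
  have hiota := fun μ : Fin r → ℤ =>
    isMetaplecticPolynomial_iotaBar ε n κ (Classical.epsilon_spec (hex (mOf n κ) μ))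
  refine ⟨fun μ => ⟨?_, ?_, ?_, existsUnique_isNonsymmetricMacdonald μ⟩, fun μ => ?_, fun μ => ?_,
    fun μ => ?_⟩
  · obtain ⟨E, hE⟩ := hex (mOf n κ) μ
    exact ⟨E, hE, fun E' hE' => hE'.unique ε _ 1 hE⟩
  · exact ⟨_, hiota μ, fun E' hE' => hE'.unique ε n κ (hiota μ)⟩
  · obtain ⟨E, hE⟩ := hex n μ
    exact ⟨E, hE, fun E' hE' => hE'.unique ε n 1 hE⟩
  · exact (metaplecticE_eq ε n κ (hiota μ)).symm
  · exact (metaplecticE_eq ε n 1 (isMetaplecticPolynomial_jBar ε n κ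
      (Classical.epsilon_spec (hex (mOf n κ) μ)))).symm
  · have h := (isNonsymmetricMacdonald_iff μ _).1
      (Classical.epsilon_spec (existsUnique_isNonsymmetricMacdonald μ).exists)
    exact metaplecticE_eq ε n 1 ((isMetaplecticPolynomial_iff ε n 1 _ _).2
      ⟨fun ν => subfieldK_one ε n _, (isParamMap_macdonald ε n).isHeckeEigen h⟩)
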